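/- Let $\mathcal V$ be a complete discrete valuation ring of mixed characteristic $(0,p)$ with perfect residue field $\kappa$, uniformizer $\varpi$ and fraction field $K$, with its absolute value $|\cdot|$. Let $U=\mathrm{Spf}\,A$ be a connected affine smooth formal curve over $\mathcal V$ (with ideal of definition $(\varpi)$) that has an étale coordinate $t\in A$, let $\partial$ be the derivation of $A$ with $\partial(t)=1$, let $x\in U$ be a closed point and let $k\ge 0$ be an integer. Put $A_K=A\otimes_{\mathcal V}K$ and let $|\cdot|$ also denote its spectral norm $|f|=\max_{z\in \mathrm{Spm} A_K}|f(z)|$. For an open $V\subseteq U$ let $\mathcal D_k(V)$ be the ring of finite sums $\sum_n a_n(\varpi^k\partial)^n$ with $a_n\in\mathcal O(V)$, and put $\widehat{\mathcal D}_k(V)=\varprojlim_i \mathcal D_k(V)/\varpi^i\mathcal D_k(V)$ and $\widehat{\mathcal D}_{k,\mathbb Q}(V)=\widehat{\mathcal D}_k(V)\otimes_{\mathcal V}K$. Every $H\in\widehat{\mathcal D}_{k,\mathbb Q}(U)$ is written uniquely $H=\sum_{n\ge 0}a_n(\varpi^k\partial)^n$ with $a_n\in A_K$, $|a_n|\to 0$.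 Put $$\|H\|_k=\max_n|a_n|,\qquad \overline N_k(H)=\max\{n: |a_n|=\|H\|_k\},\qquad N_k(H)=N(a_{\overline N_k(H)}),$$ where $N$ is defined as follows. Let $K'$ be a finite extension of $K$ whose residue field is identified with the residue field $\kappa(x)$ of $x$, let $\mathcal V'$ be its ring of integers, and let $c\in\mathcal V'$ be a lift of $t(x)\in\kappa(x)$. After extension of scalars to $K'$, the tube of (the corresponding rational point over) $x$ is an open unit disc with coordinate $t-c$, on which $f\in A_K$ has an expansion $\sum_{i\ge0}\alpha_i(t-c)^i$ with $\alpha_i\in K'$. Then $N(f)=\lim_{\lambda\to1^-}\max\{i:|\alpha_i|\lambda^i=\sup_j|\alpha_j|\lambda^j\}$. By convention $\overline N_k(0)=N(0)=N_k(0)=+\infty$. Then, for every $H\in\widehat{\mathcal D}_{k,\mathbb Q}(U)$ and every choice of $K'$ and $c$ as above: 1. $H$ is invertible in a neighbourhood of $x$ (that is, there is $f\in A$ with $f(x)\ne0$ such that the restriction of $H$ to $D(f)\subseteq U$ is invertible in $\widehat{\mathcal D}_{k,\mathbb Q}(D(f))$) if and only if $\overline N_k(H)=N_k(H)=0$. 2.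 If $\|H\|_k=1$, then for every $f\in A$ with $f(x)\neq0$ such that $H$ is invertible on $V=D(f)$, the inverse $H^{-1}$ belongs to $\widehat{\mathcal D}_k(V)$. 3. For every $Q\in\widehat{\mathcal D}_{k,\mathbb Q}(U)$ one has $\|HQ\|_k=\|H\|_k\,\|Q\|_k$, $\ \overline N_k(HQ)=\overline N_k(H)+\overline N_k(Q)$ and $N_k(HQ)=N_k(H)+N_k(Q)$. -/

import Mathlib

open scoped TensorProduct

noncomputable section

namespace ArithDiff

section FiniteOrder

variable {V R S : Type*} [CommRing V] [CommRing R] [Algebra V R] [CommRing S] [Algebra V S]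

/-- Operators of finite order `∑ aₙ δⁿ` with coefficients `aₙ ∈ R` on the left of the powers of a
derivation `δ`; the `n`-th value of the finitely supported function is `aₙ`. -/
def DiffOp (_δ : Derivation V R R) : Type _ := ℕ →₀ R

namespace DiffOp

variable {δ : Derivation V R R} {δ' : Derivation V S S}

instance : AddCommGroup (DiffOp δ) := inferInstanceAs (AddCommGroup (ℕ →₀ R))
instance : Module R (DiffOp δ) := inferInstanceAs (Module R (ℕ →₀ R))
instance : Module V (DiffOp δ) := inferInstanceAs (Module V (ℕ →₀ R))
instance : IsScalarTower V R (DiffOp δ) := inferInstanceAs (IsScalarTower V R (ℕ →₀ R))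
instance : SMulCommClass V R (DiffOp δ) := inferInstanceAs (SMulCommClass V R (ℕ →₀ R))

/-- The operator `a δⁿ`. -/
def monomial (δ : Derivation V R R) (n : ℕ) : R →ₗ[R] DiffOp δ :=
  (Finsupp.lsingle n : R →ₗ[R] (ℕ →₀ R))

/-- The coefficient `aₙ` of `∑ aₙ δⁿ`. -/
def coeff (δ : Derivation V R R) (n : ℕ) : DiffOp δ →ₗ[R] R :=
  (Finsupp.lapply n : (ℕ →₀ R) →ₗ[R] R)

/-- Left multiplication by `δ`: `δ · ∑ bₙ δⁿ = ∑ bₙ δⁿ⁺¹ + ∑ δ(bₙ) δⁿ`. -/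
def deltaMul (δ : Derivation V R R) : DiffOp δ →ₗ[V] DiffOp δ :=
  (Finsupp.lmapDomain R V Nat.succ + Finsupp.mapRange.linearMap (δ : R →ₗ[V] R) :
    (ℕ →₀ R) →ₗ[V] (ℕ →₀ R))

/-- Left multiplication by `∑ aₙ δⁿ`: `Q ↦ ∑ aₙ · (δ · (⋯ (δ · Q)))`. -/
def leftMul (δ : Derivation V R R) : DiffOp δ →ₗ[V] Module.End V (DiffOp δ) :=
  (Finsupp.lsum V fun n => (LinearMap.mulRight V (deltaMul δ ^ n)) ∘ₗ
      (Algebra.lsmul V V (DiffOp δ)).toLinearMap :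
    (ℕ →₀ R) →ₗ[V] Module.End V (DiffOp δ))

theorem induction_on {p : DiffOp δ → Prop} (P : DiffOp δ) (h0 : p 0)
    (ha : ∀ P Q, p P → p Q → p (P + Q)) (hm : ∀ n a, p (monomial δ n a)) : p P :=
  Finsupp.induction_linear P h0 ha hm

theorem hom_ext {M : Type*} [AddCommGroup M] [Module V M] {f g : DiffOp δ →ₗ[V] M}
    (h : ∀ n a, f (monomial δ n a) = g (monomial δ n a)) : f = g :=
  Finsupp.lhom_ext h

theorem ext {P Q : DiffOp δ} (h : ∀ n, coeff δ n P = coeff δ n Q) : P = Q :=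
  Finsupp.ext h

theorem leftMul_monomial (n : ℕ) (a : R) (Q : DiffOp δ) :
    leftMul δ (monomial δ n a) Q = a • (deltaMul δ ^ n) Q := by
  have : leftMul δ (monomial δ n a) = (LinearMap.mulRight V (deltaMul δ ^ n))
      ((Algebra.lsmul V V (DiffOp δ)).toLinearMap a) := Finsupp.lsum_single _ _ _ _
  rw [this]; rfl

theorem deltaMul_monomial (n : ℕ) (a : R) :
    deltaMul δ (monomial δ n a) = monomial δ (n + 1) a + monomial δ n (δ a) := by
  have h1 : (Finsupp.lmapDomain R V Nat.succ) (Finsupp.single n a) = Finsupp.single (n + 1) a :=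
    Finsupp.mapDomain_single
  have h2 : Finsupp.mapRange.linearMap (δ : R →ₗ[V] R) (Finsupp.single n a) =
      Finsupp.single n (δ a) := Finsupp.mapRange_single (hf := map_zero (δ : R →ₗ[V] R))
  exact congrArg₂ (· + ·) h1 h2

theorem smul_monomial (n : ℕ) (a b : R) : a • monomial δ n b = monomial δ n (a * b) :=
  ((monomial δ n).map_smul a b).symm

theorem deltaMul_smul (a : R) (Q : DiffOp δ) :
    deltaMul δ (a • Q) = a • deltaMul δ Q + δ a • Q := by
  induction Q using induction_on with
  | h0 => simp
  | ha P Q hP hQ => simp only [smul_add, map_add, hP, hQ]; abel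
  | hm n b =>
    simp only [smul_monomial, deltaMul_monomial, smul_add, Derivation.leibniz, map_add,
      smul_eq_mul, mul_comm b (δ a)]
    abel

theorem leftMul_smul (a : R) (P Q : DiffOp δ) : leftMul δ (a • P) Q = a • leftMul δ P Q := by
  induction P using induction_on with
  | h0 => simp
  | ha P P' hP hP' => simp only [smul_add, map_add, LinearMap.add_apply, hP, hP']
  | hm n b => rw [smul_monomial, leftMul_monomial, leftMul_monomial, mul_smul]

theorem leftMul_deltaMul (P Q : DiffOp δ) :
    leftMul δ (deltaMul δ P) Q = deltaMul δ (leftMul δ P Q) := by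
  induction P using induction_on with
  | h0 => simp
  | ha P P' hP hP' => simp only [map_add, LinearMap.add_apply, hP, hP']
  | hm n b =>
    rw [deltaMul_monomial, map_add, LinearMap.add_apply, leftMul_monomial, leftMul_monomial,
      leftMul_monomial, deltaMul_smul, pow_succ']
    rfl

theorem leftMul_deltaMul_pow (n : ℕ) (P Q : DiffOp δ) :
    leftMul δ ((deltaMul δ ^ n) P) Q = (deltaMul δ ^ n) (leftMul δ P Q) := by
  induction n with
  | zero => rfl
  | succ n ih => rw [pow_succ', Module.End.mul_apply, leftMul_deltaMul, ih]; rfl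

theorem leftMul_leftMul (P Q T : DiffOp δ) :
    leftMul δ (leftMul δ P Q) T = leftMul δ P (leftMul δ Q T) := by
  induction P using induction_on with
  | h0 => simp
  | ha P P' hP hP' => simp only [map_add, LinearMap.add_apply, hP, hP']
  | hm n b => rw [leftMul_monomial, leftMul_monomial, leftMul_smul, leftMul_deltaMul_pow]

theorem deltaMul_pow_one (n : ℕ) :
    (deltaMul δ ^ n) (monomial δ 0 1) = monomial δ n 1 := by
  induction n with
  | zero => rfl
  | succ n ih =>
    rw [pow_succ', Module.End.mul_apply, ih, deltaMul_monomial, Derivation.map_one_eq_zero,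
      map_zero, add_zero]

theorem leftMul_one (P : DiffOp δ) : leftMul δ P (monomial δ 0 1) = P := by
  induction P using induction_on with
  | h0 => simp
  | ha P P' hP hP' => simp only [map_add, LinearMap.add_apply, hP, hP']
  | hm n b => rw [leftMul_monomial, deltaMul_pow_one, smul_monomial, mul_one]

instance : One (DiffOp δ) := ⟨monomial δ 0 1⟩
instance : Mul (DiffOp δ) := ⟨fun P Q => leftMul δ P Q⟩

theorem one_def : (1 : DiffOp δ) = monomial δ 0 1 := rfl
theorem mul_def (P Q : DiffOp δ) : P * Q = leftMul δ P Q := rfl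

/-- The ring structure, determined by `δ · a = a · δ + δ(a)`. -/
instance : Ring (DiffOp δ) :=
  { (inferInstance : AddCommGroup (DiffOp δ)) with
    left_distrib := fun P Q T => by simp only [mul_def, map_add]
    right_distrib := fun P Q T => by simp only [mul_def, map_add, LinearMap.add_apply]
    zero_mul := fun P => by simp only [mul_def, map_zero, LinearMap.zero_apply]
    mul_zero := fun P => by simp only [mul_def, map_zero]
    mul_assoc := leftMul_leftMul
    one_mul := fun P => by simp [mul_def, one_def, leftMul_monomial]
    mul_one := leftMul_one }

instance : Algebra V (DiffOp δ) :=
  Algebra.ofModule (fun r P Q => by simp only [mul_def, map_smul, LinearMap.smul_apply])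
    (fun r P Q => by simp only [mul_def, map_smul])

theorem monomial_mul (n : ℕ) (a : R) (Q : DiffOp δ) :
    monomial δ n a * Q = a • (deltaMul δ ^ n) Q := leftMul_monomial n a Q

/-- `a · δⁿ` is the product of `a` and the `n`-th power of `δ`. -/
theorem monomial_eq (n : ℕ) (a : R) :
    monomial δ n a = monomial δ 0 a * monomial δ 1 1 ^ n := by
  have h : ∀ n, monomial δ 1 1 ^ n = monomial δ n 1 := by
    intro n
    induction n with
    | zero => rfl
    | succ n ih =>
      rw [pow_succ', ih, monomial_mul, one_smul, pow_one, deltaMul_monomial,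
        Derivation.map_one_eq_zero, map_zero, add_zero]
  rw [h, monomial_mul, pow_zero, Module.End.one_apply, smul_monomial, mul_one]

/-- The commutation rule `δ · a = a · δ + δ(a)`. -/
theorem delta_mul_coeff (a : R) :
    monomial δ 1 1 * monomial δ 0 a =
      monomial δ 0 a * monomial δ 1 1 + monomial δ 0 (δ a) := by
  simp [monomial_mul, deltaMul_monomial, smul_monomial]

theorem coeff_monomial (n m : ℕ) (a : R) :
    coeff δ m (monomial δ n a) = if n = m then a else 0 :=
  Finsupp.single_apply

/-- A homomorphism of differential rings acts on operators coefficientwise. -/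
def mapLinear (δ : Derivation V R R) (δ' : Derivation V S S) (φ : R →ₐ[V] S) :
    DiffOp δ →ₗ[V] DiffOp δ' :=
  (Finsupp.mapRange.linearMap φ.toLinearMap : (ℕ →₀ R) →ₗ[V] (ℕ →₀ S))

theorem mapLinear_monomial (φ : R →ₐ[V] S) (n : ℕ) (a : R) :
    mapLinear δ δ' φ (monomial δ n a) = monomial δ' n (φ a) :=
  Finsupp.mapRange_single (hf := map_zero φ.toLinearMap)

theorem mapLinear_smul (φ : R →ₐ[V] S) (a : R) (Q : DiffOp δ) :
    mapLinear δ δ' φ (a • Q) = φ a • mapLinear δ δ' φ Q := by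
  induction Q using induction_on with
  | h0 => simp
  | ha P Q hP hQ => simp only [smul_add, map_add, hP, hQ]
  | hm n b => simp only [smul_monomial, mapLinear_monomial, map_mul]

theorem mapLinear_deltaMul (φ : R →ₐ[V] S) (hφ : ∀ a, φ (δ a) = δ' (φ a)) (Q : DiffOp δ) :
    mapLinear δ δ' φ (deltaMul δ Q) = deltaMul δ' (mapLinear δ δ' φ Q) := by
  induction Q using induction_on with
  | h0 => simp
  | ha P Q hP hQ => simp only [map_add, hP, hQ]
  | hm n b => simp only [deltaMul_monomial, map_add, mapLinear_monomial, hφ]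

/-- The same, as a homomorphism of algebras. -/
def map (φ : R →ₐ[V] S) (hφ : ∀ a, φ (δ a) = δ' (φ a)) : DiffOp δ →ₐ[V] DiffOp δ' :=
  AlgHom.ofLinearMap (mapLinear δ δ' φ)
    (by rw [one_def, mapLinear_monomial, map_one]; rfl)
    (by
      intro P Q
      induction P using induction_on with
      | h0 => simp
      | ha P P' hP hP' => simp only [add_mul, map_add, hP, hP']
      | hm n b =>
        rw [monomial_mul, mapLinear_smul, mapLinear_monomial, monomial_mul]
        congr 1
        induction n with
        | zero => rfl
        | succ n ih =>
          rw [pow_succ', pow_succ', Module.End.mul_apply, Module.End.mul_apply,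
            mapLinear_deltaMul φ hφ, ih])

end DiffOp

end FiniteOrder


section Completion

variable {V : Type*} [CommRing V]

/-- The left ideal of multiples of the scalar `v`. -/
def scalarIdeal (v : V) (D : Type*) [Ring D] [Algebra V D] : Ideal D :=
  Ideal.span {algebraMap V D v}

theorem mem_scalarIdeal {v : V} {D : Type*} [Ring D] [Algebra V D] {P : D} :
    P ∈ scalarIdeal v D ↔ ∃ Q : D, v • Q = P := by
  simp only [scalarIdeal, Ideal.mem_span_singleton', Algebra.smul_def, Algebra.commutes]

instance (v : V) (D : Type*) [Ring D] [Algebra V D] : (scalarIdeal v D).IsTwoSided where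
  mul_mem_of_left {a} b ha := by
    obtain ⟨Q, rfl⟩ := mem_scalarIdeal.1 ha
    exact mem_scalarIdeal.2 ⟨Q * b, (smul_mul_assoc v Q b).symm⟩

theorem scalarIdeal_succ_le (v : V) (D : Type*) [Ring D] [Algebra V D] (n : ℕ) :
    scalarIdeal (v ^ (n + 1)) D ≤ scalarIdeal (v ^ n) D := by
  intro P hP
  obtain ⟨Q, rfl⟩ := mem_scalarIdeal.1 hP
  exact mem_scalarIdeal.2 ⟨v • Q, by rw [smul_smul, pow_succ]⟩

/-- The completion `lim_n D / ϖⁿ D` of a (not necessarily commutative) `V`-algebra `D`. -/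
def Completion (ϖ : V) (D : Type*) [Ring D] [Algebra V D] :
    Subalgebra V (∀ n : ℕ, D ⧸ scalarIdeal (ϖ ^ n) D) where
  carrier := {x | ∀ n, Ideal.Quotient.factor (scalarIdeal_succ_le ϖ D n) (x (n + 1)) = x n}
  mul_mem' := fun ha hb n => by simp only [Pi.mul_apply, map_mul, ha n, hb n]
  add_mem' := fun ha hb n => by simp only [Pi.add_apply, map_add, ha n, hb n]
  algebraMap_mem' := fun r n => rfl

/-- Functoriality of the completion. -/
def Completion.map (ϖ : V) {D E : Type*} [Ring D] [Algebra V D] [Ring E] [Algebra V E]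
    (φ : D →ₐ[V] E) : Completion ϖ D →ₐ[V] Completion ϖ E :=
  have h : ∀ (v : V) (P : D), P ∈ scalarIdeal v D →
      (Ideal.Quotient.mkₐ V (scalarIdeal v E)).comp φ P = 0 := by
    intro v P hP
    obtain ⟨Q, rfl⟩ := mem_scalarIdeal.1 hP
    exact Ideal.Quotient.eq_zero_iff_mem.2 (mem_scalarIdeal.2 ⟨φ Q, (map_smul φ v Q).symm⟩)
  let g : ∀ n : ℕ, D ⧸ scalarIdeal (ϖ ^ n) D →ₐ[V] E ⧸ scalarIdeal (ϖ ^ n) E := fun n =>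
    Ideal.Quotient.liftₐ _ ((Ideal.Quotient.mkₐ V _).comp φ) (h _)
  (AlgHom.pi fun n => (g n).comp
    ((Pi.evalAlgHom V (fun n => D ⧸ scalarIdeal (ϖ ^ n) D) n).comp (Completion ϖ D).val)).codRestrict
    (Completion ϖ E) (by
      intro x n
      have hx := x.2 n
      obtain ⟨P, hP⟩ := Ideal.Quotient.mk_surjective (x.1 (n + 1))
      change Ideal.Quotient.factor _ (g (n + 1) (x.1 (n + 1))) = g n (x.1 n)
      rw [← hx, ← hP]
      rfl)

end Completion

section Coefficients

variable {V R : Type*} [CommRing V] [CommRing R] [Algebra V R] {δ : Derivation V R R} {ϖ : V}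

/-- `a` is the `n`-th coefficient of `H = lim Pᵢ` when `a` is congruent modulo `ϖⁱ` to the `n`-th
coefficient of every operator of finite order congruent to `H` modulo `ϖⁱ`. -/
def IsCoeff (H : Completion ϖ (DiffOp δ)) (n : ℕ) (a : R) : Prop :=
  ∀ (i : ℕ) (P : DiffOp δ), Ideal.Quotient.mk _ P = H.1 i →
    DiffOp.coeff δ n P - a ∈ Ideal.span {algebraMap V R ϖ} ^ i

theorem mem_span_pow {i : ℕ} {a : R} :
    a ∈ Ideal.span {algebraMap V R ϖ} ^ i ↔ ∃ b, ϖ ^ i • b = a := by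
  simp only [Ideal.span_singleton_pow, Ideal.mem_span_singleton', Algebra.smul_def, map_pow,
    mul_comm]

theorem coeff_sub_mem {i : ℕ} {P Q : DiffOp δ} (n : ℕ)
    (h : (Ideal.Quotient.mk (scalarIdeal (ϖ ^ i) (DiffOp δ))) P = Ideal.Quotient.mk _ Q) :
    DiffOp.coeff δ n P - DiffOp.coeff δ n Q ∈ Ideal.span {algebraMap V R ϖ} ^ i := by
  obtain ⟨T, hT⟩ := mem_scalarIdeal.1 (Ideal.Quotient.eq.1 h)
  exact mem_span_pow.2 ⟨DiffOp.coeff δ n T, by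
    rw [← map_sub, ← hT]; exact ((DiffOp.coeff δ n).map_smul_of_tower (ϖ ^ i) T).symm⟩

theorem exists_isCoeff [IsAdicComplete (Ideal.span {algebraMap V R ϖ}) R]
    (H : Completion ϖ (DiffOp δ)) (n : ℕ) : ∃ a, IsCoeff H n a := by
  choose P hP using fun i => Ideal.Quotient.mk_surjective (H.1 i)
  have h1 : ∀ i, Ideal.Quotient.mk (scalarIdeal (ϖ ^ i) (DiffOp δ)) (P (i + 1)) = H.1 i := by
    intro i
    rw [← H.2 i, ← hP (i + 1)]
    rfl
  have h2 : ∀ i j, i ≤ j →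
      Ideal.Quotient.mk (scalarIdeal (ϖ ^ i) (DiffOp δ)) (P j) = H.1 i := by
    intro i j hij
    induction j, hij using Nat.le_induction with
    | base => exact hP i
    | succ j hij ih =>
      rw [← ih, Ideal.Quotient.eq]
      have := Ideal.Quotient.eq.1 ((h1 j).trans (hP j).symm)
      obtain ⟨T, hT⟩ := mem_scalarIdeal.1 this
      exact mem_scalarIdeal.2 ⟨ϖ ^ (j - i) • T, by
        rw [smul_smul, ← pow_add, Nat.add_sub_cancel' hij, hT]⟩
  obtain ⟨a, ha⟩ := IsPrecomplete.prec' (I := Ideal.span {algebraMap V R ϖ}) (M := R)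
    (fun i => DiffOp.coeff δ n (P i)) (by
      intro i j hij
      rw [SModEq.sub_mem, smul_eq_mul, Ideal.mul_top]
      exact coeff_sub_mem n ((h2 i i le_rfl).trans (h2 i j hij).symm))
  refine ⟨a, fun i Q hQ => ?_⟩
  have h3 := ha i
  rw [SModEq.sub_mem, smul_eq_mul, Ideal.mul_top] at h3
  have h4 := coeff_sub_mem n (hQ.trans (hP i).symm)
  simpa using add_mem h4 h3

theorem IsCoeff.unique [IsAdicComplete (Ideal.span {algebraMap V R ϖ}) R]
    {H : Completion ϖ (DiffOp δ)} {n : ℕ} {a b : R} (ha : IsCoeff H n a) (hb : IsCoeff H n b) :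
    a = b := by
  rw [← sub_eq_zero]
  refine IsHausdorff.haus (I := Ideal.span {algebraMap V R ϖ}) inferInstance _ fun i => ?_
  obtain ⟨P, hP⟩ := Ideal.Quotient.mk_surjective (H.1 i)
  rw [SModEq.sub_mem, smul_eq_mul, Ideal.mul_top, sub_zero]
  simpa using sub_mem (hb i P hP) (ha i P hP)

/-- The `n`-th coefficient of an element of the completion. -/
def coeffHat (δ : Derivation V R R) (ϖ : V) [IsAdicComplete (Ideal.span {algebraMap V R ϖ}) R]
    (n : ℕ) : Completion ϖ (DiffOp δ) →ₗ[V] R where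
  toFun H := (exists_isCoeff H n).choose
  map_add' H H' := by
    refine (exists_isCoeff (H + H') n).choose_spec.unique ?_
    intro i Q hQ
    obtain ⟨P, hP⟩ := Ideal.Quotient.mk_surjective (H.1 i)
    obtain ⟨P', hP'⟩ := Ideal.Quotient.mk_surjective (H'.1 i)
    have h0 : Ideal.Quotient.mk (scalarIdeal (ϖ ^ i) (DiffOp δ)) Q =
        Ideal.Quotient.mk _ (P + P') := by
      rw [hQ, map_add, hP, hP']; rfl
    have h1 := coeff_sub_mem n h0
    have h2 := (exists_isCoeff H n).choose_spec i P hP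
    have h3 := (exists_isCoeff H' n).choose_spec i P' hP'
    have h4 := add_mem h1 (add_mem h2 h3)
    rw [map_add] at h4
    convert h4 using 1
    ring
  map_smul' v H := by
    refine (exists_isCoeff (v • H) n).choose_spec.unique ?_
    intro i Q hQ
    obtain ⟨P, hP⟩ := Ideal.Quotient.mk_surjective (H.1 i)
    have h0 : Ideal.Quotient.mk (scalarIdeal (ϖ ^ i) (DiffOp δ)) Q =
        Ideal.Quotient.mk _ (v • P) := by
      rw [hQ, ← Ideal.Quotient.mkₐ_eq_mk V, map_smul, Ideal.Quotient.mkₐ_eq_mk, hP]; rfl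
    have h1 := coeff_sub_mem n h0
    have h2 := (exists_isCoeff H n).choose_spec i P hP
    have h4 := add_mem h1 (Submodule.smul_of_tower_mem _ v h2)
    rw [(DiffOp.coeff δ n).map_smul_of_tower, smul_sub] at h4
    convert h4 using 1
    simp

end Coefficients

section Localization

variable {V A : Type*} [CommRing V] [CommRing A] [Algebra V A]

/-- The homomorphism `A_f → A_f[ε]` given by `a ↦ a + D(a) ε` on `A`. -/
def localizedDerivationAux (D : Derivation V A A) (f : A) :
    Localization.Away f →ₐ[V] TrivSqZeroExt (Localization.Away f) (Localization.Away f) :=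
  let L := Localization.Away f
  let g : A →ₐ[V] TrivSqZeroExt L L :=
    AlgHom.ofLinearMap
      ((TrivSqZeroExt.inlAlgHom V L L).toLinearMap ∘ₗ (Algebra.linearMap A L).restrictScalars V +
        (TrivSqZeroExt.inrHom L L).restrictScalars V ∘ₗ
          (Algebra.linearMap A L).restrictScalars V ∘ₗ (D : A →ₗ[V] A))
      (by ext <;> simp)
      (by intro a b; ext <;> simp <;> ring)
  IsLocalization.liftAlgHom (M := Submonoid.powers f) (f := g) (by
    rintro ⟨_, n, rfl⟩
    rw [TrivSqZeroExt.isUnit_iff_isUnit_fst]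
    have : (g (f ^ n)).fst = algebraMap A L (f ^ n) := by simp [g]
    rw [this]
    exact IsLocalization.map_units L (⟨f ^ n, n, rfl⟩ : Submonoid.powers f))

theorem localizedDerivationAux_algebraMap (D : Derivation V A A) (f a : A) :
    localizedDerivationAux D f (algebraMap A (Localization.Away f) a) =
      TrivSqZeroExt.inl (algebraMap A (Localization.Away f) a) +
        TrivSqZeroExt.inr (algebraMap A (Localization.Away f) (D a)) := by
  rw [localizedDerivationAux, IsLocalization.liftAlgHom_apply, IsLocalization.lift_eq]
  rfl

theorem localizedDerivationAux_fst (D : Derivation V A A) (f : A) (b : Localization.Away f) :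
    (localizedDerivationAux D f b).fst = b := by
  have : ((TrivSqZeroExt.fstHom V _ _).comp (localizedDerivationAux D f) : _ →+* _) =
      RingHom.id (Localization.Away f) := by
    apply IsLocalization.ringHom_ext (Submonoid.powers f)
    ext a
    simp [localizedDerivationAux_algebraMap]
  exact congrArg (fun h => h b) this

/-- The unique extension to `A_f` of a derivation of `A`. -/
def localizedDerivation (D : Derivation V A A) (f : A) :
    Derivation V (Localization.Away f) (Localization.Away f) :=
  Derivation.mk' ((TrivSqZeroExt.sndHom _ _).restrictScalars V ∘ₗ
      (localizedDerivationAux D f).toLinearMap) (by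
    intro a b
    simp [localizedDerivationAux_fst, mul_comm])

theorem localizedDerivation_algebraMap (D : Derivation V A A) (f a : A) :
    localizedDerivation D f (algebraMap A (Localization.Away f) a) =
      algebraMap A (Localization.Away f) (D a) := by
  change (localizedDerivationAux D f _).snd = _
  rw [localizedDerivationAux_algebraMap]
  exact (congrArg (· + _) (TrivSqZeroExt.snd_inl _ _)).trans (zero_add _)

end Localization

section Curve

open IsLocalRing Filter Topology PowerSeries

variable {V : Type*} [CommRing V] {A : Type*} [CommRing A] [Algebra V A]

/-- `t` is an étale coordinate on `Spf A`: for every `n`, the morphism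
`Spec (A / ϖⁿ⁺¹) → 𝔸¹` over `V / ϖⁿ⁺¹` given by `t` is étale. -/
def IsEtaleCoordinate (ϖ : V) (t : A) : Prop :=
  ∀ n : ℕ, (Polynomial.eval₂RingHom
    (Ideal.quotientMap ((Ideal.span {ϖ ^ (n + 1)}).map (algebraMap V A)) (algebraMap V A)
      Ideal.le_comap_map : V ⧸ Ideal.span {ϖ ^ (n + 1)} →+* _)
    (Ideal.Quotient.mk ((Ideal.span {ϖ ^ (n + 1)}).map (algebraMap V A)) t)).Etale

/-- The ring of completed integral differential operators `lim_n D / ϖⁿ D` on an open with ring of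
functions `A` (or its completion), where `D` is the ring of operators `∑ aₙ (ϖᵏ∂)ⁿ` of finite
order. -/
abbrev Dhat (ϖ : V) (k : ℕ) (D : Derivation V A A) : Type _ :=
  Completion ϖ (DiffOp (ϖ ^ k • D))

/-- The same after inverting `ϖ`. -/
abbrev DhatQ (K : Type*) [Field K] [Algebra V K] (ϖ : V) (k : ℕ) (D : Derivation V A A) :
    Type _ :=
  K ⊗[V] Dhat ϖ k D

/-- Restriction to the basic open `D(f)` of integral operators. The ring of functions on `D(f)` is
the `ϖ`-adic completion of `A_f`; it and `A_f` agree modulo all powers of `ϖ`, so that operators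
with coefficients in either of them have the same completion. -/
def restrictHat (ϖ : V) (k : ℕ) (D : Derivation V A A) (f : A) :
    Dhat ϖ k D →ₐ[V] Dhat ϖ k (localizedDerivation D f) :=
  Completion.map ϖ (DiffOp.map (IsScalarTower.toAlgHom V A (Localization.Away f)) (fun a => by
    rw [Derivation.smul_apply, map_smul, Derivation.smul_apply]
    exact congrArg (ϖ ^ k • ·) (localizedDerivation_algebraMap D f a).symm))

/-- Restriction to the basic open `D(f)`. -/
def restrict (K : Type*) [Field K] [Algebra V K] (ϖ : V) (k : ℕ) (D : Derivation V A A) (f : A) :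
    DhatQ K ϖ k D →ₐ[K] DhatQ K ϖ k (localizedDerivation D f) :=
  Algebra.TensorProduct.map (AlgHom.id K K) (restrictHat ϖ k D f)

/-- `H` is invertible on an open neighbourhood of the closed point `x`. -/
def IsInvertibleNear {K : Type*} [Field K] [Algebra V K] {ϖ : V} {k : ℕ} {D : Derivation V A A}
    (x : Ideal A) (H : DhatQ K ϖ k D) : Prop :=
  ∃ f : A, f ∉ x ∧ IsUnit (restrict K ϖ k D f H)

/-- The spectral seminorm `max_z |f(z)|` of a `K`-algebra, `z` running over its maximal ideals. -/
def spNorm (K : Type*) [NormedField K] {B : Type*} [CommRing B] [Algebra K B] (f : B) : ℝ :=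
  ⨆ z : MaximalSpectrum B,
    letI : Field (B ⧸ z.asIdeal) := Ideal.Quotient.field z.asIdeal
    spectralNorm K (B ⧸ z.asIdeal) (Ideal.Quotient.mk z.asIdeal f)

section Operators

variable {K : Type*} [NormedField K] [Algebra V K] {ϖ : V} {k : ℕ} {D : Derivation V A A}
  [IsAdicComplete (Ideal.span {algebraMap V A ϖ}) A]

/-- The coefficient `aₙ` of `H = ∑ aₙ (ϖᵏ∂)ⁿ`. -/
def coeffQ (H : DhatQ K ϖ k D) (n : ℕ) : K ⊗[V] A :=
  (coeffHat (ϖ ^ k • D) ϖ n).baseChange K H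

/-- `‖H‖ = max_n |aₙ|`. -/
def opNorm (H : DhatQ K ϖ k D) : ℝ := ⨆ n, spNorm K (coeffQ H n)

/-- The largest `n` with `|aₙ| = ‖H‖` (which is `∞` for `H = 0`). -/
def Nbar (H : DhatQ K ϖ k D) : ℕ∞ := ⨆ n ∈ {n : ℕ | spNorm K (coeffQ H n) = opNorm H}, (n : ℕ∞)

end Operators

/-- For a series `∑ αᵢ Tⁱ` with `aᵢ = |αᵢ|`, the largest `i` with `|αᵢ| rⁱ = sup_j |αⱼ| rʲ`. -/
def radiusIndex (a : ℕ → ℝ) (r : ℝ) : ℕ∞ := ⨆ i ∈ {i : ℕ | a i * r ^ i = ⨆ j, a j * r ^ j}, (i : ℕ∞)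

/-- The limit of the preceding index as `r → 1⁻`. -/
def limitIndex (a : ℕ → ℝ) : ℕ∞ := limUnder (𝓝[<] (1 : ℝ)) (radiusIndex a)

section Tube

variable {V' : Type*} [CommRing V'] [IsLocalRing V'] [Algebra V V']

/-- Let `ρ` define a point `x` of `Spf A` with values in the residue field of `V'`, and let `c ∈ V'`
be a lift of `t(x)`. After extension of scalars to `V'` the tube of `x` is an open unit disc with
coordinate `T = t - c`, and `s : A → V'⟦T⟧` is the expansion of functions on it if it is a
homomorphism with `t ↦ c + T` whose value at `T = 0` reduces to `ρ`. -/
def IsTubeExpansion (ρ : A →ₐ[V] ResidueField V') (t : A) (c : V') (s : A →ₐ[V] V'⟦X⟧) : Prop :=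
  s t = PowerSeries.C c + X ∧ ∀ f, residue V' (constantCoeff (s f)) = ρ f

open Classical in
/-- The expansion of functions on the tube as power series in `t - c`. -/
def tubeExpansion (ρ : A →ₐ[V] ResidueField V') (t : A) (c : V') : A →ₗ[V] V'⟦X⟧ :=
  if h : ∃ s : A →ₐ[V] V'⟦X⟧, IsTubeExpansion ρ t c s then h.choose.toLinearMap else 0

variable {K K' : Type*} [NormedField K] [Algebra V K] [Field K'] [Algebra V' K'] [Algebra K K']
  [Algebra V K'] [IsScalarTower V K K'] [IsScalarTower V V' K']

/-- The coefficient `αᵢ ∈ K'` of the expansion of a function on the generic fibre. -/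
def tubeCoeff (ρ : A →ₐ[V] ResidueField V') (t : A) (c : V') (K K' : Type*) [NormedField K]
    [Algebra V K] [Field K'] [Algebra V' K'] [Algebra K K'] [Algebra V K'] [IsScalarTower V K K']
    [IsScalarTower V V' K'] (i : ℕ) : K ⊗[V] A →ₗ[K] K' :=
  LinearMap.liftBaseChange K ((IsScalarTower.toAlgHom V V' K').toLinearMap ∘ₗ
    (PowerSeries.coeff (R := V') i).restrictScalars V ∘ₗ tubeExpansion ρ t c)

/-- The number `N(f)`. -/
def functionIndex (ρ : A →ₐ[V] ResidueField V') (t : A) (c : V') (K' : Type*) [Field K']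
    [Algebra V' K'] [Algebra K K'] [Algebra V K'] [IsScalarTower V K K'] [IsScalarTower V V' K']
    (f : K ⊗[V] A) : ℕ∞ :=
  limitIndex fun i => spectralNorm K K' (tubeCoeff ρ t c K K' i f)

/-- The number `N(H) = N(aₙ)`, `n` the largest index with `|aₙ| = ‖H‖`. -/
def opIndex (ρ : A →ₐ[V] ResidueField V') (t : A) (c : V') (K' : Type*) [Field K']
    [Algebra V' K'] [Algebra K K'] [Algebra V K'] [IsScalarTower V K K'] [IsScalarTower V V' K']
    {ϖ : V} {k : ℕ} {D : Derivation V A A} [IsAdicComplete (Ideal.span {algebraMap V A ϖ}) A]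
    (H : DhatQ K ϖ k D) : ℕ∞ :=
  functionIndex ρ t c K' (coeffQ H (Nbar H).toNat)

end Tube

end Curve

end ArithDiff

end

/-! A nonzero operator has the form `d ⊗ H₀` with `d ∈ K` nonzero and `H₀` integral and nonzero
modulo `ϖ`. The étale coordinate makes `A` free of `ϖ`-torsion and, with connectedness, makes `A/ϖ`
a domain. The reduction of `H₀` is therefore a nonzero polynomial in `ϖᵏ∂` over a domain; let `n` be
its degree and `ā` its leading coefficient (`HasLeadingCoeff`). All invariants are read off from
these data: `‖H‖ = |d|`, the upper index is `n`, and the index at `x` is the vanishing order of `ā`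
at `x` (`opNorm_tmul`, `Nbar_tmul`, `opIndex_tmul`).

A `V`-linear derivation preserves `ϖA`, and commutators only touch lower degrees, so leading
coefficients multiply (`HasLeadingCoeff.mul`). The third claim is then multiplicativity of `|d|` and
additivity of degrees and of orders of power series. If `H` is invertible on `D(f)`, the inverse of
`H₀` there is integral (`exists_eq_inv_tmul_of_mul_eq_one`). The inverse of `H` is `d⁻¹` times it,
which gives the second claim; comparing degrees gives `n = 0` and `ā` a unit on `D(f)`, hence
nonzero at `x`. Conversely, if `n = 0` and `a(x) ≠ 0`, then on `D(a)` the operator `H₀` is congruent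
to the unit `a`, and units lift through the completion.

Two facts link this algebra to the analytic definitions. A function `a ∉ ϖA` has spectral norm 1: a
closed point of the special fibre where `ā ≠ 0` lifts, by étaleness, to a point over an unramified
extension where `a` is a unit (`exists_integral_point`). And the expansion `A → V'⟦X⟧`, `t ↦ c + X`,
also produced by étale lifting, induces an injection on `A/ϖ` (`reducedExpansion_ne_zero`), so the
order of `ā` is finite and equals `N(a)`. -/

open scoped TensorProduct

noncomputable section

namespace ArithDiff

/-! ### Étale algebras over a principal ideal domain that is not a field -/

section EtaleCurve

/-- An unramified extension has no ramification index: a generator `π` of the contraction of `y`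
still generates the maximal ideal of `B_y`. So every element of `B_y` is zero or a unit times a
power of `π`, and clearing denominators gives the two alternatives. One `π` serves all `f`. -/
theorem exists_pow_mul_of_etale {P B : Type*} [CommRing P] [IsDomain P] [IsPrincipalIdealRing P]
    [IsJacobsonRing P] (hP : ¬ IsField P) [CommRing B] [Algebra P B] [Algebra.Etale P B]
    (y : Ideal B) [hy : y.IsMaximal] :
    ∃ π : P, π ≠ 0 ∧ ∀ f : B, (∃ h, h ∉ y ∧ h * f = 0) ∨
      ∃ h u, h ∉ y ∧ u ∉ y ∧ ∃ n, h * f = u * algebraMap P B π ^ n := by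
  have hy' := hy.isPrime
  let q : Ideal P := y.under P
  -- Zariski's lemma over the Jacobson ring `P` makes `B/y` finite over `P`, so the contraction of
  -- `y` is maximal; as `P` is not a field, its generator is nonzero.
  have hq : q.IsMaximal := by
    let _ : Field (B ⧸ y) := Ideal.Quotient.field y
    have : Algebra.FiniteType P (B ⧸ y) := .trans (S := B) inferInstance inferInstance
    have := finite_of_finite_type_of_isJacobsonRing P (B ⧸ y)
    have : (⊥ : Ideal (B ⧸ y)).IsMaximal := Ideal.bot_isMaximal
    have := Ideal.isMaximal_comap_of_isIntegral_of_isMaximal (R := P) (⊥ : Ideal (B ⧸ y))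
    convert this using 1
    ext r
    change algebraMap P B r ∈ y ↔ algebraMap P (B ⧸ y) r = 0
    rw [IsScalarTower.algebraMap_apply P B (B ⧸ y),
      Ideal.Quotient.algebraMap_eq, Ideal.Quotient.eq_zero_iff_mem]
  have hq' := hq.isPrime
  obtain ⟨π, hπ⟩ := IsPrincipalIdealRing.principal q
  have hπ0 : π ≠ 0 := by
    rintro rfl
    refine Ring.ne_bot_of_isMaximal_of_not_isField hq hP ?_
    rw [hπ]; simp
  refine ⟨π, hπ0, fun f => ?_⟩
  have : y.LiesOver q := ⟨rfl⟩
  let _ := Localization.AtPrime.algebraOfLiesOver q y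
  have hmax := ((Algebra.isUnramifiedAt_iff_map_eq P q y).1 inferInstance).2
  set L := Localization.AtPrime y
  rw [hπ, ← Ideal.span, Ideal.map_span, Set.image_singleton] at hmax
  have : IsNoetherianRing B := Algebra.FiniteType.isNoetherianRing P B
  have : IsNoetherianRing L := IsLocalization.isNoetherianRing y.primeCompl L inferInstance
  by_cases hf : algebraMap B L f = 0
  · left
    obtain ⟨⟨h, hh⟩, e⟩ := (IsLocalization.map_eq_zero_iff y.primeCompl L f).1 hf
    exact ⟨h, hh, e⟩
  · right
    -- By Krull's intersection theorem a nonzero element lies in a last power of the maximal ideal.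
    obtain ⟨n, hn, hn'⟩ : ∃ n, algebraMap B L f ∈ IsLocalRing.maximalIdeal L ^ n ∧
        algebraMap B L f ∉ IsLocalRing.maximalIdeal L ^ (n + 1) := by
      by_contra! hcon
      apply hf
      have h1 : ∀ n, algebraMap B L f ∈ IsLocalRing.maximalIdeal L ^ n := by
        intro n
        induction n with
        | zero => simp
        | succ n ih => exact hcon n ih
      have := Ideal.iInf_pow_eq_bot_of_isLocalRing (IsLocalRing.maximalIdeal L)
        (IsLocalRing.maximalIdeal.isMaximal L).ne_top
      rw [← Ideal.mem_bot, ← this]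
      exact (Submodule.mem_iInf _).2 h1
    rw [← hmax, Ideal.span_singleton_pow, Ideal.mem_span_singleton'] at hn
    obtain ⟨v, hv⟩ := hn
    have hvu : v ∉ IsLocalRing.maximalIdeal L := by
      intro hv'
      apply hn'
      rw [← hv, pow_succ']
      refine Ideal.mul_mem_mul hv' (Ideal.pow_mem_pow ?_ n)
      rw [← hmax]
      exact Ideal.mem_span_singleton_self _
    obtain ⟨⟨u, s⟩, hs⟩ := IsLocalization.surj y.primeCompl v
    have hu : u ∉ y := by
      intro hu
      apply hvu
      have h2 : algebraMap B L u ∈ IsLocalRing.maximalIdeal L :=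
        (IsLocalization.AtPrime.to_map_mem_maximal_iff L y u).2 hu
      rw [← hs] at h2
      refine ((IsLocalRing.maximalIdeal.isMaximal L).isPrime.mem_or_mem h2).resolve_right ?_
      rw [IsLocalization.AtPrime.to_map_mem_maximal_iff L y]
      exact s.2
    have h3 : algebraMap B L (s * f) = algebraMap B L (u * algebraMap P B π ^ n) := by
      rw [map_mul, map_mul, map_pow, ← IsScalarTower.algebraMap_apply P B L, ← hs, ← hv]
      ring
    obtain ⟨c, hc⟩ := (IsLocalization.eq_iff_exists y.primeCompl L).1 h3
    refine ⟨c * s, c * u, ?_, ?_, n, ?_⟩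
    · exact (c * s).2
    · exact fun h => (hy'.mem_or_mem h).elim c.2 hu
    · rw [mul_assoc, hc, mul_assoc]

/-- Powers of `π` are nonzerodivisors by flatness, so the local description shows that if `f * g =
0`, one factor vanishes near each closed point. Connectedness globalizes this: an idempotent
separates the locus where `f` vanishes locally from the rest. -/
theorem isDomain_of_etale {P B : Type*} [CommRing P] [IsDomain P] [IsPrincipalIdealRing P]
    [IsJacobsonRing P] (hP : ¬ IsField P) [CommRing B] [Algebra P B] [Algebra.Etale P B]
    [ConnectedSpace (PrimeSpectrum B)] : IsDomain B := by
  have : Nontrivial B := PrimeSpectrum.nonempty_iff_nontrivial.1 inferInstance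
  have : IsNoetherianRing B := Algebra.FiniteType.isNoetherianRing P B
  have key : ∀ y : Ideal B, y.IsMaximal → ∀ f g : B, f * g = 0 →
      (∃ h, h ∉ y ∧ h * f = 0) ∨ ∃ h, h ∉ y ∧ h * g = 0 := by
    intro y hy f g hfg
    have hy' := hy.isPrime
    obtain ⟨π, hπ, H⟩ := exists_pow_mul_of_etale hP y
    rcases H f with h | ⟨h, u, hh, hu, n, e⟩
    · exact .inl h
    rcases H g with h' | ⟨h', u', hh', hu', m, e'⟩
    · exact .inr h'
    exfalso
    have h1 : (π ^ (n + m)) • (u * u') = 0 := by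
      rw [Algebra.smul_def, map_pow, pow_add]
      linear_combination (-1 : B) * h' * g * e - e' * u * algebraMap P B π ^ n + h * h' * hfg
    have hreg : IsSMulRegular B (π ^ (n + m)) := by
      have := Module.Flat.isSMulRegular_of_isRegular
        (IsRegular.of_ne_zero (pow_ne_zero (n + m) hπ)) (M := B)
      exact this
    have h2 : u * u' = 0 := hreg (by simpa using h1)
    rcases hy'.mem_or_mem (h2 ▸ y.zero_mem : u * u' ∈ y) with h | h
    · exact hu h
    · exact hu' h
  have hid : ∀ e : B, IsIdempotentElem e → e = 0 ∨ e = 1 := by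
    intro e he
    have h1 := (PrimeSpectrum.isClopen_iff.2 ⟨e, he, rfl⟩ :
      IsClopen (PrimeSpectrum.basicOpen e : Set (PrimeSpectrum B)))
    rcases isClopen_iff.1 h1 with h | h
    · left
      exact PrimeSpectrum.basicOpen_injOn_isIdempotentElem he .zero (SetLike.ext' (by simp [h]))
    · right
      exact PrimeSpectrum.basicOpen_injOn_isIdempotentElem he .one (SetLike.ext' (by simp [h]))
  have : NoZeroDivisors B := by
    classical
    refine ⟨fun {f g} hfg => ?_⟩
    let I : Ideal B := Submodule.annihilator (Ideal.span {f})
    let J : Ideal B := Submodule.annihilator I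
    have hI : ∀ a, a ∈ I ↔ a * f = 0 := fun a => Submodule.mem_annihilator_span_singleton f a
    -- Near `y` either `f` vanishes, so `I` is not contained in `y`, or every element of `I`
    -- vanishes. In the latter case finite generation of `I` allows multiplying the annihilators of
    -- the generators into one element of `J` outside `y`.
    have hIJ : I ⊔ J = ⊤ := by
      by_contra hne
      obtain ⟨y, hy, hle⟩ := Ideal.exists_le_maximal _ hne
      obtain ⟨s, hs⟩ := IsNoetherian.noetherian I
      by_cases hf : ∃ h, h ∉ y ∧ h * f = 0
      · obtain ⟨h, hh, e⟩ := hf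
        exact hh (hle (Ideal.mem_sup_left ((hI h).2 e)))
      have h1 : ∀ a ∈ I, ∃ h, h ∉ y ∧ h * a = 0 := fun a ha =>
        (key y hy a f ((hI a).1 ha)).resolve_right hf
      choose! c hc hc' using h1
      have h2 : ∏ a ∈ s, c a ∈ J := by
        rw [Submodule.mem_annihilator, ← hs]
        intro b hb
        induction hb using Submodule.span_induction with
        | mem b hb =>
          rw [smul_eq_mul, ← Finset.prod_erase_mul s c hb, mul_assoc,
            hc' b (hs ▸ Submodule.subset_span hb), mul_zero]
        | zero => simp
        | add b b' _ _ h h' => rw [smul_add, h, h', add_zero]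
        | smul r b _ h => rw [smul_comm, h, smul_zero]
      have h3 := hle (Ideal.mem_sup_right h2)
      have h4 := (Ideal.IsPrime.prod_mem_iff (hp := hy.isPrime)).1 h3
      obtain ⟨a, ha, ha'⟩ := h4
      exact hc a (hs ▸ Submodule.subset_span ha) ha'
    obtain ⟨i, hi, j, hj, hij⟩ := Submodule.mem_sup.1 (hIJ ▸ Submodule.mem_top : (1 : B) ∈ I ⊔ J)
    have h0 : j * i = 0 := Submodule.mem_annihilator.1 hj i hi
    -- From `i + j = 1` and `j * i = 0`, the element `i` is idempotent.
    rcases hid i (by rw [IsIdempotentElem]; linear_combination i * hij - h0) with h | h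
    · right
      have : j = 1 := by rw [← hij, h, zero_add]
      rw [← one_mul g, ← this]
      exact Submodule.mem_annihilator.1 hj g ((hI g).2 (by rw [mul_comm, hfg]))
    · left
      rw [← one_mul f, ← h]
      exact (hI i).1 hi
  exact NoZeroDivisors.to_isDomain B

/-- Locally at `y` a nonzero `f` is `u * π ^ n`; since `ker φ ≤ y`, neither `u` nor `π` is killed.
Applied to the expansion of functions at a closed point. -/
theorem injective_of_etale {P B S : Type*} [CommRing P] [IsDomain P] [IsPrincipalIdealRing P]
    [IsJacobsonRing P] (hP : ¬ IsField P) [CommRing B] [IsDomain B] [Algebra P B]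
    [Algebra.Etale P B] [CommRing S] [IsDomain S] (φ : B →+* S)
    (hφ : ∀ π : P, π ≠ 0 → φ (algebraMap P B π) ≠ 0)
    (y : Ideal B) [y.IsMaximal] (hy : RingHom.ker φ ≤ y) : Function.Injective φ := by
  rw [injective_iff_map_eq_zero]
  intro f hf
  obtain ⟨π, hπ, H⟩ := exists_pow_mul_of_etale hP y
  rcases H f with ⟨h, hh, e⟩ | ⟨h, u, hh, hu, n, e⟩
  · refine (mul_eq_zero.1 e).resolve_left ?_
    rintro rfl
    exact hh y.zero_mem
  · have := congrArg φ e
    rw [map_mul, map_mul, hf, mul_zero, map_pow, eq_comm, mul_eq_zero] at this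
    rcases this with h | h
    · exact absurd (hy h) hu
    · exact absurd (eq_zero_of_pow_eq_zero h) (hφ π hπ)

end EtaleCurve

/-! ### Lifting homomorphisms along an étale coordinate -/

section AdicLifting

variable {V : Type*} [CommRing V] {A : Type*} [CommRing A] [Algebra V A] {ϖ : V} {t : A}

theorem exists_etaleCoordinate_factor {T : Type*} [CommRing T] [Algebra V T] {m : ℕ}
    (hT : algebraMap V T (ϖ ^ (m + 1)) = 0) (φ : A →ₐ[V] T) :
    (Ideal.span {ϖ ^ (m + 1)}).map (algebraMap V A) ≤ RingHom.ker φ := by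
  rw [Ideal.map_span, Set.image_singleton, Ideal.span_singleton_le_iff_mem, RingHom.mem_ker,
    AlgHom.commutes, hT]

/-- As `ϖ ^ (m + 1)` dies in `T`, both maps factor through `A/ϖ^(m+1)`. Agreement on `t` makes them
linear for the same `(V/ϖ^(m+1))[t]`-structure on `T`, and formal unramifiedness applies. -/
theorem etaleCoordinate_lift_eq (ht : IsEtaleCoordinate ϖ t) {T C : Type*} [CommRing T]
    [Algebra V T] [CommRing C] [Algebra V C] {m : ℕ} (hT : algebraMap V T (ϖ ^ (m + 1)) = 0)
    (g : T →ₐ[V] C) (hker : IsNilpotent (RingHom.ker g)) {φ φ' : A →ₐ[V] T}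
    (hφt : φ t = φ' t) (hφ : g.comp φ = g.comp φ') : φ = φ' := by
  have H := ht m
  set F := Polynomial.eval₂RingHom
    (Ideal.quotientMap ((Ideal.span {ϖ ^ (m + 1)}).map (algebraMap V A)) (algebraMap V A)
      Ideal.le_comap_map : V ⧸ Ideal.span {ϖ ^ (m + 1)} →+* _)
    (Ideal.Quotient.mk ((Ideal.span {ϖ ^ (m + 1)}).map (algebraMap V A)) t) with hF
  let _ := F.toAlgebra
  have : Algebra.Etale _ _ := H
  let ψ (φ : A →ₐ[V] T) := Ideal.Quotient.lift ((Ideal.span {ϖ ^ (m + 1)}).map (algebraMap V A))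
    φ.toRingHom (fun a ha => exists_etaleCoordinate_factor hT φ ha)
  let _ : Algebra (Polynomial (V ⧸ Ideal.span {ϖ ^ (m + 1)})) T := ((ψ φ).comp F).toAlgebra
  have h1 : (ψ φ').comp F = (ψ φ).comp F := by
    refine Polynomial.ringHom_ext' (Ideal.Quotient.ringHom_ext (RingHom.ext fun v => ?_)) ?_
    · simp only [RingHom.comp_apply, hF, Polynomial.coe_eval₂RingHom, Polynomial.eval₂_C]
      exact (φ'.commutes v).trans (φ.commutes v).symm
    · simp [hF, ψ, hφt]
  let a : _ →ₐ[Polynomial (V ⧸ Ideal.span {ϖ ^ (m + 1)})] T :=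
    { ψ φ with commutes' := fun _ => rfl }
  let a' : _ →ₐ[Polynomial (V ⧸ Ideal.span {ϖ ^ (m + 1)})] T :=
    { ψ φ' with commutes' := fun r => congrArg (· r) h1 }
  have h2 : a = a' := by
    refine Algebra.FormallyUnramified.ext' (g : T →+* C) hker _ _ fun x => ?_
    obtain ⟨x, rfl⟩ := Ideal.Quotient.mk_surjective x
    exact congrArg (· x) hφ
  exact AlgHom.ext fun x => congrArg (· (Ideal.Quotient.mk _ x)) h2

/-- The chosen `r` makes `T` an algebra over `(V/ϖ^(m+1))[X]` by `X ↦ r`; formal smoothness lifts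
`ψ` linearly over this ring, which forces `t ↦ r`. -/
theorem exists_etaleCoordinate_lift (ht : IsEtaleCoordinate ϖ t) {T C : Type*} [CommRing T]
    [Algebra V T] [CommRing C] [Algebra V C] {m : ℕ} (hT : algebraMap V T (ϖ ^ (m + 1)) = 0)
    (g : T →ₐ[V] C) (hg : Function.Surjective g) (hker : IsNilpotent (RingHom.ker g))
    (ψ : A →ₐ[V] C) (r : T) (hr : g r = ψ t) : ∃ φ : A →ₐ[V] T, φ t = r ∧ g.comp φ = ψ := by
  have H := ht m
  set F := Polynomial.eval₂RingHom
    (Ideal.quotientMap ((Ideal.span {ϖ ^ (m + 1)}).map (algebraMap V A)) (algebraMap V A)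
      Ideal.le_comap_map : V ⧸ Ideal.span {ϖ ^ (m + 1)} →+* _)
    (Ideal.Quotient.mk ((Ideal.span {ϖ ^ (m + 1)}).map (algebraMap V A)) t) with hF
  let _ := F.toAlgebra
  have : Algebra.Etale _ _ := H
  have hC : algebraMap V C (ϖ ^ (m + 1)) = 0 := by rw [← g.commutes, hT, map_zero]
  let ψ' := Ideal.Quotient.lift ((Ideal.span {ϖ ^ (m + 1)}).map (algebraMap V A))
    ψ.toRingHom (fun a ha => exists_etaleCoordinate_factor hC ψ ha)
  let G : Polynomial (V ⧸ Ideal.span {ϖ ^ (m + 1)}) →+* T :=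
    Polynomial.eval₂RingHom (Ideal.Quotient.lift _ (algebraMap V T) (by
      exact (Ideal.span_singleton_le_iff_mem (RingHom.ker (algebraMap V T))).2 hT)) r
  let _ := G.toAlgebra
  let _ := ((g : T →+* C).comp G).toAlgebra
  have h1 : ψ'.comp F = (g : T →+* C).comp G := by
    refine Polynomial.ringHom_ext' (Ideal.Quotient.ringHom_ext (RingHom.ext fun v => ?_)) ?_
    · simp only [RingHom.comp_apply, hF, G, Polynomial.coe_eval₂RingHom, Polynomial.eval₂_C]
      exact (ψ.commutes v).trans (g.commutes v).symm
    · simp [hF, ψ', G, hr]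
  let a : _ →ₐ[Polynomial (V ⧸ Ideal.span {ϖ ^ (m + 1)})] C :=
    { ψ' with commutes' := fun r => congrArg (· r) h1 }
  let b : T →ₐ[Polynomial (V ⧸ Ideal.span {ϖ ^ (m + 1)})] C :=
    { (g : T →+* C) with commutes' := fun _ => rfl }
  let L := Algebra.FormallySmooth.liftOfSurjective a b hg hker
  have hL : ∀ x, g (L x) = ψ' x := Algebra.FormallySmooth.liftOfSurjective_apply a b hg hker
  have hLF : ∀ P, L (F P) = G P := fun P => L.commutes P
  refine ⟨{ L.toRingHom.comp (Ideal.Quotient.mk _) with commutes' := fun v => ?_ }, ?_, ?_⟩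
  · have := hLF (Polynomial.C (Ideal.Quotient.mk _ v))
    simp only [hF, G, Polynomial.coe_eval₂RingHom, Polynomial.eval₂_C] at this
    exact this
  · have := hLF Polynomial.X
    simpa [hF, G] using this
  · ext x
    exact hL (Ideal.Quotient.mk _ x)

/-- Topological étaleness: homomorphisms to an adically complete ring can be lifted once the image
of the coordinate is. -/
theorem exists_etaleCoordinate_lift_of_isAdicComplete (ht : IsEtaleCoordinate ϖ t) {R C : Type*}
    [CommRing R] [Algebra V R] [CommRing C] [Algebra V C] (J : Ideal R) [IsAdicComplete J R]
    (hϖ : algebraMap V R ϖ ∈ J) (g : R →ₐ[V] C) (hg : Function.Surjective g)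
    (hJ : J ≤ RingHom.ker g) {e : ℕ} (he : RingHom.ker g ^ e ≤ J)
    (ψ : A →ₐ[V] C) (r : R) (hr : g r = ψ t) : ∃ φ : A →ₐ[V] R, φ t = r ∧ g.comp φ = ψ := by
  have hT : ∀ n, algebraMap V (R ⧸ J ^ (n + 1)) (ϖ ^ (n + 1)) = 0 := fun n => by
    rw [IsScalarTower.algebraMap_apply V R, Ideal.Quotient.algebraMap_eq,
      Ideal.Quotient.eq_zero_iff_mem, map_pow]
    exact Ideal.pow_mem_pow hϖ _
  let G : ∀ n, R ⧸ J ^ (n + 1) →ₐ[V] C := fun n => Ideal.Quotient.liftₐ _ g fun a ha =>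
    hJ (Ideal.pow_le_self n.succ_ne_zero ha)
  have hGs : ∀ n, Function.Surjective (G n) := fun n c => by
    obtain ⟨b, rfl⟩ := hg c
    exact ⟨Ideal.Quotient.mk _ b, rfl⟩
  -- The kernel of `g` may be larger than `J`; it is enough that its `e`-th power falls in `J`. This
  -- permits ramified targets later.
  have hGk : ∀ n, IsNilpotent (RingHom.ker (G n)) := fun n => by
    have h1 : RingHom.ker (G n) = (RingHom.ker g).map (Ideal.Quotient.mk (J ^ (n + 1))) := by
      ext a
      obtain ⟨a, rfl⟩ := Ideal.Quotient.mk_surjective a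
      refine ⟨fun h => Ideal.mem_map_of_mem _ h, fun h => ?_⟩
      obtain ⟨b, hb, hab⟩ := (Ideal.mem_map_iff_of_surjective _ Ideal.Quotient.mk_surjective).1 h
      rw [← hab]
      exact hb
    refine ⟨e * (n + 1), ?_⟩
    rw [h1, ← Ideal.map_pow, pow_mul, Ideal.zero_eq_bot, Ideal.map_eq_bot_iff_le_ker, Ideal.mk_ker]
    exact Ideal.pow_right_mono he _
  choose f hft hf using fun n => exists_etaleCoordinate_lift ht (hT n) (G n) (hGs n) (hGk n) ψ
    (Ideal.Quotient.mk _ r) hr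
  have hcomp : ∀ {m n : ℕ} (hle : m ≤ n), (Ideal.Quotient.factorₐ V
      (Ideal.pow_le_pow_right (I := J) (Nat.succ_le_succ hle))).comp (f n) = f m := by
    intro m n hle
    refine etaleCoordinate_lift_eq ht (hT m) (G m) (hGk m) ?_ ?_
    · rw [AlgHom.comp_apply, hft, hft]; rfl
    · rw [hf, ← hf n, ← AlgHom.comp_assoc]
      congr 1
      ext x
      obtain ⟨x, rfl⟩ := Ideal.Quotient.mk_surjective x
      rfl
  -- The lifts live on `R/J^(n+1)`, whereas the inverse limit is indexed from `J^0`, hence the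
  -- shift.
  let f' : ∀ n, A →ₐ[V] R ⧸ J ^ n := fun n =>
    (Ideal.Quotient.factorₐ V (Ideal.pow_le_pow_right (I := J) n.le_succ)).comp (f n)
  have hf' : ∀ {m n : ℕ} (hle : m ≤ n),
      (Ideal.Quotient.factorₐ V (Ideal.pow_le_pow_right (I := J) hle)).comp (f' n) = f' m := by
    intro m n hle
    simp only [f']
    rw [← hcomp hle, ← AlgHom.comp_assoc, ← AlgHom.comp_assoc]
    congr 1
    ext x
    obtain ⟨x, rfl⟩ := Ideal.Quotient.mk_surjective x
    rfl
  refine ⟨IsAdicComplete.liftAlgHom J f' hf', ?_, ?_⟩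
  · refine IsHausdorff.eq_iff_smodEq (I := J).2 fun n => ?_
    rw [smul_eq_mul, Ideal.mul_top, SModEq.sub_mem, ← Ideal.Quotient.eq,
      IsAdicComplete.mk_liftAlgHom]
    simp only [f', AlgHom.comp_apply, hft]
    rfl
  · ext x
    have h1 : Ideal.Quotient.mk (J ^ 1) (IsAdicComplete.liftAlgHom J f' hf' x) = f' 1 x :=
      IsAdicComplete.mk_liftAlgHom J f' hf' 1 x
    have h2 : f' 1 x = f 0 x := congrArg (· x) (hcomp (Nat.zero_le 1))
    rw [h2] at h1
    have h3 : G 0 (f 0 x) = ψ x := congrArg (· x) (hf 0)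
    rw [← h3, ← h1]
    rfl

end AdicLifting

/-! ### Adic completeness of `V`, of finite free modules and of power series rings -/

section Completeness

/-- Membership in `(ϖ)^n` is the inequality `‖v‖ ≤ ‖ϖ‖ ^ n`, so adic Cauchy sequences converge in
`K`, and the limits stay in the closed unit ball. -/
theorem isAdicComplete_of_integers {V : Type*} [CommRing V] [IsDomain V] [IsDiscreteValuationRing V]
    {K : Type*} [NormedField K] [IsUltrametricDist K] [CompleteSpace K] [Algebra V K]
    (hV : (NormedField.valuation (K := K)).Integers V) {ϖ : V} (hϖ : Irreducible ϖ) :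
    IsAdicComplete (Ideal.span {ϖ}) V := by
  have hle : ∀ v : V, ‖algebraMap V K v‖ ≤ 1 := fun v => by
    have := hV.map_le_one v
    rwa [NormedField.valuation_apply, ← NNReal.coe_le_coe] at this
  have hex : ∀ r : K, ‖r‖ ≤ 1 → ∃ v, algebraMap V K v = r := fun r hr =>
    hV.exists_of_le_one (by rwa [NormedField.valuation_apply, ← NNReal.coe_le_coe])
  have hϖ0 : algebraMap V K ϖ ≠ 0 := fun h => hϖ.ne_zero (hV.hom_inj (by rw [h, map_zero]))
  have hϖ1 : ‖algebraMap V K ϖ‖ < 1 := by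
    refine lt_of_le_of_ne (hle ϖ) fun h => hϖ.not_isUnit ?_
    obtain ⟨u, hu⟩ := hex (algebraMap V K ϖ)⁻¹ (by rw [norm_inv, h, inv_one])
    exact IsUnit.of_mul_eq_one u (hV.hom_inj (by rw [map_mul, hu, mul_inv_cancel₀ hϖ0, map_one]))
  have hdvd : ∀ n v, ‖algebraMap V K v‖ ≤ ‖algebraMap V K ϖ‖ ^ n ↔ v ∈ Ideal.span {ϖ} ^ n := by
    intro n v
    rw [Ideal.span_singleton_pow, Ideal.mem_span_singleton]
    constructor
    · intro h
      obtain ⟨w, hw⟩ := hex (algebraMap V K v / algebraMap V K ϖ ^ n) (by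
        rw [norm_div, norm_pow]
        exact div_le_one_of_le₀ h (by positivity))
      refine ⟨w, hV.hom_inj ?_⟩
      rw [map_mul, hw, map_pow]
      field_simp
    · rintro ⟨w, rfl⟩
      rw [map_mul, norm_mul, map_pow, norm_pow]
      exact mul_le_of_le_one_right (by positivity) (hle w)
  have : IsHausdorff (Ideal.span {ϖ}) V := .of_isDomain _ (by
    rw [Ne, Ideal.span_singleton_eq_top]; exact hϖ.not_isUnit)
  refine { prec' := fun f hf => ?_ }
  have hf' : ∀ m n, m ≤ n → ‖algebraMap V K (f m) - algebraMap V K (f n)‖ ≤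
      ‖algebraMap V K ϖ‖ ^ m := fun m n hmn => by
    rw [← map_sub, hdvd]
    have := hf hmn
    rwa [SModEq.sub_mem, smul_eq_mul, Ideal.mul_top] at this
  have hc : CauchySeq fun n => algebraMap V K (f n) := by
    refine cauchySeq_of_le_geometric _ 1 hϖ1 fun n => ?_
    rw [dist_eq_norm, one_mul]
    exact hf' n _ n.le_succ
  obtain ⟨L, hL⟩ := cauchySeq_tendsto_of_complete hc
  obtain ⟨v, rfl⟩ := hex L (le_of_tendsto hL.norm (.of_forall fun n => hle _))
  refine ⟨v, fun n => ?_⟩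
  rw [SModEq.sub_mem, smul_eq_mul, Ideal.mul_top, ← hdvd, map_sub]
  exact le_of_tendsto ((tendsto_const_nhds.sub hL).norm)
    (Filter.eventually_atTop.2 ⟨n, fun m hm => hf' n m hm⟩)

theorem mem_pow_smul_top_iff_repr {R M ι : Type*} [CommRing R] [AddCommGroup M] [Module R M]
    [Finite ι] (b : Module.Basis ι R M) (I : Ideal R) (x : M) :
    x ∈ (I • ⊤ : Submodule R M) ↔ ∀ i, b.repr x i ∈ I := by
  have := Fintype.ofFinite ι
  constructor
  · intro h i
    have := Submodule.mem_map_of_mem (f := b.coord i) h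
    rw [Submodule.map_smul''] at this
    exact Submodule.smul_le.2 (fun r hr n _ => I.mul_mem_right n hr) this
  · intro h
    rw [← b.sum_repr x]
    exact Submodule.sum_mem _ fun i _ => Submodule.smul_mem_smul (h i) trivial

theorem isAdicComplete_of_basis {R M ι : Type*} [CommRing R] [AddCommGroup M] [Module R M]
    [Finite ι] (b : Module.Basis ι R M) (I : Ideal R) [IsAdicComplete I R] :
    IsAdicComplete I M where
  haus' x hx := by
    refine b.ext_elem fun i => ?_
    rw [map_zero]
    refine IsHausdorff.haus (I := I) inferInstance _ fun n => ?_
    have := hx n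
    rw [SModEq.zero, mem_pow_smul_top_iff_repr b] at this
    rw [SModEq.zero, smul_eq_mul, Ideal.mul_top]
    exact this i
  prec' f hf := by
    have h1 : ∀ i, ∃ L, ∀ n, b.repr (f n) i ≡ L [SMOD (I ^ n • ⊤ : Ideal R)] := fun i =>
      IsPrecomplete.prec' (I := I) (M := R) (fun n => b.repr (f n) i) (fun {m n} hmn => by
        have := hf hmn
        rw [SModEq.sub_mem, mem_pow_smul_top_iff_repr b] at this
        rw [SModEq.sub_mem, smul_eq_mul, Ideal.mul_top]
        simpa using this i)
    choose L hL using h1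
    refine ⟨b.equivFun.symm L, fun n => ?_⟩
    rw [SModEq.sub_mem, mem_pow_smul_top_iff_repr b]
    intro i
    have := hL i n
    rw [SModEq.sub_mem, smul_eq_mul, Ideal.mul_top] at this
    have h2 : b.repr (b.equivFun.symm L) i = L i := by
      rw [← b.equivFun_apply, LinearEquiv.apply_symm_apply]
    rwa [map_sub, Finsupp.sub_apply, h2]

-- This turns `(I, X)`-adic congruences into conditions on finitely many coefficients. For the
-- converse, the part of `f` beyond degree `n` is divisible by `X ^ n`, so `I` need not be finitely
-- generated.
open PowerSeries in
theorem mem_pow_powerSeries_iff {R : Type*} [CommRing R] (I : Ideal R) (n : ℕ) (f : R⟦X⟧) :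
    f ∈ (I.map (C (R := R)) ⊔ Ideal.span {X}) ^ n ↔ ∀ i, i < n → coeff i f ∈ I ^ (n - i) := by
  constructor
  · induction n generalizing f with
    | zero => simp
    | succ n ih =>
      intro h i hi
      rw [pow_succ] at h
      induction h using Submodule.mul_induction_on' with
      | mem_mul_mem g hg a ha =>
        obtain ⟨a, ha0, b, hb, rfl⟩ := Submodule.mem_sup.1 ha
        obtain ⟨b, rfl⟩ := Ideal.mem_span_singleton'.1 hb
        rw [mul_add, map_add]
        have h1 : ∀ j, j ≤ n → coeff j g ∈ I ^ (n - j) := fun j hj => by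
          rcases hj.lt_or_eq with h | rfl
          · exact ih g hg j h
          · simp
        refine add_mem ?_ ?_
        · rw [coeff_mul]
          refine Ideal.sum_mem _ fun p hp => ?_
          have hp' := Finset.HasAntidiagonal.mem_antidiagonal.1 hp
          have ha' : coeff p.2 a ∈ I := by
            have hle : I.map (C (R := R)) ≤
                RingHom.ker (PowerSeries.map (Ideal.Quotient.mk I)) := by
              refine Ideal.map_le_iff_le_comap.2 fun x hx => ?_
              rw [Ideal.mem_comap, RingHom.mem_ker, map_C, Ideal.Quotient.eq_zero_iff_mem.2 hx,
                map_zero]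
            have := congrArg (coeff p.2) (RingHom.mem_ker.1 (hle ha0))
            rwa [coeff_map, map_zero, Ideal.Quotient.eq_zero_iff_mem] at this
          refine Ideal.pow_le_pow_right (?_ : n + 1 - i ≤ n - p.1 + 1) ?_
          · omega
          · rw [pow_succ]
            exact Ideal.mul_mem_mul (h1 _ (by omega)) ha'
        · rw [← mul_assoc]
          rcases i with _ | i
          · simp
          · rw [coeff_succ_mul_X, coeff_mul]
            refine Ideal.sum_mem _ fun p hp => ?_
            have hp' := Finset.HasAntidiagonal.mem_antidiagonal.1 hp
            refine Ideal.mul_mem_right _ _ (Ideal.pow_le_pow_right ?_ (h1 p.1 (by omega)))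
            omega
      | add x _ y _ hx hy => rw [map_add]; exact add_mem hx hy
  · intro h
    have hf : f = ∑ i ∈ Finset.range n, C (coeff i f) * X ^ i +
        X ^ n * PowerSeries.mk fun i => coeff (i + n) f := by
      ext j
      simp only [map_add, map_sum, coeff_C_mul, coeff_X_pow, mul_ite, mul_one, mul_zero,
        Finset.sum_ite_eq, Finset.mem_range, coeff_X_pow_mul']
      by_cases hj : j < n
      · simp [hj]
      · simp [hj, not_lt.1 hj, Nat.sub_add_cancel (not_lt.1 hj)]
    rw [hf]
    refine add_mem (Ideal.sum_mem _ fun i hi => ?_) ?_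
    · have hi' := Finset.mem_range.1 hi
      rw [← Nat.sub_add_cancel hi'.le, pow_add]
      refine Ideal.mul_mem_mul ?_ (Ideal.pow_mem_pow (Ideal.mem_sup_right
        (Ideal.mem_span_singleton_self _)) _)
      refine Ideal.pow_right_mono le_sup_left _ ?_
      rw [← Ideal.map_pow]
      exact Ideal.mem_map_of_mem (C (R := R)) (h i hi')
    · exact Ideal.mul_mem_right _ _ (Ideal.pow_mem_pow (Ideal.mem_sup_right
        (Ideal.mem_span_singleton_self _)) _)

open PowerSeries in
theorem isAdicComplete_powerSeries {R : Type*} [CommRing R] (I : Ideal R) [IsAdicComplete I R] :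
    IsAdicComplete (I.map (C (R := R)) ⊔ Ideal.span {X}) R⟦X⟧ where
  haus' f hf := by
    ext i
    rw [map_zero]
    refine IsHausdorff.haus (I := I) inferInstance _ fun n => ?_
    rcases n with _ | n
    · simp
    have := hf (n + 1 + i)
    rw [SModEq.zero, smul_eq_mul, Ideal.mul_top, mem_pow_powerSeries_iff] at this
    rw [SModEq.zero, smul_eq_mul, Ideal.mul_top]
    simpa using this i (by omega)
  prec' f hf := by
    -- A congruence modulo `(I, X)^(n+i)` controls the `i`-th coefficient only modulo `I^n`; the
    -- index is shifted by `i` to compensate.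
    have h1 : ∀ i, ∃ L, ∀ n, coeff i (f (n + i)) ≡ L [SMOD (I ^ n • ⊤ : Ideal R)] := fun i =>
      IsPrecomplete.prec' (I := I) (M := R) (fun n => coeff i (f (n + i))) (fun {m n} hmn => by
        rcases m with _ | m
        · simp
        have := hf (Nat.add_le_add_right hmn i)
        rw [SModEq.sub_mem, smul_eq_mul, Ideal.mul_top, mem_pow_powerSeries_iff] at this
        rw [SModEq.sub_mem, smul_eq_mul, Ideal.mul_top]
        simpa using this i (by omega))
    choose L hL using h1
    refine ⟨PowerSeries.mk L, fun n => ?_⟩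
    rw [SModEq.sub_mem, smul_eq_mul, Ideal.mul_top, mem_pow_powerSeries_iff]
    intro i hi
    have := hL i (n - i)
    rw [SModEq.sub_mem, smul_eq_mul, Ideal.mul_top, Nat.sub_add_cancel hi.le] at this
    rwa [map_sub, coeff_mk]

end Completeness

/-! ### Torsion, divisibility and units in the completion -/

section CompletionStructure

variable {V : Type*} [CommRing V] {ϖ : V} {D : Type*} [Ring D] [Algebra V D]

namespace Completion

theorem mk_eq_of_le (H : Completion ϖ D) {i j : ℕ} (hij : i ≤ j) {P : D}
    (hP : Ideal.Quotient.mk (scalarIdeal (ϖ ^ j) D) P = H.1 j) :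
    Ideal.Quotient.mk (scalarIdeal (ϖ ^ i) D) P = H.1 i := by
  induction j, hij using Nat.le_induction with
  | base => exact hP
  | succ j hij ih =>
    refine ih ?_
    rw [← H.2 j, ← hP]
    rfl

theorem val_zero_eq (H : Completion ϖ D) (x : D ⧸ scalarIdeal (ϖ ^ 0) D) : H.1 0 = x := by
  obtain ⟨P, hP⟩ := Ideal.Quotient.mk_surjective (H.1 0)
  obtain ⟨Q, rfl⟩ := Ideal.Quotient.mk_surjective x
  rw [← hP, Ideal.Quotient.eq]
  exact mem_scalarIdeal.2 ⟨P - Q, by rw [pow_zero, one_smul]⟩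

theorem ext_val {H H' : Completion ϖ D} (h : ∀ n, H.1 n = H'.1 n) : H = H' :=
  Subtype.ext (funext h)

theorem val_mk_smul (v : V) (P : D) (i : ℕ) :
    v • Ideal.Quotient.mk (scalarIdeal (ϖ ^ i) D) P = Ideal.Quotient.mk _ (v • P) := rfl

theorem val_pow_smul_eq_zero (H : Completion ϖ D) (n : ℕ) : (ϖ ^ n • H).1 n = 0 := by
  obtain ⟨P, hP⟩ := Ideal.Quotient.mk_surjective (H.1 n)
  change ϖ ^ n • H.1 n = 0
  rw [← hP, val_mk_smul, Ideal.Quotient.eq_zero_iff_mem]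
  exact mem_scalarIdeal.2 ⟨P, rfl⟩

theorem smul_val_one_eq_zero (H : Completion ϖ D) : (ϖ • H).1 1 = 0 := by
  simpa using val_pow_smul_eq_zero H 1

/-- Cancelling `ϖ` costs one level of precision: vanishing of `ϖ • H` at level `n + 1` gives
vanishing of `H` at level `n`. -/
theorem eq_zero_of_smul_eq_zero (hD : ∀ P : D, ϖ • P = 0 → P = 0) {H : Completion ϖ D}
    (h : ϖ • H = 0) : H = 0 := by
  refine ext_val fun n => ?_
  obtain ⟨P, hP⟩ := Ideal.Quotient.mk_surjective (H.1 (n + 1))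
  have h1 : ϖ • H.1 (n + 1) = 0 := congrArg (fun H : Completion ϖ D => H.1 (n + 1)) h
  rw [← hP, val_mk_smul, Ideal.Quotient.eq_zero_iff_mem] at h1
  obtain ⟨Q, hQ⟩ := mem_scalarIdeal.1 h1
  rw [← mk_eq_of_le H n.le_succ hP]
  refine Ideal.Quotient.eq_zero_iff_mem.2 (mem_scalarIdeal.2 ⟨Q, ?_⟩)
  rw [← sub_eq_zero]
  apply hD
  rw [smul_sub, smul_smul, ← pow_succ', hQ, sub_self]

/-- Level `i` of the quotient is a representative of level `i + 1` of `H` divided by `ϖ`; absence of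
torsion makes these quotients compatible. -/
theorem exists_smul_of_val_one_eq_zero (hD : ∀ P : D, ϖ • P = 0 → P = 0) {H : Completion ϖ D}
    (h : H.1 1 = 0) : ∃ H', H = ϖ • H' := by
  choose P hP using fun i => Ideal.Quotient.mk_surjective (H.1 (i + 1))
  have h1 : ∀ i, ∃ Q, ϖ • Q = P i := fun i => by
    have := mk_eq_of_le H (Nat.le_add_left 1 i) (hP i)
    rw [h, Ideal.Quotient.eq_zero_iff_mem, pow_one] at this
    exact mem_scalarIdeal.1 this
  choose Q hQ using h1
  refine ⟨⟨fun i => Ideal.Quotient.mk _ (Q i), fun i => ?_⟩, ext_val fun i => ?_⟩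
  · change Ideal.Quotient.mk _ (Q (i + 1)) = _
    rw [Ideal.Quotient.eq]
    have := (mk_eq_of_le H (Nat.le_succ (i + 1)) (hP (i + 1))).trans (hP i).symm
    rw [Ideal.Quotient.eq] at this
    obtain ⟨T, hT⟩ := mem_scalarIdeal.1 this
    refine mem_scalarIdeal.2 ⟨T, ?_⟩
    rw [← sub_eq_zero]
    apply hD
    rw [smul_sub, smul_sub, hQ, hQ, smul_smul, ← pow_succ', hT, sub_self]
  · change H.1 i = ϖ • Ideal.Quotient.mk _ (Q i)
    rw [val_mk_smul, hQ]
    exact (mk_eq_of_le H i.le_succ (hP i)).symm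

theorem exists_pow_smul (hD : ∀ P : D, ϖ • P = 0 → P = 0) {H : Completion ϖ D} (h : H ≠ 0) :
    ∃ n H', H = ϖ ^ n • H' ∧ H'.1 1 ≠ 0 := by
  by_contra! hcon
  have h1 : ∀ n, ∃ H', H = ϖ ^ n • H' := by
    intro n
    induction n with
    | zero => exact ⟨H, by simp⟩
    | succ n ih =>
      obtain ⟨H', hH'⟩ := ih
      obtain ⟨H'', rfl⟩ := exists_smul_of_val_one_eq_zero hD (hcon n H' hH')
      exact ⟨H'', by rw [hH', smul_smul, pow_succ]⟩
  refine h (ext_val fun n => ?_)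
  obtain ⟨H', rfl⟩ := h1 n
  exact val_pow_smul_eq_zero H' n

/-- An inverse modulo `ϖ` lifts to an inverse modulo each `ϖ ^ n` because `ϖ` is central and
nilpotent there. Uniqueness of inverses makes them a compatible system. -/
theorem isUnit_of_isUnit_val_one {H : Completion ϖ D} (h : IsUnit (H.1 1)) : IsUnit H := by
  have hn : ∀ n, IsUnit (H.1 n) := by
    intro n
    rcases n with _ | n
    · rw [val_zero_eq H 1]; exact isUnit_one
    obtain ⟨P, hP⟩ := Ideal.Quotient.mk_surjective (H.1 (n + 1))
    have hP1 := mk_eq_of_le H (Nat.le_add_left 1 n) hP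
    obtain ⟨⟨x, y, hxy, hyx⟩, rfl : x = _⟩ := h
    obtain ⟨Q, rfl⟩ := Ideal.Quotient.mk_surjective y
    -- The ring is not commutative, so `P * Q` and `Q * P` are treated separately; they supply a
    -- right and a left inverse.
    have key : ∀ S T : D, Ideal.Quotient.mk (scalarIdeal (ϖ ^ 1) D) S *
        Ideal.Quotient.mk _ T = 1 → IsUnit (Ideal.Quotient.mk (scalarIdeal (ϖ ^ (n + 1)) D) S *
          Ideal.Quotient.mk _ T) := by
      intro S T hST
      rw [← map_mul, ← map_one (Ideal.Quotient.mk _), eq_comm, Ideal.Quotient.eq] at hST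
      obtain ⟨U, hU⟩ := mem_scalarIdeal.1 hST
      rw [← map_mul, show S * T = 1 - ϖ ^ 1 • U by rw [hU, sub_sub_cancel], map_sub, map_one]
      refine IsNilpotent.isUnit_one_sub ⟨n + 1, ?_⟩
      rw [← map_pow, Ideal.Quotient.eq_zero_iff_mem, smul_pow, pow_one]
      exact mem_scalarIdeal.2 ⟨_, rfl⟩
    rw [hP1.symm] at hxy hyx
    have h1 := key P Q hxy
    have h2 := key Q P hyx
    rw [← hP]
    exact isUnit_iff_exists_and_exists.2 ⟨⟨_, (mul_assoc _ _ _).symm.trans h1.mul_val_inv⟩,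
      ⟨_, (mul_assoc _ _ _).trans h2.val_inv_mul⟩⟩
  choose u hu using hn
  have hc : ∀ n, Ideal.Quotient.factor (scalarIdeal_succ_le ϖ D n)
      ((↑(u (n + 1))⁻¹ : D ⧸ scalarIdeal (ϖ ^ (n + 1)) D)) = ↑(u n)⁻¹ := by
    intro n
    refine (Units.inv_eq_of_mul_eq_one_right ?_).symm
    rw [hu, ← H.2 n, ← map_mul, ← hu, Units.mul_inv, map_one]
  refine ⟨⟨H, ⟨fun n => ↑(u n)⁻¹, hc⟩, ?_, ?_⟩, rfl⟩
  · refine ext_val fun n => ?_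
    change H.1 n * ↑(u n)⁻¹ = 1
    rw [← hu, Units.mul_inv]
  · refine ext_val fun n => ?_
    change ↑(u n)⁻¹ * H.1 n = 1
    rw [← hu, Units.inv_mul]

end Completion

end CompletionStructure

/-! ### Degrees and leading coefficients modulo `ϖ` -/

section LeadingCoefficient

variable {V R : Type*} [CommRing V] [CommRing R] [Algebra V R] {δ : Derivation V R R}

namespace DiffOp

theorem coeff_deltaMul_succ (n : ℕ) (Q : DiffOp δ) :
    coeff δ (n + 1) (deltaMul δ Q) = coeff δ n Q + δ (coeff δ (n + 1) Q) := by
  induction Q using induction_on with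
  | h0 => simp
  | ha P Q hP hQ => simp only [map_add, hP, hQ]; abel
  | hm m a =>
    rw [deltaMul_monomial, map_add, coeff_monomial, coeff_monomial, coeff_monomial,
      coeff_monomial]
    split_ifs <;> simp_all

/-- Each multiplication by `δ` shifts the coefficients up by one and adds `δ` of the coefficient
already in that degree. At the new top degree that coefficient lies in `I`, so the leading
coefficient is unchanged modulo `I`. -/
theorem coeff_deltaMul_pow {I : Ideal R} (hI : ∀ a ∈ I, δ a ∈ I) {m : ℕ} {Q : DiffOp δ}
    (hQ : ∀ l, m < l → coeff δ l Q ∈ I) (n : ℕ) :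
    (∀ l, n + m < l → coeff δ l ((deltaMul δ ^ n) Q) ∈ I) ∧
      coeff δ (n + m) ((deltaMul δ ^ n) Q) - coeff δ m Q ∈ I := by
  induction n with
  | zero => simpa using hQ
  | succ n ih =>
    rw [pow_succ', Module.End.mul_apply]
    refine ⟨fun l hl => ?_, ?_⟩
    · obtain ⟨l, rfl⟩ : ∃ l', l = l' + 1 := ⟨l - 1, by omega⟩
      rw [coeff_deltaMul_succ]
      exact add_mem (ih.1 _ (by omega)) (hI _ (ih.1 _ (by omega)))
    · rw [show n + 1 + m = n + m + 1 by omega, coeff_deltaMul_succ, add_sub_right_comm]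
      exact add_mem ih.2 (hI _ (ih.1 _ (by omega)))

theorem eq_sum_monomial (P : DiffOp δ) :
    ∃ s : Finset ℕ, (∀ n, n ∉ s → coeff δ n P = 0) ∧ P = ∑ n ∈ s, monomial δ n (coeff δ n P) :=
  ⟨Finsupp.support P, fun _ h => Finsupp.notMem_support_iff.1 h, (Finsupp.sum_single P).symm⟩

/-- Modulo an ideal that is stable under the derivation, leading coefficients multiply. -/
theorem coeff_mul {I : Ideal R} (hI : ∀ a ∈ I, δ a ∈ I) {n m : ℕ} {P Q : DiffOp δ}
    (hP : ∀ l, n < l → coeff δ l P ∈ I) (hQ : ∀ l, m < l → coeff δ l Q ∈ I) :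
    (∀ l, n + m < l → coeff δ l (P * Q) ∈ I) ∧
      coeff δ (n + m) (P * Q) - coeff δ n P * coeff δ m Q ∈ I := by
  obtain ⟨s, hs, e⟩ := eq_sum_monomial P
  have h1 : ∀ l, coeff δ l (P * Q) =
      ∑ i ∈ s, coeff δ i P * coeff δ l ((deltaMul δ ^ i) Q) := fun l => by
    conv_lhs => rw [e]
    simp only [Finset.sum_mul, map_sum, monomial_mul, map_smul, smul_eq_mul]
  -- Terms with `i > n` have their coefficient in `I`; otherwise `i + m < l`, and `δⁱ Q` has nothing
  -- in degree `l` modulo `I`.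
  have h2 : ∀ i l, n + m ≤ l → i ≠ n ∨ n + m < l →
      coeff δ i P * coeff δ l ((deltaMul δ ^ i) Q) ∈ I := by
    intro i l hl hi
    rcases lt_or_ge n i with h | h
    · exact I.mul_mem_right _ (hP i h)
    · exact I.mul_mem_left _ ((coeff_deltaMul_pow hI hQ i).1 l (by omega))
  refine ⟨fun l hl => ?_, ?_⟩
  · rw [h1]
    exact Ideal.sum_mem _ fun i _ => h2 i l hl.le (.inr hl)
  · rw [h1]
    have h3 := coeff_deltaMul_pow hI hQ n
    by_cases hn : n ∈ s
    · rw [← Finset.add_sum_erase s _ hn, add_sub_right_comm, ← mul_sub]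
      exact add_mem (I.mul_mem_left _ h3.2) (Ideal.sum_mem _ fun i hi =>
        h2 i _ le_rfl (.inl (Finset.ne_of_mem_erase hi)))
    · rw [hs n hn, zero_mul, sub_zero]
      exact Ideal.sum_mem _ fun i hi => h2 i _ le_rfl (.inl fun h => hn (h ▸ hi))

theorem smul_eq_zero_of_regular {ϖ : V} (hR : ∀ a : R, ϖ • a = 0 → a = 0) (P : DiffOp δ)
    (h : ϖ • P = 0) : P = 0 := by
  refine ext fun n => ?_
  rw [map_zero]
  refine hR _ ?_
  rw [← (coeff δ n).map_smul_of_tower, h, map_zero]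

theorem mem_scalarIdeal_iff_coeff {v : V} {P : DiffOp δ} :
    P ∈ scalarIdeal v (DiffOp δ) ↔ ∀ n, coeff δ n P ∈ Ideal.span {algebraMap V R v} := by
  constructor
  · intro h n
    obtain ⟨Q, rfl⟩ := mem_scalarIdeal.1 h
    rw [(coeff δ n).map_smul_of_tower, Algebra.smul_def]
    exact Ideal.mul_mem_right _ _ (Ideal.mem_span_singleton_self _)
  · intro h
    obtain ⟨s, -, e⟩ := eq_sum_monomial P
    rw [e]
    refine Ideal.sum_mem _ fun n _ => ?_
    obtain ⟨a, ha⟩ := Ideal.mem_span_singleton'.1 (h n)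
    refine mem_scalarIdeal.2 ⟨monomial δ n a, ?_⟩
    rw [← ha, mul_comm, ← Algebra.smul_def, (monomial δ n).map_smul_of_tower]

end DiffOp

theorem derivation_mem_span (δ : Derivation V R R) (v : V) (a : R)
    (ha : a ∈ Ideal.span {algebraMap V R v}) : δ a ∈ Ideal.span {algebraMap V R v} := by
  obtain ⟨b, rfl⟩ := Ideal.mem_span_singleton'.1 ha
  rw [mul_comm, ← Algebra.smul_def, δ.map_smul, Algebra.smul_def]
  exact Ideal.mul_mem_right _ _ (Ideal.mem_span_singleton_self _)

variable {ϖ : V}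

/-- The reduction modulo `ϖ` of an operator has degree `n` and leading coefficient the residue class
of `a`. -/
def HasLeadingCoeff (H : Completion ϖ (DiffOp δ)) (n : ℕ) (a : R) : Prop :=
  a ∉ Ideal.span {algebraMap V R ϖ} ∧ ∃ P : DiffOp δ, Ideal.Quotient.mk _ P = H.1 1 ∧
    DiffOp.coeff δ n P - a ∈ Ideal.span {algebraMap V R ϖ} ∧
    ∀ l, n < l → DiffOp.coeff δ l P ∈ Ideal.span {algebraMap V R ϖ}

namespace HasLeadingCoeff

theorem exists_of_val_one_ne_zero {H : Completion ϖ (DiffOp δ)} (h : H.1 1 ≠ 0) :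
    ∃ n a, HasLeadingCoeff H n a := by
  classical
  obtain ⟨P, hP⟩ := Ideal.Quotient.mk_surjective (H.1 1)
  rw [← hP, Ne, Ideal.Quotient.eq_zero_iff_mem, DiffOp.mem_scalarIdeal_iff_coeff, pow_one] at h
  obtain ⟨s, hs, -⟩ := DiffOp.eq_sum_monomial P
  obtain ⟨k, hk⟩ := not_forall.1 h
  let s' := s.filter fun n => DiffOp.coeff δ n P ∉ Ideal.span {algebraMap V R ϖ}
  have hs' : ∀ n, DiffOp.coeff δ n P ∉ Ideal.span {algebraMap V R ϖ} → n ∈ s' := fun n hn =>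
    Finset.mem_filter.2 ⟨by_contra fun h' => hn (hs n h' ▸ zero_mem _), hn⟩
  have hne : s'.Nonempty := ⟨k, hs' k hk⟩
  refine ⟨s'.max' hne, _, (Finset.mem_filter.1 (s'.max'_mem hne)).2, P, hP, ?_, fun l hl => ?_⟩
  · rw [sub_self]; exact zero_mem _
  · by_contra hl'
    exact absurd (s'.le_max' l (hs' l hl')) (not_le.2 hl)

theorem val_one_ne_zero {H : Completion ϖ (DiffOp δ)} {n : ℕ} {a : R} (h : HasLeadingCoeff H n a) :
    H.1 1 ≠ 0 := by
  obtain ⟨ha, P, hP, hn, -⟩ := h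
  intro h0
  rw [← hP, Ideal.Quotient.eq_zero_iff_mem, DiffOp.mem_scalarIdeal_iff_coeff, pow_one] at h0
  exact ha (by simpa using sub_mem (h0 n) hn)

/-- Primality keeps the product of the leading coefficients nonzero modulo `ϖ`. All the additivity
and multiplicativity in the theorem comes from here. -/
theorem mul [(Ideal.span {algebraMap V R ϖ}).IsPrime] {H Q : Completion ϖ (DiffOp δ)} {n m : ℕ}
    {a b : R} (hH : HasLeadingCoeff H n a) (hQ : HasLeadingCoeff Q m b) :
    HasLeadingCoeff (H * Q) (n + m) (a * b) := by
  obtain ⟨ha, P, hP, hPn, hPl⟩ := hH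
  obtain ⟨hb, T, hT, hTm, hTl⟩ := hQ
  obtain ⟨h1, h2⟩ := DiffOp.coeff_mul (derivation_mem_span δ ϖ) hPl hTl
  refine ⟨fun h => ((Ideal.IsPrime.mem_or_mem inferInstance h).elim ha hb), P * T, ?_, ?_, h1⟩
  · rw [map_mul, hP, hT]; rfl
  · have h3 := add_mem h2 (add_mem (Ideal.mul_mem_right (DiffOp.coeff δ m T) _ hPn)
      (Ideal.mul_mem_left _ a hTm))
    convert h3 using 1
    ring

theorem unique {H : Completion ϖ (DiffOp δ)} {n m : ℕ} {a b : R} (hH : HasLeadingCoeff H n a)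
    (hH' : HasLeadingCoeff H m b) : n = m ∧ a - b ∈ Ideal.span {algebraMap V R ϖ} := by
  obtain ⟨ha, P, hP, hPn, hPl⟩ := hH
  obtain ⟨hb, T, hT, hTm, hTl⟩ := hH'
  have h : ∀ l, DiffOp.coeff δ l P - DiffOp.coeff δ l T ∈ Ideal.span {algebraMap V R ϖ} := by
    intro l
    have := coeff_sub_mem l (hP.trans hT.symm)
    rwa [pow_one] at this
  have hnm : n = m := by
    by_contra hne
    rcases lt_or_gt_of_ne hne with hlt | hlt
    · apply hb
      have := sub_mem (sub_mem (hPl m hlt) (h m)) hTm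
      simpa using this
    · apply ha
      have := sub_mem (add_mem (h n) (hTl n hlt)) hPn
      simpa using this
  subst hnm
  refine ⟨rfl, ?_⟩
  have := sub_mem (add_mem (h n) hTm) hPn
  convert this using 1
  ring

theorem one [(Ideal.span {algebraMap V R ϖ}).IsPrime] :
    HasLeadingCoeff (1 : Completion ϖ (DiffOp δ)) 0 1 := by
  refine ⟨fun h => Ideal.IsPrime.ne_top inferInstance ((Ideal.eq_top_iff_one _).2 h), 1, rfl, ?_,
    fun l hl => ?_⟩
  · rw [DiffOp.one_def, DiffOp.coeff_monomial, if_pos rfl, sub_self]; exact zero_mem _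
  · rw [DiffOp.one_def, DiffOp.coeff_monomial, if_neg hl.ne]; exact zero_mem _

/-- In degree zero the reduction of `H` is the class of `a` itself, and invertibility is detected
modulo `ϖ`. -/
theorem isUnit {H : Completion ϖ (DiffOp δ)} {a : R} (hH : HasLeadingCoeff H 0 a) (ha : IsUnit a) :
    IsUnit H := by
  obtain ⟨-, P, hP, hP0, hPl⟩ := hH
  refine Completion.isUnit_of_isUnit_val_one ?_
  have h1 : H.1 1 = Ideal.Quotient.mk _ (DiffOp.monomial δ 0 a) := by
    rw [← hP, Ideal.Quotient.eq, DiffOp.mem_scalarIdeal_iff_coeff, pow_one]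
    intro n
    rw [map_sub, DiffOp.coeff_monomial]
    rcases n with _ | n
    · exact hP0
    · simpa using hPl (n + 1) n.succ_pos
  rw [h1]
  refine IsUnit.map _ ?_
  obtain ⟨⟨a, b, hab, hba⟩, rfl⟩ := ha
  refine ⟨⟨DiffOp.monomial δ 0 a, DiffOp.monomial δ 0 b, ?_, ?_⟩, rfl⟩
  · rw [DiffOp.monomial_mul, pow_zero, Module.End.one_apply, DiffOp.smul_monomial, hab]; rfl
  · rw [DiffOp.monomial_mul, pow_zero, Module.End.one_apply, DiffOp.smul_monomial, hba]; rfl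

theorem isCoeff_coeffHat [IsAdicComplete (Ideal.span {algebraMap V R ϖ}) R]
    (H : Completion ϖ (DiffOp δ)) (n : ℕ) : IsCoeff H n (coeffHat δ ϖ n H) :=
  (exists_isCoeff H n).choose_spec

theorem coeffHat_sub_mem [IsAdicComplete (Ideal.span {algebraMap V R ϖ}) R]
    {H : Completion ϖ (DiffOp δ)} {n : ℕ} {a : R} (hH : HasLeadingCoeff H n a) :
    coeffHat δ ϖ n H - a ∈ Ideal.span {algebraMap V R ϖ} := by
  obtain ⟨-, P, hP, hPn, -⟩ := hH
  have := isCoeff_coeffHat H n 1 P hP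
  rw [pow_one] at this
  simpa using sub_mem hPn this

theorem coeffHat_mem [IsAdicComplete (Ideal.span {algebraMap V R ϖ}) R]
    {H : Completion ϖ (DiffOp δ)} {n : ℕ} {a : R} (hH : HasLeadingCoeff H n a) {l : ℕ}
    (hl : n < l) : coeffHat δ ϖ l H ∈ Ideal.span {algebraMap V R ϖ} := by
  obtain ⟨-, P, hP, -, hPl⟩ := hH
  have := isCoeff_coeffHat H l 1 P hP
  rw [pow_one] at this
  simpa using sub_mem (hPl l hl) this

theorem coeffHat_notMem [IsAdicComplete (Ideal.span {algebraMap V R ϖ}) R]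
    {H : Completion ϖ (DiffOp δ)} {n : ℕ} {a : R} (hH : HasLeadingCoeff H n a) :
    coeffHat δ ϖ n H ∉ Ideal.span {algebraMap V R ϖ} :=
  fun h => hH.1 (by simpa using sub_mem h hH.coeffHat_sub_mem)

end HasLeadingCoeff

end LeadingCoefficient

/-! ### Spectral norms over a complete discretely valued field -/

section SpectralNorm

variable {V : Type*} [CommRing V] {K : Type*} [NormedField K] [IsUltrametricDist K] [Algebra V K]

theorem norm_algebraMap_le_one (hV : (NormedField.valuation (K := K)).Integers V) (v : V) :
    ‖algebraMap V K v‖ ≤ 1 := by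
  have := hV.map_le_one v
  rwa [NormedField.valuation_apply, ← NNReal.coe_le_coe] at this

theorem exists_algebraMap_eq_of_norm_le_one (hV : (NormedField.valuation (K := K)).Integers V)
    {r : K} (hr : ‖r‖ ≤ 1) : ∃ v, algebraMap V K v = r :=
  hV.exists_of_le_one (by rwa [NormedField.valuation_apply, ← NNReal.coe_le_coe])

theorem norm_algebraMap_eq_one_iff (hV : (NormedField.valuation (K := K)).Integers V) {v : V} :
    ‖algebraMap V K v‖ = 1 ↔ IsUnit v := by
  constructor
  · intro h
    have h0 : algebraMap V K v ≠ 0 := by rintro h0; simp [h0] at h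
    obtain ⟨u, hu⟩ := exists_algebraMap_eq_of_norm_le_one hV (r := (algebraMap V K v)⁻¹)
      (by rw [norm_inv, h, inv_one])
    exact IsUnit.of_mul_eq_one u (hV.hom_inj (by rw [map_mul, hu, mul_inv_cancel₀ h0, map_one]))
  · rintro ⟨⟨v, w, h, -⟩, rfl⟩
    have h1 := congrArg (fun x => ‖algebraMap V K x‖) h
    simp only [map_mul, norm_mul, map_one, norm_one] at h1
    have h2 := norm_algebraMap_le_one hV v
    have h3 := norm_algebraMap_le_one hV w
    refine le_antisymm h2 ?_
    rw [← h1]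
    exact mul_le_of_le_one_right (norm_nonneg _) h3

theorem norm_algebraMap_uniformizer_lt_one (hV : (NormedField.valuation (K := K)).Integers V)
    {ϖ : V} (hϖ : Irreducible ϖ) : ‖algebraMap V K ϖ‖ < 1 :=
  lt_of_le_of_ne (norm_algebraMap_le_one hV ϖ) fun h =>
    hϖ.not_isUnit ((norm_algebraMap_eq_one_iff hV).1 h)

theorem algebraMap_uniformizer_ne_zero (hV : (NormedField.valuation (K := K)).Integers V)
    {ϖ : V} (hϖ : Irreducible ϖ) : algebraMap V K ϖ ≠ 0 := fun h =>
  hϖ.ne_zero (hV.hom_inj (by rw [h, map_zero]))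

variable [IsDomain V] [IsDiscreteValuationRing V]

theorem dvd_of_norm_lt_one (hV : (NormedField.valuation (K := K)).Integers V)
    {ϖ : V} (hϖ : Irreducible ϖ) {v : V} (hv : ‖algebraMap V K v‖ < 1) : ϖ ∣ v := by
  have h : ¬ IsUnit v := fun h => hv.ne ((norm_algebraMap_eq_one_iff hV).2 h)
  rw [← Ideal.mem_span_singleton, ← hϖ.maximalIdeal_eq]
  exact h

theorem norm_coeff_lt_one_of_spectralValue_lt_one {K : Type*} [NormedField K] {q : Polynomial K}
    (h : spectralValue q < 1) {i : ℕ} (hi : i < q.natDegree) : ‖q.coeff i‖ < 1 := by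
  have h1 := (le_ciSup (spectralValueTerms_bddAbove q) i).trans_lt h
  rw [spectralValueTerms_of_lt_natDegree q hi] at h1
  by_contra! h2
  have : (i : ℝ) < q.natDegree := by exact_mod_cast hi
  exact absurd h1 (not_lt.2 (Real.one_le_rpow h2 (one_div_nonneg.2 (by linarith))))

/-- The minimal polynomial of a transcendental element is `0` by convention. Upper bounds can thus
be proved at every maximal ideal without knowing its residue field to be algebraic over `K`. -/
theorem spectralNorm_eq_zero_of_not_isAlgebraic {K : Type*} [NormedField K]
    {L : Type*} [Field L] [Algebra K L] {y : L} (hy : ¬ IsAlgebraic K y) : spectralNorm K L y = 0 := by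
  rw [spectralNorm, minpoly.eq_zero (fun h => hy h.isAlgebraic), spectralValue]
  have : spectralValueTerms (0 : Polynomial K) = fun _ => 0 := funext fun n =>
    spectralValueTerms_of_natDegree_le 0 (by simp)
  rw [this, ciSup_const]

/-- As `V` is integrally closed, the minimal polynomial over `K` has coefficients in `V`. -/
theorem spectralNorm_le_one_of_isIntegral (hV : (NormedField.valuation (K := K)).Integers V)
    {L : Type*} [Field L] [Algebra K L] [Algebra V L] [IsScalarTower V K L] {y : L}
    (hy : IsIntegral V y) : spectralNorm K L y ≤ 1 := by
  have : IsFractionRing V K := hV.isFractionRing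
  have : FaithfulSMul V L := (faithfulSMul_iff_algebraMap_injective V L).2 (by
    rw [IsScalarTower.algebraMap_eq V K L]
    exact (algebraMap K L).injective.comp hV.hom_inj)
  rw [spectralNorm, minpoly.isIntegrallyClosed_eq_field_fractions' K hy,
    spectralValue_le_one_iff ((minpoly.monic hy).map _)]
  intro n
  rw [Polynomial.coeff_map]
  exact norm_algebraMap_le_one hV _

theorem spectralNorm_smul_eq {K : Type*} [NormedField K] [IsUltrametricDist K]
    {L : Type*} [Field L] [Algebra K L] (c : K) (y : L) :
    spectralNorm K L (c • y) = ‖c‖ * spectralNorm K L y := by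
  by_cases hy : IsAlgebraic K y
  · exact spectralNorm_smul c hy
  · rcases eq_or_ne c 0 with rfl | hc
    · simp [spectralNorm_zero]
    · rw [spectralNorm_eq_zero_of_not_isAlgebraic hy, mul_zero,
        spectralNorm_eq_zero_of_not_isAlgebraic]
      intro h
      apply hy
      have := h.smul c⁻¹
      rwa [smul_smul, inv_mul_cancel₀ hc, one_smul] at this

variable [CompleteSpace K]

theorem spectralNorm_mul_eq (hV : (NormedField.valuation (K := K)).Integers V) {L : Type*} [Field L]
    [Algebra K L] [Algebra.IsAlgebraic K L] (x y : L) :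
    spectralNorm K L (x * y) = spectralNorm K L x * spectralNorm K L y := by
  obtain ⟨ϖ, hϖ⟩ := IsDiscreteValuationRing.exists_irreducible V
  -- The inverse of a uniformizer witnesses that the norm is nontrivial.
  let _ : NontriviallyNormedField K :=
    { ‹NormedField K› with
      non_trivial := ⟨(algebraMap V K ϖ)⁻¹, by
        rw [norm_inv]
        exact (one_lt_inv₀ (norm_pos_iff.2 (algebraMap_uniformizer_ne_zero hV hϖ))).2
          (norm_algebraMap_uniformizer_lt_one hV hϖ)⟩ }
  exact spectralAlgNorm_mul x y

theorem spectralNorm_eq_one_of_mul_eq_one (hV : (NormedField.valuation (K := K)).Integers V)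
    {L : Type*} [Field L] [Algebra K L] [Algebra.IsAlgebraic K L] [Algebra V L]
    [IsScalarTower V K L] {x y : L} (hx : IsIntegral V x) (hy : IsIntegral V y) (h : x * y = 1) :
    spectralNorm K L x = 1 := by
  have h1 := spectralNorm_mul_eq hV x y
  rw [h, spectralNorm_one] at h1
  refine le_antisymm (spectralNorm_le_one_of_isIntegral hV hx) ?_
  rw [h1]
  exact mul_le_of_le_one_right (spectralNorm_nonneg _) (spectralNorm_le_one_of_isIntegral hV hy)

/-- Multiplicativity is available in algebraic extensions, so the computation is moved to `K(y)`. -/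
theorem spectralNorm_inv_lt_one (hV : (NormedField.valuation (K := K)).Integers V)
    {L : Type*} [Field L] [Algebra K L] {y : L} (hy : IsAlgebraic K y)
    (h : 1 < spectralNorm K L y) : spectralNorm K L y⁻¹ < 1 := by
  have hint := hy.isIntegral
  let E := IntermediateField.adjoin K {y}
  have : FiniteDimensional K E := IntermediateField.adjoin.finiteDimensional hint
  let g : E := IntermediateField.AdjoinSimple.gen K y
  have hg : algebraMap E L g = y := rfl
  have h1 : spectralNorm K L y⁻¹ = spectralNorm K E g⁻¹ := by
    rw [spectralNorm.eq_of_tower (L := L) (g⁻¹), map_inv₀, hg]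
  have h2 : spectralNorm K L y = spectralNorm K E g := by
    rw [spectralNorm.eq_of_tower (L := L) g, hg]
  rw [h2] at h
  rw [h1]
  have hg0 : g ≠ 0 := by rintro h0; rw [h0, spectralNorm_zero] at h; linarith
  have h3 := spectralNorm_mul_eq hV g g⁻¹
  rw [mul_inv_cancel₀ hg0, spectralNorm_one] at h3
  by_contra! h4
  nlinarith

/-- Functions on an affine formal scheme take integral values at the points of the generic
fibre. -/
theorem spectralNorm_le_one_of_isAdicComplete (hV : (NormedField.valuation (K := K)).Integers V)
    {ϖ : V} (hϖ : Irreducible ϖ) {A : Type*} [CommRing A] [Algebra V A]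
    [IsAdicComplete (Ideal.span {algebraMap V A ϖ}) A] {L : Type*} [Field L] [Algebra K L]
    (φ : A →+* L) (hφ : ∀ v, φ (algebraMap V A v) = algebraMap K L (algebraMap V K v)) (a : A) :
    spectralNorm K L (φ a) ≤ 1 := by
  by_cases halg : IsAlgebraic K (φ a)
  swap
  · rw [spectralNorm_eq_zero_of_not_isAlgebraic halg]; exact zero_le_one
  by_contra! h
  have hinv := spectralNorm_inv_lt_one hV halg h
  have ha0 : φ a ≠ 0 := by rintro h0; rw [h0, spectralNorm_zero] at h; linarith
  -- If `φ a` had norm greater than 1, the lower coefficients of `q` would lie in `ϖV`. Multiplying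
  -- `q((φ a)⁻¹) = 0` by `(φ a) ^ n` gives `φ (b + 1) = 0` with `b ∈ ϖA`, but `b + 1` is a unit
  -- since `ϖ` lies in the Jacobson radical of `A`.
  set q := minpoly K (φ a)⁻¹
  have hint : IsIntegral K (φ a)⁻¹ := halg.isIntegral.inv
  have hmon : q.Monic := minpoly.monic hint
  have h1 : ∀ i, ∃ v : V, i < q.natDegree → algebraMap V K (ϖ * v) = q.coeff i := fun i => by
    by_cases hi : i < q.natDegree
    · have h2 := norm_coeff_lt_one_of_spectralValue_lt_one hinv hi
      obtain ⟨w, hw⟩ := exists_algebraMap_eq_of_norm_le_one hV h2.le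
      rw [← hw] at h2
      obtain ⟨v, rfl⟩ := dvd_of_norm_lt_one hV hϖ h2
      exact ⟨v, fun _ => hw⟩
    · exact ⟨0, fun h => absurd h hi⟩
  choose v hv using h1
  set n := q.natDegree
  have h2 : (φ a) ^ n * (Polynomial.aeval (φ a)⁻¹ q) = 0 := by
    rw [minpoly.aeval, mul_zero]
  rw [Polynomial.aeval_eq_sum_range, Finset.sum_range_succ, show q.coeff n = 1 from hmon, one_smul,
    mul_add, ← mul_pow, mul_inv_cancel₀ ha0, one_pow, Finset.mul_sum] at h2
  let b : A := ∑ i ∈ Finset.range n, algebraMap V A (ϖ * v i) * a ^ (n - i)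
  have hb : φ b = ∑ i ∈ Finset.range n, φ a ^ n * q.coeff i • (φ a)⁻¹ ^ i := by
    rw [map_sum]
    refine Finset.sum_congr rfl fun i hi => ?_
    have hi' := Finset.mem_range.1 hi
    rw [map_mul, hφ, hv i hi', Algebra.smul_def, map_pow, ← Nat.sub_add_cancel hi'.le, pow_add,
      Nat.sub_add_cancel hi'.le, mul_left_comm, ← mul_assoc, mul_assoc, mul_assoc, ← mul_pow,
      mul_inv_cancel₀ ha0, one_pow, mul_one]
  have hbm : b ∈ Ideal.span {algebraMap V A ϖ} := Ideal.sum_mem _ fun i _ =>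
    Ideal.mul_mem_right _ _ (by
      rw [map_mul]; exact Ideal.mul_mem_right _ _ (Ideal.mem_span_singleton_self _))
  have hu : IsUnit (b * 1 + 1) := Ideal.mem_jacobson_bot.1
    (IsAdicComplete.le_jacobson_bot (Ideal.span {algebraMap V A ϖ}) hbm) 1
  have h3 := hu.map φ
  rw [mul_one, map_add, map_one, hb, h2] at h3
  exact not_isUnit_zero h3

end SpectralNorm

/-! ### The spectral norm of functions on the generic fibre -/

section SpNorm

variable {V : Type*} [CommRing V] [IsDomain V] [IsDiscreteValuationRing V]
  {K : Type*} [NormedField K] [Algebra V K] [IsUltrametricDist K] [CompleteSpace K]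
  {A : Type*} [CommRing A] [Algebra V A]

theorem spectralNorm_residue_le (hV : (NormedField.valuation (K := K)).Integers V)
    {ϖ : V} (hϖ : Irreducible ϖ) [IsAdicComplete (Ideal.span {algebraMap V A ϖ}) A]
    (c : K) (a : A) (z : MaximalSpectrum (K ⊗[V] A)) :
    letI : Field (K ⊗[V] A ⧸ z.asIdeal) := Ideal.Quotient.field z.asIdeal
    spectralNorm K (K ⊗[V] A ⧸ z.asIdeal) (Ideal.Quotient.mk z.asIdeal (c ⊗ₜ a)) ≤ ‖c‖ := by
  let _ : Field (K ⊗[V] A ⧸ z.asIdeal) := Ideal.Quotient.field z.asIdeal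
  have h1 : Ideal.Quotient.mk z.asIdeal (c ⊗ₜ[V] a) =
      c • Ideal.Quotient.mk z.asIdeal ((1 : K) ⊗ₜ[V] a) := by
    rw [← Ideal.Quotient.mkₐ_eq_mk K, ← map_smul, TensorProduct.smul_tmul', smul_eq_mul, mul_one]
  rw [h1, spectralNorm_smul_eq]
  refine mul_le_of_le_one_right (norm_nonneg _) ?_
  refine spectralNorm_le_one_of_isAdicComplete hV hϖ ((Ideal.Quotient.mk z.asIdeal).comp
    (Algebra.TensorProduct.includeRight : A →ₐ[V] K ⊗[V] A).toRingHom) (fun v => ?_) a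
  change Ideal.Quotient.mk z.asIdeal ((Algebra.TensorProduct.includeRight : A →ₐ[V] K ⊗[V] A)
    (algebraMap V A v)) = _
  rw [AlgHom.commutes, IsScalarTower.algebraMap_apply V K]
  rfl

theorem bddAbove_spectralNorm (hV : (NormedField.valuation (K := K)).Integers V)
    {ϖ : V} (hϖ : Irreducible ϖ) [IsAdicComplete (Ideal.span {algebraMap V A ϖ}) A]
    (c : K) (a : A) :
    ‖c‖ ∈ upperBounds (Set.range fun z : MaximalSpectrum (K ⊗[V] A) =>
      letI : Field (K ⊗[V] A ⧸ z.asIdeal) := Ideal.Quotient.field z.asIdeal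
      spectralNorm K (K ⊗[V] A ⧸ z.asIdeal) (Ideal.Quotient.mk z.asIdeal (c ⊗ₜ a))) := by
  rintro _ ⟨z, rfl⟩
  exact spectralNorm_residue_le hV hϖ c a z

theorem spNorm_tmul_le (hV : (NormedField.valuation (K := K)).Integers V)
    {ϖ : V} (hϖ : Irreducible ϖ) [IsAdicComplete (Ideal.span {algebraMap V A ϖ}) A]
    (c : K) (a : A) : spNorm K (c ⊗ₜ[V] a : K ⊗[V] A) ≤ ‖c‖ :=
  Real.iSup_le (spectralNorm_residue_le hV hϖ c a) (norm_nonneg _)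

/-- The spectral norm of a function with a unit value at a point of the generic fibre that is
integral over `V`. -/
theorem spNorm_tmul_eq (hV : (NormedField.valuation (K := K)).Integers V)
    {ϖ : V} (hϖ : Irreducible ϖ) [IsAdicComplete (Ideal.span {algebraMap V A ϖ}) A]
    {W : Type*} [CommRing W] [Algebra V W] [Module.Finite V W] [Nontrivial (K ⊗[V] W)]
    (φ : A →ₐ[V] W) (c : K) (a : A) (ha : IsUnit (φ a)) :
    spNorm K (c ⊗ₜ[V] a : K ⊗[V] A) = ‖c‖ := by
  refine le_antisymm (spNorm_tmul_le hV hϖ c a) ?_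
  obtain ⟨M, hM⟩ := Ideal.exists_maximal (K ⊗[V] W)
  let L := K ⊗[V] W ⧸ M
  let _ : Field L := Ideal.Quotient.field M
  let g : K ⊗[V] A →ₐ[K] L :=
    (Ideal.Quotient.mkₐ K M).comp (Algebra.TensorProduct.map (AlgHom.id K K) φ)
  have : Module.Finite K L := Module.Finite.of_surjective (Ideal.Quotient.mkₐ K M).toLinearMap
    (Ideal.Quotient.mkₐ_surjective K M)
  let _ : Algebra (K ⊗[V] A) L := g.toAlgebra
  have : IsScalarTower K (K ⊗[V] A) L := .of_algebraMap_eq fun k => (g.commutes k).symm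
  have : Algebra.IsIntegral (K ⊗[V] A) L := .tower_top (R := K)
  have : (⊥ : Ideal L).IsMaximal := Ideal.bot_isMaximal
  -- The point of the generic fibre cut out by `φ`: the kernel of `K ⊗ A → L` is maximal because `L`
  -- is finite over `K`.
  let z : MaximalSpectrum (K ⊗[V] A) := ⟨(⊥ : Ideal L).comap (algebraMap _ L),
    Ideal.isMaximal_comap_of_isIntegral_of_isMaximal _⟩
  refine le_trans ?_ (le_ciSup ⟨_, bddAbove_spectralNorm hV hϖ c a⟩ z)
  let E := K ⊗[V] A ⧸ z.asIdeal
  let _ : Field E := Ideal.Quotient.field z.asIdeal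
  let g' : E →ₐ[K] L := Ideal.Quotient.liftₐ z.asIdeal g fun x hx => hx
  let _ : Algebra E L := g'.toAlgebra
  have : IsScalarTower K E L := .of_algebraMap_eq fun k => (g'.commutes k).symm
  change ‖c‖ ≤ spectralNorm K E (Ideal.Quotient.mk z.asIdeal (c ⊗ₜ a))
  rw [spectralNorm.eq_of_tower (L := L)]
  have h1 : algebraMap E L (Ideal.Quotient.mk z.asIdeal (c ⊗ₜ a)) =
      c • Ideal.Quotient.mk M ((1 : K) ⊗ₜ[V] φ a) := by
    change Ideal.Quotient.mk M (c ⊗ₜ[V] φ a) = _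
    rw [← Ideal.Quotient.mkₐ_eq_mk K, ← map_smul, TensorProduct.smul_tmul', smul_eq_mul, mul_one]
  rw [h1, spectralNorm_smul_eq]
  obtain ⟨⟨w, w', hw, -⟩, h : w = _⟩ := ha
  let ι : W →ₐ[V] L := ((Ideal.Quotient.mkₐ K M).restrictScalars V).comp
    Algebra.TensorProduct.includeRight
  have hi : ∀ w : W, IsIntegral V (ι w) := fun w => (Algebra.IsIntegral.isIntegral w).map ι
  have h2 : spectralNorm K L (ι (φ a)) = 1 :=
    spectralNorm_eq_one_of_mul_eq_one hV (hi _) (hi w') (by rw [← map_mul, ← h, hw, map_one])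
  have h3 : Ideal.Quotient.mk M ((1 : K) ⊗ₜ[V] φ a) = ι (φ a) := rfl
  rw [h3, h2, mul_one]

end SpNorm

/-! ### The special fibre: flatness, integrality and expansions -/

section SpecialFibre

theorem polynomial_isField_facts {k : Type*} [CommRing k] (hk : IsField k) :
    IsDomain (Polynomial k) ∧ IsPrincipalIdealRing (Polynomial k) ∧
      IsJacobsonRing (Polynomial k) ∧ ¬ IsField (Polynomial k) := by
  let _ := hk.toField
  exact ⟨inferInstance, inferInstance, inferInstance, Polynomial.not_isField k⟩

/-- By the equational criterion of flatness, `b` is a combination of elements of `P` annihilated by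
`p`. -/
theorem mem_map_of_algebraMap_mul_eq_zero {P B : Type*} [CommRing P] [CommRing B] [Algebra P B]
    [Module.Flat P B] {p : P} {b : B} {I : Ideal P} (h : ∀ r, p * r = 0 → r ∈ I)
    (hb : p • b = 0) : b ∈ I.map (algebraMap P B) := by
  obtain ⟨m, r, y, hx, hr⟩ := Module.Flat.isTrivialRelation_of_sum_smul_eq_zero
    (f := fun _ : Unit => p) (x := fun _ => b)
    (by rw [Finset.univ_unique, Finset.sum_singleton, hb])
  rw [show b = _ from hx ()]
  refine Ideal.sum_mem _ fun j _ => ?_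
  rw [Algebra.smul_def]
  exact Ideal.mul_mem_right _ _ (Ideal.mem_map_of_mem _ (h _ (by simpa using hr j)))

variable {V : Type*} [CommRing V] {A : Type*} [CommRing A] [Algebra V A] {ϖ : V} {t : A}

theorem map_span_pow_eq (ϖ : V) (n : ℕ) : (Ideal.span {ϖ ^ n}).map (algebraMap V A) =
    Ideal.span {algebraMap V A ϖ} ^ n := by
  rw [Ideal.map_span, Set.image_singleton, map_pow, Ideal.span_singleton_pow]

/-- The coordinate on the reduction modulo `ϖⁿ⁺¹`. -/
abbrev coordinateHom (ϖ : V) (t : A) (n : ℕ) : Polynomial (V ⧸ Ideal.span {ϖ ^ (n + 1)}) →+*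
    A ⧸ (Ideal.span {ϖ ^ (n + 1)}).map (algebraMap V A) :=
  Polynomial.eval₂RingHom (Ideal.quotientMap _ (algebraMap V A) Ideal.le_comap_map)
    (Ideal.Quotient.mk _ t)

/-- In `(V/ϖ^(n+1))[t]` the annihilator of `ϖ` is contained in `(ϖ^n)`; flatness carries this to
`A/ϖ^(n+1)`. Letting `n` grow shows that `A` has no `ϖ`-torsion. -/
theorem mem_span_pow_of_smul_mem (ht : IsEtaleCoordinate ϖ t)
    (hϖ : ∀ n (v : V), ϖ * v ∈ Ideal.span {ϖ ^ (n + 1)} → v ∈ Ideal.span {ϖ ^ n}) (n : ℕ) {a : A}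
    (ha : ϖ • a = 0) : a ∈ Ideal.span {algebraMap V A ϖ} ^ n := by
  let _ := (coordinateHom ϖ t n).toAlgebra
  have : Algebra.Etale _ _ := ht n
  have h0 : (Polynomial.C (Ideal.Quotient.mk (Ideal.span {ϖ ^ (n + 1)}) ϖ)) •
      (Ideal.Quotient.mk ((Ideal.span {ϖ ^ (n + 1)}).map (algebraMap V A)) a) = 0 := by
    change coordinateHom ϖ t n (Polynomial.C _) * _ = _
    rw [Polynomial.coe_eval₂RingHom, Polynomial.eval₂_C, Ideal.quotientMap_mk, ← map_mul,
      ← Algebra.smul_def, ha, map_zero]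
  have h3 := mem_map_of_algebraMap_mul_eq_zero
    (I := Ideal.span {Polynomial.C (Ideal.Quotient.mk (Ideal.span {ϖ ^ (n + 1)}) (ϖ ^ n))})
    (fun r hr => by
      obtain ⟨q, rfl⟩ := Polynomial.map_surjective _
        (Ideal.Quotient.mk_surjective (I := Ideal.span {ϖ ^ (n + 1)})) r
      have h2 : q ∈ (Ideal.span {ϖ ^ n}).map Polynomial.C := by
        rw [Ideal.mem_map_C_iff]
        intro i
        refine hϖ n _ ?_
        have h4 := congrArg (fun f => Polynomial.coeff f i) hr
        simp only [Polynomial.coeff_C_mul, Polynomial.coeff_map, Polynomial.coeff_zero,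
          ← map_mul] at h4
        exact Ideal.Quotient.eq_zero_iff_mem.1 h4
      rw [Ideal.map_span, Set.image_singleton] at h2
      obtain ⟨q', rfl⟩ := Ideal.mem_span_singleton'.1 h2
      rw [Polynomial.map_mul, Polynomial.map_C]
      exact Ideal.mul_mem_left _ _ (Ideal.mem_span_singleton_self _)) h0
  have h5 : algebraMap (Polynomial (V ⧸ Ideal.span {ϖ ^ (n + 1)}))
      (A ⧸ (Ideal.span {ϖ ^ (n + 1)}).map (algebraMap V A))
      (Polynomial.C (Ideal.Quotient.mk (Ideal.span {ϖ ^ (n + 1)}) (ϖ ^ n))) =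
      Ideal.Quotient.mk _ (algebraMap V A (ϖ ^ n)) := by
    change coordinateHom ϖ t n (Polynomial.C _) = _
    rw [Polynomial.coe_eval₂RingHom, Polynomial.eval₂_C, Ideal.quotientMap_mk]
  replace h3 := (Ideal.map_span _ _).le h3
  rw [Set.image_singleton, h5] at h3
  obtain ⟨b, hb⟩ := Ideal.mem_span_singleton'.1 h3
  obtain ⟨b, rfl⟩ := Ideal.Quotient.mk_surjective b
  rw [← map_mul, Ideal.Quotient.eq, map_span_pow_eq] at hb
  have h6 := sub_mem (Ideal.mul_mem_left (Ideal.span {algebraMap V A ϖ} ^ n) b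
    (Ideal.pow_mem_pow (Ideal.mem_span_singleton_self _) n))
    (Ideal.pow_le_pow_right n.le_succ hb)
  simpa using h6

variable [IsDomain V]

theorem eq_zero_of_uniformizer_smul_eq_zero (hϖ : Irreducible ϖ) (ht : IsEtaleCoordinate ϖ t)
    [IsAdicComplete (Ideal.span {algebraMap V A ϖ}) A] (a : A) (ha : ϖ • a = 0) : a = 0 := by
  refine IsHausdorff.haus (I := Ideal.span {algebraMap V A ϖ}) inferInstance _ fun n => ?_
  rw [SModEq.zero, smul_eq_mul, Ideal.mul_top]
  refine mem_span_pow_of_smul_mem ht (fun n v hv => ?_) n ha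
  obtain ⟨w, hw⟩ := Ideal.mem_span_singleton'.1 hv
  refine Ideal.mem_span_singleton'.2 ⟨w, mul_left_cancel₀ hϖ.ne_zero ?_⟩
  rw [← hw]
  ring

variable [IsDiscreteValuationRing V]

theorem isField_quotient_uniformizer (hϖ : Irreducible ϖ) :
    IsField (V ⧸ Ideal.span {ϖ ^ (0 + 1)}) := by
  rw [zero_add, pow_one, ← hϖ.maximalIdeal_eq, ← Ideal.Quotient.maximal_ideal_iff_isField_quotient]
  infer_instance

/-- The level `n = 0` of the coordinate makes `A/ϖ` étale over a polynomial ring in one variable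
over the residue field; connectedness then makes it a domain. -/
theorem isPrime_span_uniformizer (hϖ : Irreducible ϖ) (ht : IsEtaleCoordinate ϖ t)
    [ConnectedSpace (PrimeSpectrum (A ⧸ Ideal.span {algebraMap V A ϖ}))] :
    (Ideal.span {algebraMap V A ϖ}).IsPrime := by
  obtain ⟨_, _, _, hP⟩ := polynomial_isField_facts (isField_quotient_uniformizer hϖ)
  let _ := (coordinateHom ϖ t 0).toAlgebra
  have : Algebra.Etale _ _ := ht 0
  have e : (Ideal.span {ϖ ^ (0 + 1)}).map (algebraMap V A) = Ideal.span {algebraMap V A ϖ} := by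
    rw [map_span_pow_eq, zero_add, pow_one]
  have : ConnectedSpace (PrimeSpectrum (A ⧸ (Ideal.span {ϖ ^ (0 + 1)}).map (algebraMap V A))) := by
    rw [e]; infer_instance
  have := isDomain_of_etale (B := A ⧸ (Ideal.span {ϖ ^ (0 + 1)}).map (algebraMap V A)) hP
  rw [← e]
  exact (Ideal.Quotient.isDomain_iff_prime _).1 this

/-- The reduction modulo `ϖ` of a function is determined by its expansion in the coordinate at a
closed point. -/
theorem powerSeries_expansion_ne_zero (hϖ : Irreducible ϖ) (ht : IsEtaleCoordinate ϖ t)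
    (hp : (Ideal.span {algebraMap V A ϖ}).IsPrime) {F : Type*} [Field F] [Algebra V F]
    (hF : algebraMap V F ϖ = 0) (s : A →+* PowerSeries F)
    (hs : ∀ v, s (algebraMap V A v) = PowerSeries.C (algebraMap V F v)) (c : F)
    (hst : s t = PowerSeries.C c + PowerSeries.X)
    (hsurj : Function.Surjective fun a => PowerSeries.constantCoeff (s a))
    {a : A} (ha : a ∉ Ideal.span {algebraMap V A ϖ}) : s a ≠ 0 := by
  obtain ⟨_, _, _, hP⟩ := polynomial_isField_facts (isField_quotient_uniformizer hϖ)
  let _ := (coordinateHom ϖ t 0).toAlgebra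
  have : Algebra.Etale _ _ := ht 0
  have e : (Ideal.span {ϖ ^ (0 + 1)}).map (algebraMap V A) = Ideal.span {algebraMap V A ϖ} := by
    rw [map_span_pow_eq, zero_add, pow_one]
  have : IsDomain (A ⧸ (Ideal.span {ϖ ^ (0 + 1)}).map (algebraMap V A)) :=
    (Ideal.Quotient.isDomain_iff_prime _).2 (e ▸ hp)
  have hle : (Ideal.span {ϖ ^ (0 + 1)}).map (algebraMap V A) ≤ RingHom.ker s := by
    rw [e, Ideal.span_singleton_le_iff_mem, RingHom.mem_ker, hs, hF, map_zero]
  let φ : A ⧸ (Ideal.span {ϖ ^ (0 + 1)}).map (algebraMap V A) →+* PowerSeries F :=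
    Ideal.Quotient.lift _ s hle
  let y := RingHom.ker ((PowerSeries.constantCoeff (R := F)).comp φ)
  have hy : y.IsMaximal := RingHom.ker_isMaximal_of_surjective _ fun b => by
    obtain ⟨a, rfl⟩ := hsurj b
    exact ⟨Ideal.Quotient.mk _ a, rfl⟩
  let ι : V ⧸ Ideal.span {ϖ ^ (0 + 1)} →+* F := Ideal.Quotient.lift _ (algebraMap V F) (by
    refine (Ideal.span_singleton_le_iff_mem (RingHom.ker (algebraMap V F))).2 ?_
    rw [RingHom.mem_ker, zero_add, pow_one, hF])
  have hι : Function.Injective ι := by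
    let _ := (isField_quotient_uniformizer hϖ).toField
    exact ι.injective
  -- On polynomials in the coordinate, the expansion is the Taylor expansion at `c`, hence
  -- injective; `injective_of_etale` extends this to all functions.
  have hφ : φ.comp (coordinateHom ϖ t 0) = (Polynomial.coeToPowerSeries.ringHom).comp
      ((Polynomial.compRingHom (Polynomial.X + Polynomial.C c)).comp
        (Polynomial.mapRingHom ι)) := by
    refine Polynomial.ringHom_ext' (Ideal.Quotient.ringHom_ext (RingHom.ext fun v => ?_)) ?_
    · simp only [RingHom.comp_apply, Polynomial.coe_eval₂RingHom, Polynomial.eval₂_C,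
        Polynomial.coe_mapRingHom, Polynomial.map_C, Polynomial.coe_compRingHom,
        Polynomial.C_comp, Polynomial.coeToPowerSeries.ringHom_apply, Polynomial.coe_C]
      exact hs v
    · simp only [RingHom.comp_apply, Polynomial.coe_eval₂RingHom, Polynomial.eval₂_X,
        Polynomial.coe_mapRingHom, Polynomial.map_X, Polynomial.coe_compRingHom,
        Polynomial.X_comp, Polynomial.coeToPowerSeries.ringHom_apply, Polynomial.coe_add,
        Polynomial.coe_C, Polynomial.coe_X]
      exact hst.trans (add_comm _ _)
  have hinj : Function.Injective φ := by
    refine injective_of_etale hP φ (fun π hπ => ?_) y (fun x hx => ?_)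
    · have h1 : φ (algebraMap _ _ π) =
          ((Polynomial.taylor c (π.map ι) : Polynomial F) : PowerSeries F) := by
        rw [Polynomial.taylor_apply]
        exact congrArg (fun f => f π) hφ
      rw [h1, Ne, Polynomial.coe_eq_zero_iff]
      intro h2
      refine hπ (Polynomial.map_injective ι hι ?_)
      rw [Polynomial.map_zero]
      exact Polynomial.taylor_injective c (by rw [h2, map_zero])
    · rw [RingHom.mem_ker, RingHom.comp_apply, hx, map_zero]
  intro h
  apply ha
  rw [← e, ← Ideal.Quotient.eq_zero_iff_mem]
  apply hinj
  rw [map_zero]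
  exact h

end SpecialFibre

/-! ### Integral points over unramified extensions -/

section UnramifiedExtension

/-- `F` is finite over the residue field and separable by perfectness, so it has a primitive
element. For a monic lift `G` of its minimal polynomial, `V[X]/(G)` is finite free over `V` and its
reduction modulo `ϖ` is `F`. -/
theorem exists_unramified_extension {V : Type*} [CommRing V] [IsDomain V]
    [IsDiscreteValuationRing V] [PerfectField (IsLocalRing.ResidueField V)] {ϖ : V}
    (hϖ : Irreducible ϖ) [IsAdicComplete (Ideal.span {ϖ}) V] {F : Type*} [Field F] [Algebra V F]
    [Algebra.FiniteType V F] (hF : algebraMap V F ϖ = 0) :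
    ∃ G : Polynomial V, G.Monic ∧ ∃ π : AdjoinRoot G →ₐ[V] F, Function.Surjective π ∧
      RingHom.ker π = Ideal.span {algebraMap V (AdjoinRoot G) ϖ} := by
  let κ := IsLocalRing.ResidueField V
  have hle : ∀ v ∈ IsLocalRing.maximalIdeal V, algebraMap V F v = 0 := fun v hv => by
    rw [hϖ.maximalIdeal_eq] at hv
    obtain ⟨w, rfl⟩ := Ideal.mem_span_singleton'.1 hv
    rw [map_mul, hF, mul_zero]
  let _ : Algebra κ F := (Ideal.Quotient.lift _ (algebraMap V F) hle).toAlgebra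
  have : IsScalarTower V κ F := .of_algebraMap_eq fun v => rfl
  have : Algebra.FiniteType κ F := .of_restrictScalars_finiteType V κ F
  have : Module.Finite κ F := finite_of_finite_type_of_isJacobsonRing κ F
  let pb := Field.powerBasisOfFiniteOfSeparable κ F
  set θ := pb.gen
  have hint : IsIntegral κ θ := Algebra.IsIntegral.isIntegral θ
  have hsurj : Function.Surjective (algebraMap V κ) := IsLocalRing.residue_surjective
  obtain ⟨G, hG, -, hGm⟩ := Polynomial.lifts_and_natDegree_eq_and_monic
    (Polynomial.mem_lifts (f := algebraMap V κ) (minpoly κ θ) |>.2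
      (Polynomial.map_surjective _ hsurj _)) (minpoly.monic hint)
  have hev : ∀ P : Polynomial V, Polynomial.aeval θ P =
      Polynomial.aeval θ (P.map (algebraMap V κ)) := fun P => by
    rw [Polynomial.aeval_map_algebraMap]
  let π : AdjoinRoot G →ₐ[V] F := AdjoinRoot.liftAlgHom G (Algebra.ofId V F) θ (by
    change Polynomial.aeval θ G = 0
    rw [hev, hG, minpoly.aeval])
  have hπ : ∀ P, π (AdjoinRoot.mk G P) = Polynomial.aeval θ P := fun P => rfl
  refine ⟨G, hGm, π, fun y => ?_, le_antisymm (fun w hw => ?_) ?_⟩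
  · obtain ⟨f, hf⟩ := pb.exists_eq_aeval' y
    obtain ⟨P, rfl⟩ := Polynomial.map_surjective _ hsurj f
    exact ⟨AdjoinRoot.mk G P, by rw [hπ, hev, hf]⟩
  · obtain ⟨P, rfl⟩ := AdjoinRoot.mk_surjective w
    rw [RingHom.mem_ker] at hw
    change π _ = 0 at hw
    rw [hπ, hev] at hw
    obtain ⟨r, hr⟩ := minpoly.dvd κ θ hw
    obtain ⟨T, rfl⟩ := Polynomial.map_surjective _ hsurj r
    rw [← hG, ← Polynomial.map_mul] at hr
    have h1 : P - G * T ∈ (IsLocalRing.maximalIdeal V).map Polynomial.C := by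
      rw [Ideal.mem_map_C_iff]
      intro n
      have h2 := congrArg (fun f => Polynomial.coeff f n) hr
      simp only [Polynomial.coeff_map] at h2
      rw [← IsLocalRing.residue_eq_zero_iff, Polynomial.coeff_sub, map_sub, sub_eq_zero]
      exact h2
    rw [hϖ.maximalIdeal_eq, Ideal.map_span, Set.image_singleton] at h1
    obtain ⟨U, hU⟩ := Ideal.mem_span_singleton'.1 h1
    rw [Ideal.mem_span_singleton']
    refine ⟨AdjoinRoot.mk G U, ?_⟩
    have h3 := congrArg (AdjoinRoot.mk G) hU
    rw [map_mul, map_sub, map_mul, AdjoinRoot.mk_self, zero_mul, sub_zero] at h3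
    exact h3
  · rw [Ideal.span_singleton_le_iff_mem, RingHom.mem_ker, AlgHom.commutes, hF]

/-- A function that does not vanish modulo `ϖ` is a unit at some integral point. -/
theorem exists_integral_point {V : Type*} [CommRing V] [IsDomain V]
    [IsDiscreteValuationRing V] [PerfectField (IsLocalRing.ResidueField V)] {ϖ : V}
    (hϖ : Irreducible ϖ) [IsAdicComplete (Ideal.span {ϖ}) V] {A : Type*} [CommRing A] [Algebra V A]
    {t : A} (ht : IsEtaleCoordinate ϖ t) (hp : (Ideal.span {algebraMap V A ϖ}).IsPrime)
    {a : A} (ha : a ∉ Ideal.span {algebraMap V A ϖ}) :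
    ∃ G : Polynomial V, G.Monic ∧ Nontrivial (AdjoinRoot G) ∧
      ∃ φ : A →ₐ[V] AdjoinRoot G, IsUnit (φ a) := by
  obtain ⟨_, _, _, hP⟩ := polynomial_isField_facts (isField_quotient_uniformizer hϖ)
  let _ := (coordinateHom ϖ t 0).toAlgebra
  have : Algebra.Etale _ _ := ht 0
  have e : (Ideal.span {ϖ ^ (0 + 1)}).map (algebraMap V A) = Ideal.span {algebraMap V A ϖ} := by
    rw [map_span_pow_eq, zero_add, pow_one]
  let P := Polynomial (V ⧸ Ideal.span {ϖ ^ (0 + 1)})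
  let B := A ⧸ (Ideal.span {ϖ ^ (0 + 1)}).map (algebraMap V A)
  have : IsDomain B := (Ideal.Quotient.isDomain_iff_prime _).2 (e ▸ hp)
  have : IsJacobsonRing B := isJacobsonRing_of_finiteType (A := P)
  have hab : Ideal.Quotient.mk ((Ideal.span {ϖ ^ (0 + 1)}).map (algebraMap V A)) a ≠ 0 := by
    rwa [Ne, Ideal.Quotient.eq_zero_iff_mem, e]
  -- In a Jacobson domain the maximal ideals meet in zero, so the nonzero class of `a` survives at
  -- some closed point.
  obtain ⟨y, hy, hay⟩ : ∃ y : Ideal B, y.IsMaximal ∧ Ideal.Quotient.mk _ a ∉ y := by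
    by_contra! hcon
    apply hab
    have h1 : (⊥ : Ideal B).jacobson = ⊥ := IsJacobsonRing.out inferInstance Ideal.isRadical_bot
    rw [← Ideal.mem_bot, ← h1, Ideal.jacobson, Ideal.mem_sInf]
    exact fun {I} hI => hcon I hI.2
  let F := B ⧸ y
  let _ : Field F := Ideal.Quotient.field y
  have hft : Algebra.FiniteType V F := by
    have : IsScalarTower V P B := .of_algebraMap_eq fun v => by
      change _ = coordinateHom ϖ t 0 (Polynomial.C (Ideal.Quotient.mk _ v))
      rw [Polynomial.coe_eval₂RingHom, Polynomial.eval₂_C]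
      rfl
    have h1 : Algebra.FiniteType V P := .trans (S := V ⧸ Ideal.span {ϖ ^ (0 + 1)})
      inferInstance inferInstance
    have h2 : Algebra.FiniteType V B := .trans (S := P) inferInstance inferInstance
    exact .trans (S := B) inferInstance inferInstance
  have hm : algebraMap V A ϖ ∈ Ideal.span {algebraMap V A ϖ} := Ideal.mem_span_singleton_self _
  have hF : algebraMap V F ϖ = 0 := by
    rw [IsScalarTower.algebraMap_apply V A F, IsScalarTower.algebraMap_apply A B F,
      Ideal.Quotient.algebraMap_eq, Ideal.Quotient.algebraMap_eq,
      Ideal.Quotient.eq_zero_iff_mem.2 (e.ge hm), map_zero]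
  obtain ⟨G, hG, π, hπ, hker⟩ := exists_unramified_extension hϖ hF
  let W := AdjoinRoot G
  have hc : IsAdicComplete (Ideal.span {algebraMap V W ϖ}) W := by
    have := isAdicComplete_of_basis (AdjoinRoot.powerBasis' hG).basis (Ideal.span {ϖ})
    have := (IsAdicComplete.map_algebraMap_iff (S := W) (I := Ideal.span {ϖ}) (M := W)).2 this
    rwa [Ideal.map_span, Set.image_singleton] at this
  let ψ : A →ₐ[V] F := (Ideal.Quotient.mkₐ V y).comp (Ideal.Quotient.mkₐ V _)
  obtain ⟨r, hr⟩ := hπ (ψ t)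
  obtain ⟨φ, -, hφ⟩ := exists_etaleCoordinate_lift_of_isAdicComplete ht
    (Ideal.span {algebraMap V W ϖ}) (Ideal.mem_span_singleton_self _) π hπ hker.ge
    (e := 1) (by rw [pow_one]; exact hker.le) ψ r hr
  have hnt : Nontrivial W := π.toRingHom.domain_nontrivial
  refine ⟨G, hG, hnt, φ, ?_⟩
  have hψa : ψ a ≠ 0 := fun h => hay (Ideal.Quotient.eq_zero_iff_mem.1 h)
  obtain ⟨w, hw⟩ := hπ (ψ a)⁻¹
  -- The value `φ a` is invertible modulo `ϖ`, hence invertible because `ϖ` lies in the Jacobson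
  -- radical of `W`.
  have h1 : φ a * w - 1 ∈ Ideal.span {algebraMap V W ϖ} := by
    rw [← hker, RingHom.mem_ker, map_sub, map_mul, map_one, hw, ← AlgHom.comp_apply, hφ,
      mul_inv_cancel₀ hψa, sub_self]
  have h2 := Ideal.mem_jacobson_bot.1 (IsAdicComplete.le_jacobson_bot _ h1) 1
  rw [mul_one, sub_add_cancel] at h2
  exact isUnit_of_mul_isUnit_left h2

end UnramifiedExtension

/-! ### The index of a power series near radius 1 -/

section LimitIndex

open Filter Topology

/-- Beyond `n` the factor `r ^ i` makes the terms strictly smaller than `C * r ^ n`. Before `n` a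
weak inequality is enough, since the largest maximizing index is taken. -/
theorem radiusIndex_eq {a : ℕ → ℝ} {C r θ : ℝ} {n : ℕ} (hr : 0 < r) (hr1 : r < 1)
    (hC : 0 < C) (hn : a n = C) (hle : ∀ i, a i ≤ C) (hlt : ∀ i, i < n → a i ≤ C * θ)
    (hθ : θ ≤ r ^ n) (ha : ∀ i, 0 ≤ a i) : radiusIndex a r = n := by
  have hb : ∀ i, a i * r ^ i ≤ C * r ^ n := fun i => by
    rcases lt_or_ge i n with h | h
    · calc a i * r ^ i ≤ a i := mul_le_of_le_one_right (ha i) (pow_le_one₀ hr.le hr1.le)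
        _ ≤ C * θ := hlt i h
        _ ≤ C * r ^ n := by gcongr
    · exact mul_le_mul (hle i) (pow_le_pow_of_le_one hr.le hr1.le h) (by positivity) hC.le
  have hsup : ⨆ j, a j * r ^ j = C * r ^ n := by
    refine le_antisymm (ciSup_le hb) ?_
    rw [← hn]
    exact le_ciSup (f := fun j => a j * r ^ j) ⟨_, by rintro _ ⟨i, rfl⟩; exact hb i⟩ n
  rw [radiusIndex, hsup]
  refine le_antisymm (iSup₂_le fun i hi => ?_) (le_iSup₂_of_le n ?_ le_rfl)
  · rw [Nat.cast_le]
    by_contra! h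
    have h1 : a i * r ^ i < C * r ^ n :=
      (mul_le_mul_of_nonneg_right (hle i) (by positivity)).trans_lt
        (mul_lt_mul_of_pos_left (pow_lt_pow_right_of_lt_one₀ hr hr1 h) hC)
    exact h1.ne hi
  · change a n * r ^ n = _
    rw [hn]

/-- The uniform gap `θ < 1` below `n` makes the index constantly `n` once `θ < r ^ n`. -/
theorem limitIndex_eq {a : ℕ → ℝ} {C θ : ℝ} {n : ℕ} (hθ : θ < 1)
    (hC : 0 < C) (hn : a n = C) (hle : ∀ i, a i ≤ C) (hlt : ∀ i, i < n → a i ≤ C * θ)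
    (ha : ∀ i, 0 ≤ a i) : limitIndex a = n := by
  refine Tendsto.limUnder_eq (tendsto_const_nhds.congr' ?_)
  have h1 : ∀ᶠ r : ℝ in 𝓝[<] 1, θ < r ^ n := by
    have : Tendsto (fun r : ℝ => r ^ n) (𝓝[<] 1) (𝓝 (1 ^ n)) :=
      ((continuous_pow n).tendsto 1).mono_left nhdsWithin_le_nhds
    rw [one_pow] at this
    exact this.eventually (lt_mem_nhds hθ)
  filter_upwards [h1, Ioo_mem_nhdsLT (zero_lt_one (α := ℝ))] with r hr hr'
  exact (radiusIndex_eq hr'.1 hr'.2 hC hn hle hlt hr.le ha).symm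

/-- Every index attains the supremum `0`, so the convention `N(0) = +∞` is automatic. -/
theorem limitIndex_zero : limitIndex (fun _ => 0) = ⊤ := by
  have h : radiusIndex (fun _ => 0) = fun _ => ⊤ := funext fun r => by
    rw [radiusIndex]
    simp only [zero_mul, ciSup_const, Set.ofPred_true, Set.mem_univ, iSup_pos]
    exact ENat.iSup_natCast_eq_top.2 fun ⟨n, hn⟩ => absurd (hn ⟨n + 1, rfl⟩) (by simp)
  rw [limitIndex, h]
  exact tendsto_const_nhds.limUnder_eq

end LimitIndex

/-! ### Expansions on the tube of the closed point -/

section TubeBasic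

open IsLocalRing PowerSeries

variable {V : Type*} [CommRing V] {A : Type*} [CommRing A] [Algebra V A]
  {V' : Type*} [CommRing V'] [IsLocalRing V'] [Algebra V V']
  {t : A} {c : V'} {ρ : A →ₐ[V] ResidueField V'}

theorem tubeExpansion_eq (h : ∃ s : A →ₐ[V] V'⟦X⟧, IsTubeExpansion ρ t c s) :
    ∃ s : A →ₐ[V] V'⟦X⟧, IsTubeExpansion ρ t c s ∧ tubeExpansion ρ t c = s.toLinearMap :=
  ⟨h.choose, h.choose_spec, by rw [tubeExpansion, dif_pos h]⟩

/-- The reduction of the expansion of a function on the tube. -/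
def reducedExpansion (s : A →ₐ[V] V'⟦X⟧) : A →+* (ResidueField V')⟦X⟧ :=
  (PowerSeries.map (residue V')).comp s.toRingHom

theorem coeff_reducedExpansion (s : A →ₐ[V] V'⟦X⟧) (i : ℕ) (a : A) :
    coeff i (reducedExpansion s a) = residue V' (coeff i (s a)) :=
  coeff_map (residue V') i (s a)

theorem constantCoeff_reducedExpansion {s : A →ₐ[V] V'⟦X⟧} (hs : IsTubeExpansion ρ t c s) (a : A) :
    constantCoeff (reducedExpansion s a) = ρ a := by
  rw [← hs.2, ← coeff_zero_eq_constantCoeff_apply, coeff_reducedExpansion,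
    coeff_zero_eq_constantCoeff_apply]

theorem reducedExpansion_algebraMap (s : A →ₐ[V] V'⟦X⟧) (v : V) :
    reducedExpansion s (algebraMap V A v) = C (algebraMap V (ResidueField V') v) := by
  change PowerSeries.map (residue V') (s (algebraMap V A v)) = _
  rw [AlgHom.commutes, PowerSeries.algebraMap_apply, PowerSeries.map_C]
  rfl

variable {K : Type*} [NormedField K] [Algebra V K]
  {K' : Type*} [Field K'] [Algebra V' K'] [Algebra K K'] [Algebra V K'] [IsScalarTower V K K']
  [IsScalarTower V V' K']

theorem functionIndex_zero : functionIndex ρ t c K' (0 : K ⊗[V] A) = ⊤ := by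
  rw [functionIndex]
  simp only [map_zero, spectralNorm_zero]
  exact limitIndex_zero

theorem isAlgebraic_of_isFractionRing (V V' : Type*) [CommRing V] [CommRing V'] [IsDomain V']
    [Algebra V V'] [Algebra.IsIntegral V V'] (K K' : Type*) [Field K] [Algebra V K] [Field K']
    [Algebra V' K'] [Algebra K K'] [Algebra V K'] [IsScalarTower V K K'] [IsScalarTower V V' K']
    [IsFractionRing V' K'] : Algebra.IsAlgebraic K K' := by
  have h : ∀ v : V', IsAlgebraic K (algebraMap V' K' v) := fun v =>
    (((Algebra.IsIntegral.isIntegral (R := V) v).map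
      (IsScalarTower.toAlgHom V V' K')).tower_top (A := K)).isAlgebraic
  refine ⟨fun x => ?_⟩
  obtain ⟨a, b, -, rfl⟩ := IsFractionRing.div_surjective V' x
  rw [div_eq_mul_inv]
  exact (h a).mul (h b).inv

theorem algebraMap_uniformizer_mem [Module.Finite V V'] [FaithfulSMul V V'] {ϖ : V}
    (hϖ : Irreducible ϖ) : algebraMap V V' ϖ ∈ maximalIdeal V' := by
  have : IsLocalHom (algebraMap V V') := RingHom.IsIntegral.isLocalHom
    (algebraMap_isIntegral_iff.2 inferInstance) (FaithfulSMul.algebraMap_injective V V')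
  exact fun h => hϖ.not_isUnit (isUnit_of_map_unit (algebraMap V V') ϖ h)

theorem algebraMap_residueField_uniformizer [Module.Finite V V'] [FaithfulSMul V V'] {ϖ : V}
    (hϖ : Irreducible ϖ) :
    algebraMap V (ResidueField V') ϖ = 0 := by
  rw [IsScalarTower.algebraMap_apply V V' (ResidueField V')]
  exact (residue_eq_zero_iff _).2 (algebraMap_uniformizer_mem hϖ)

theorem reducedExpansion_eq_zero [Module.Finite V V'] [FaithfulSMul V V'] {ϖ : V}
    (hϖ : Irreducible ϖ) (s : A →ₐ[V] V'⟦X⟧)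
    {a : A} (ha : a ∈ Ideal.span {algebraMap V A ϖ}) : reducedExpansion s a = 0 := by
  obtain ⟨b, rfl⟩ := Ideal.mem_span_singleton'.1 ha
  rw [map_mul, reducedExpansion_algebraMap, algebraMap_residueField_uniformizer hϖ, map_zero,
    mul_zero]

end TubeBasic

section Tube

open IsLocalRing PowerSeries

variable {V : Type*} [CommRing V] [IsDomain V] [IsDiscreteValuationRing V]
  {A : Type*} [CommRing A] [Algebra V A]
  {V' : Type*} [CommRing V'] [IsDomain V'] [IsDiscreteValuationRing V'] [Algebra V V']
  [Module.Finite V V'] [FaithfulSMul V V'] {ϖ : V} {t : A} {c : V'} {ρ : A →ₐ[V] ResidueField V'}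

/-- For the extensions considered, `e` is the ramification index; `V'` is not assumed unramified
over `V`. -/
theorem span_uniformizer_eq_pow {V V' : Type*} [CommRing V] [CommRing V'] [IsDomain V']
    [IsDiscreteValuationRing V'] [Algebra V V'] [FaithfulSMul V V'] {ϖ : V} (hϖ : ϖ ≠ 0) :
    ∃ e, Ideal.span {algebraMap V V' ϖ} = maximalIdeal V' ^ e := by
  have hϖ' : algebraMap V V' ϖ ≠ 0 := fun h =>
    hϖ (FaithfulSMul.algebraMap_injective V V' (by rw [h, map_zero]))
  obtain ⟨ϖ', hϖ''⟩ := IsDiscreteValuationRing.exists_irreducible V'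
  obtain ⟨e, he⟩ := IsDiscreteValuationRing.ideal_eq_span_pow_irreducible
    (s := Ideal.span {algebraMap V V' ϖ}) (by simpa using hϖ') hϖ''
  exact ⟨e, by rw [he, hϖ''.maximalIdeal_eq, Ideal.span_singleton_pow]⟩

/-- Étale lifting applied to `V'⟦X⟧`, which is complete for `J = (ϖ, X)`. The kernel of its map to
the residue field is generated by the maximal ideal of `V'` and `X`, and its `e`-th power lies in
`J`; the coordinate is sent to `c + X`. -/
theorem exists_isTubeExpansion (hϖ : Irreducible ϖ) [IsAdicComplete (Ideal.span {ϖ}) V]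
    (ht : IsEtaleCoordinate ϖ t) (hc : residue V' c = ρ t) :
    ∃ s : A →ₐ[V] V'⟦X⟧, IsTubeExpansion ρ t c s := by
  have : Module.IsTorsionFree V V' :=
    Module.isTorsionFree_iff_faithfulSMul.mpr inferInstance
  have hcomp : IsAdicComplete (Ideal.span {algebraMap V V' ϖ}) V' := by
    have := isAdicComplete_of_basis (Module.Free.chooseBasis V V') (Ideal.span {ϖ})
    have := (IsAdicComplete.map_algebraMap_iff (S := V') (I := Ideal.span {ϖ}) (M := V')).2 this
    rwa [Ideal.map_span, Set.image_singleton] at this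
  have hcomp' := isAdicComplete_powerSeries (Ideal.span {algebraMap V V' ϖ})
  set J := (Ideal.span {algebraMap V V' ϖ}).map (C (R := V')) ⊔ Ideal.span {X} with hJ
  have hJmem : ∀ f, f ∈ J ↔ constantCoeff f ∈ Ideal.span {algebraMap V V' ϖ} := fun f => by
    have := mem_pow_powerSeries_iff (Ideal.span {algebraMap V V' ϖ}) 1 f
    simpa using this
  let g : V'⟦X⟧ →ₐ[V] ResidueField V' :=
    { (residue V').comp (constantCoeff (R := V')) with
      commutes' := fun v => by
        change residue V' (constantCoeff (algebraMap V V'⟦X⟧ v)) = _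
        rw [PowerSeries.algebraMap_apply, constantCoeff_C]
        rfl }
  have hg : ∀ f, g f = residue V' (constantCoeff f) := fun f => rfl
  have hker : RingHom.ker g = (maximalIdeal V').map (C (R := V')) ⊔ Ideal.span {X} := by
    ext f
    have := mem_pow_powerSeries_iff (maximalIdeal V') 1 f
    rw [pow_one] at this
    rw [this, RingHom.mem_ker, hg, residue_eq_zero_iff]
    simp
  obtain ⟨e, he'⟩ := span_uniformizer_eq_pow (V' := V') hϖ.ne_zero
  have hkere : RingHom.ker g ^ e ≤ J := by
    intro f hf
    rw [hker, mem_pow_powerSeries_iff] at hf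
    rw [hJmem, he']
    rcases e with _ | e
    · simp
    · simpa using hf 0 (by omega)
  obtain ⟨s, hst, hs⟩ := exists_etaleCoordinate_lift_of_isAdicComplete ht J
    ((hJmem _).2 (by
      rw [PowerSeries.algebraMap_apply, constantCoeff_C]; exact Ideal.mem_span_singleton_self _)) g
    (fun x => by
      obtain ⟨v, rfl⟩ := residue_surjective x
      exact ⟨C v, by rw [hg, constantCoeff_C]⟩)
    (fun f hf => by
      rw [RingHom.mem_ker, hg, residue_eq_zero_iff]
      exact (Ideal.span_singleton_le_iff_mem (maximalIdeal V')).2 (algebraMap_uniformizer_mem hϖ)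
        ((hJmem f).1 hf))
    hkere ρ (C c + X) (by rw [hg, map_add, constantCoeff_C, constantCoeff_X, add_zero, hc])
  exact ⟨s, hst, fun f => congrArg (fun φ => φ f) hs⟩

theorem reducedExpansion_ne_zero (hϖ : Irreducible ϖ) (ht : IsEtaleCoordinate ϖ t)
    (hp : (Ideal.span {algebraMap V A ϖ}).IsPrime) (hρ : Function.Surjective ρ)
    {s : A →ₐ[V] V'⟦X⟧} (hs : IsTubeExpansion ρ t c s) {a : A}
    (ha : a ∉ Ideal.span {algebraMap V A ϖ}) : reducedExpansion s a ≠ 0 := by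
  refine powerSeries_expansion_ne_zero hϖ ht hp (algebraMap_residueField_uniformizer hϖ)
    (reducedExpansion s) (reducedExpansion_algebraMap s) (residue V' c) ?_ ?_ ha
  · change PowerSeries.map (residue V') (s t) = _
    rw [hs.1, map_add, PowerSeries.map_C, PowerSeries.map_X]
  · intro x
    obtain ⟨a, rfl⟩ := hρ x
    exact ⟨a, constantCoeff_reducedExpansion hs a⟩

variable {K : Type*} [NormedField K] [IsUltrametricDist K] [CompleteSpace K] [Algebra V K]
  {K' : Type*} [Field K'] [Algebra V' K'] [Algebra K K'] [Algebra V K'] [IsScalarTower V K K']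
  [IsScalarTower V V' K']

/-- If the reduction has order `n`, the `n`-th coefficient of `s a` is a unit and the earlier ones
are divisible by `ϖ'`. So `limitIndex_eq` applies with `C = ‖k‖` and `θ = |ϖ'|`. -/
theorem functionIndex_tmul [IsFractionRing V' K']
    (hV : (NormedField.valuation (K := K)).Integers V) (hϖ : Irreducible ϖ) {s : A →ₐ[V] V'⟦X⟧}
    (hs : tubeExpansion ρ t c = s.toLinearMap) {k : K} (hk : k ≠ 0) {a : A}
    (ha : reducedExpansion s a ≠ 0) :
    functionIndex ρ t c K' (k ⊗ₜ[V] a : K ⊗[V] A) = (reducedExpansion s a).order := by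
  have := isAlgebraic_of_isFractionRing V V' K K'
  obtain ⟨n, hn⟩ := ENat.ne_top_iff_exists.1 (order_eq_top.not.2 ha)
  rw [← hn]
  obtain ⟨hn1, hn2⟩ := order_eq_nat.1 hn.symm
  rw [coeff_reducedExpansion, Ne, residue_eq_zero_iff] at hn1
  have hint : ∀ v : V', IsIntegral V (algebraMap V' K' v) := fun v =>
    (Algebra.IsIntegral.isIntegral (R := V) v).map (IsScalarTower.toAlgHom V V' K')
  have hle : ∀ v : V', spectralNorm K K' (algebraMap V' K' v) ≤ 1 := fun v =>
    spectralNorm_le_one_of_isIntegral hV (hint v)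
  have hunit : ∀ v : V', IsUnit v → spectralNorm K K' (algebraMap V' K' v) = 1 := by
    rintro _ ⟨⟨v, w, hvw, -⟩, rfl⟩
    exact spectralNorm_eq_one_of_mul_eq_one hV (hint v) (hint w) (by rw [← map_mul, hvw, map_one])
  obtain ⟨ϖ', hϖ'⟩ := IsDiscreteValuationRing.exists_irreducible V'
  have hcoef : ∀ i, spectralNorm K K' (tubeCoeff ρ t c K K' i (k ⊗ₜ[V] a)) =
      ‖k‖ * spectralNorm K K' (algebraMap V' K' (coeff i (s a))) := fun i => by
    rw [tubeCoeff, LinearMap.liftBaseChange_tmul, spectralNorm_smul_eq, hs]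
    rfl
  -- Some power of `ϖ'` is an integral multiple of `ϖ`, so its norm is at most `|ϖ| < 1`.
  have hθ : spectralNorm K K' (algebraMap V' K' ϖ') < 1 := by
    obtain ⟨e, he⟩ := span_uniformizer_eq_pow (V' := V') hϖ.ne_zero
    refine lt_of_le_of_ne (hle ϖ') fun h => ?_
    have h1 : ϖ' ^ e ∈ Ideal.span {algebraMap V V' ϖ} := by
      rw [he, hϖ'.maximalIdeal_eq]
      exact Ideal.pow_mem_pow (Ideal.mem_span_singleton_self _) _
    obtain ⟨w, hw⟩ := Ideal.mem_span_singleton'.1 h1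
    have h2 : ∀ n, spectralNorm K K' (algebraMap V' K' (ϖ' ^ n)) = 1 := fun n => by
      induction n with
      | zero => rw [pow_zero, map_one, spectralNorm_one]
      | succ n ih => rw [pow_succ, map_mul, spectralNorm_mul_eq hV, ih, h, mul_one]
    have h3 := h2 e
    rw [← hw, map_mul, spectralNorm_mul_eq hV, ← IsScalarTower.algebraMap_apply V V' K',
      IsScalarTower.algebraMap_apply V K K', spectralNorm_extends] at h3
    exact absurd h3 ((mul_le_of_le_one_left (norm_nonneg _) (hle w)).trans_lt
      (norm_algebraMap_uniformizer_lt_one hV hϖ)).ne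
  have hk' := norm_pos_iff.2 hk
  rw [functionIndex]
  refine limitIndex_eq hθ hk' ?_ (fun i => ?_) (fun i hi => ?_) (fun i => spectralNorm_nonneg _)
  · rw [hcoef, hunit _ (notMem_maximalIdeal.1 hn1), mul_one]
  · rw [hcoef]
    exact mul_le_of_le_one_right hk'.le (hle _)
  · rw [hcoef]
    refine mul_le_mul_of_nonneg_left ?_ hk'.le
    have h1 := hn2 i hi
    rw [coeff_reducedExpansion, residue_eq_zero_iff, hϖ'.maximalIdeal_eq] at h1
    obtain ⟨w, hw⟩ := Ideal.mem_span_singleton'.1 h1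
    rw [← hw, map_mul, spectralNorm_mul_eq hV]
    exact mul_le_of_le_one_left (spectralNorm_nonneg _) (hle w)

end Tube

/-! ### Normal form of an operator: a scalar times an integral operator nonzero modulo `ϖ` -/

section Scalars

variable {V : Type*} [CommRing V] [IsDomain V] {K : Type*} [Field K] [Algebra V K]
  [IsFractionRing V K]

/-- Elements of the localization have a common denominator; `c` is its inverse, hence nonzero even
for `x = 0`. -/
theorem exists_eq_tmul {M : Type*} [AddCommGroup M] [Module V M] (x : K ⊗[V] M) :
    ∃ c : K, c ≠ 0 ∧ ∃ m, x = c ⊗ₜ m := by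
  obtain ⟨⟨m, r⟩, h⟩ := IsLocalizedModule.surj (nonZeroDivisors V) (TensorProduct.mk V K M 1) x
  have hr : algebraMap V K r ≠ 0 := IsFractionRing.to_map_ne_zero_of_mem_nonZeroDivisors r.2
  refine ⟨(algebraMap V K r)⁻¹, inv_ne_zero hr, m, ?_⟩
  have h' : algebraMap V K r • x = 1 ⊗ₜ m := by
    rw [algebraMap_smul]; exact h
  rw [← inv_smul_smul₀ hr x, h', TensorProduct.smul_tmul', smul_eq_mul, mul_one]

theorem one_tmul_injective [IsDiscreteValuationRing V] {ϖ : V} (hϖ : Irreducible ϖ)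
    {M : Type*} [AddCommGroup M] [Module V M] (hM : ∀ m : M, ϖ • m = 0 → m = 0) :
    Function.Injective (TensorProduct.mk V K M 1) := by
  refine (injective_iff_map_eq_zero _).2 fun m hm => ?_
  obtain ⟨⟨r, hr0⟩, hr⟩ := (IsLocalizedModule.eq_zero_iff (nonZeroDivisors V) _).1 hm
  obtain ⟨n, u, rfl⟩ := IsDiscreteValuationRing.eq_unit_mul_pow_irreducible
    (nonZeroDivisors.ne_zero hr0) hϖ
  change ((u : V) * ϖ ^ n) • m = 0 at hr
  rw [mul_smul] at hr
  replace hr : ϖ ^ n • m = 0 := (smul_eq_zero_iff_eq u).1 hr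
  clear hr0 hm
  induction n with
  | zero => simpa using hr
  | succ n ih => exact ih (hM _ (by rw [smul_smul, ← pow_succ', hr]))

theorem algebraMap_tmul {V : Type*} [CommRing V] {K : Type*} [CommRing K] [Algebra V K]
    {M : Type*} [AddCommGroup M] [Module V M] (v : V) (m : M) :
    algebraMap V K v ⊗ₜ[V] m = (1 : K) ⊗ₜ[V] (v • m) := by
  rw [← TensorProduct.smul_tmul, Algebra.smul_def, mul_one]

end Scalars

section NormalForm

variable {V : Type*} [CommRing V] [IsDomain V] [IsDiscreteValuationRing V]
  {K : Type*} [NormedField K] [Algebra V K] {ϖ : V}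
  {D : Type*} [Ring D] [Algebra V D]

theorem exists_eq_tmul_of_ne_zero [IsFractionRing V K] (hϖ : Irreducible ϖ)
    (hD : ∀ P : D, ϖ • P = 0 → P = 0) {H : K ⊗[V] Completion ϖ D} (hH : H ≠ 0) :
    ∃ c : K, c ≠ 0 ∧ ∃ H₀ : Completion ϖ D, H₀.1 1 ≠ 0 ∧ H = c ⊗ₜ H₀ := by
  obtain ⟨c, hc, H₁, rfl⟩ := exists_eq_tmul H
  obtain ⟨n, H₀, rfl, h0⟩ := Completion.exists_pow_smul hD (H := H₁)
    (by rintro rfl; exact hH (TensorProduct.tmul_zero _ _))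
  refine ⟨ϖ ^ n • c, ?_, H₀, h0, (TensorProduct.smul_tmul _ _ _).symm⟩
  rw [Algebra.smul_def]
  exact mul_ne_zero (IsFractionRing.to_map_ne_zero_of_mem_nonZeroDivisors
    (mem_nonZeroDivisors_of_ne_zero (pow_ne_zero n hϖ.ne_zero))) hc

theorem isUnit_of_smul_val_one_ne_zero (hϖ : Irreducible ϖ) {v : V} {H : Completion ϖ D}
    (h : (v • H).1 1 ≠ 0) : IsUnit v := by
  by_contra hv
  obtain ⟨w, rfl⟩ : ϖ ∣ v := by
    rw [← Ideal.mem_span_singleton, ← hϖ.maximalIdeal_eq]; exact hv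
  rw [mul_smul] at h
  exact h (Completion.smul_val_one_eq_zero _)

/-- The normal form is unique up to a unit: one of `e`, `e⁻¹` lies in `V`, and if it were not a
unit, `Y` or `X` would vanish modulo `ϖ`. -/
theorem exists_unit_of_tmul_eq_one_tmul [IsUltrametricDist K]
    (hV : (NormedField.valuation (K := K)).Integers V)
    (hϖ : Irreducible ϖ) (hD : ∀ P : D, ϖ • P = 0 → P = 0) {e : K} {X Y : Completion ϖ D}
    (hX : X.1 1 ≠ 0) (hY : Y.1 1 ≠ 0) (h : e ⊗ₜ[V] X = (1 : K) ⊗ₜ[V] Y) :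
    ∃ v : Vˣ, e = algebraMap V K v ∧ (v : V) • X = Y := by
  have := hV.isFractionRing
  have hinj := one_tmul_injective (K := K) hϖ
    (fun m : Completion ϖ D => Completion.eq_zero_of_smul_eq_zero hD)
  rcases le_total ‖e‖ 1 with he | he
  · obtain ⟨v, rfl⟩ := exists_algebraMap_eq_of_norm_le_one hV he
    rw [algebraMap_tmul] at h
    obtain rfl : v • X = Y := hinj h
    exact ⟨(isUnit_of_smul_val_one_ne_zero hϖ hY).unit, rfl, rfl⟩
  · have he0 : e ≠ 0 := by rintro rfl; simp at he; linarith
    obtain ⟨v, hv⟩ := exists_algebraMap_eq_of_norm_le_one hV (r := e⁻¹)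
      (by rw [norm_inv]; exact inv_le_one_of_one_le₀ he)
    have h1 : X = v • Y := by
      refine hinj ?_
      rw [TensorProduct.mk_apply, TensorProduct.mk_apply, ← algebraMap_tmul, hv]
      rw [← mul_one e⁻¹, ← smul_eq_mul, ← TensorProduct.smul_tmul', ← h, TensorProduct.smul_tmul',
        smul_eq_mul, inv_mul_cancel₀ he0]
    subst h1
    obtain ⟨u, rfl⟩ := isUnit_of_smul_val_one_ne_zero hϖ hX
    refine ⟨u⁻¹, ?_, by rw [smul_smul, Units.inv_mul, one_smul]⟩
    rw [map_units_inv, hv, inv_inv]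

end NormalForm

/-! ### Restriction to a basic open -/

section Restriction

variable {V R S : Type*} [CommRing V] [CommRing R] [Algebra V R] [CommRing S] [Algebra V S]
  {δ : Derivation V R R} {δ' : Derivation V S S} {ϖ : V}

theorem DiffOp.coeff_map (φ : R →ₐ[V] S) (hφ : ∀ a, φ (δ a) = δ' (φ a)) (n : ℕ) (P : DiffOp δ) :
    coeff δ' n (map φ hφ P) = φ (coeff δ n P) :=
  Finsupp.mapRange_apply (hf := map_zero φ.toLinearMap)

theorem Completion.mk_map {D E : Type*} [Ring D] [Algebra V D] [Ring E] [Algebra V E]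
    (φ : D →ₐ[V] E) {H : Completion ϖ D} {n : ℕ} {P : D} (hP : Ideal.Quotient.mk _ P = H.1 n) :
    Ideal.Quotient.mk _ (φ P) = (Completion.map ϖ φ H).1 n := by
  have h : ∀ Q ∈ scalarIdeal (ϖ ^ n) D,
      (Ideal.Quotient.mkₐ V (scalarIdeal (ϖ ^ n) E)).comp φ Q = 0 := fun Q hQ => by
    obtain ⟨T, rfl⟩ := mem_scalarIdeal.1 hQ
    exact Ideal.Quotient.eq_zero_iff_mem.2 (mem_scalarIdeal.2 ⟨φ T, (map_smul φ _ T).symm⟩)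
  exact congrArg (Ideal.Quotient.liftₐ _ _ h) hP

theorem HasLeadingCoeff.map {H : Completion ϖ (DiffOp δ)} {n : ℕ} {a : R}
    (hH : HasLeadingCoeff H n a) (φ : R →ₐ[V] S) (hφ : ∀ a, φ (δ a) = δ' (φ a))
    (ha : φ a ∉ Ideal.span {algebraMap V S ϖ}) :
    HasLeadingCoeff (Completion.map ϖ (DiffOp.map φ hφ) H) n (φ a) := by
  obtain ⟨-, P, hP, hPn, hPl⟩ := hH
  have hmem : ∀ b ∈ Ideal.span {algebraMap V R ϖ}, φ b ∈ Ideal.span {algebraMap V S ϖ} := by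
    intro b hb
    obtain ⟨r, rfl⟩ := Ideal.mem_span_singleton'.1 hb
    exact Ideal.mem_span_singleton'.2 ⟨φ r, by rw [map_mul, AlgHom.commutes]⟩
  refine ⟨ha, DiffOp.map φ hφ P, Completion.mk_map _ hP, ?_, fun l hl => ?_⟩
  · rw [DiffOp.coeff_map, ← map_sub]
    exact hmem _ hPn
  · rw [DiffOp.coeff_map]
    exact hmem _ (hPl l hl)

end Restriction

section Away

variable {V A : Type*} [CommRing V] [CommRing A] [Algebra V A] {ϖ : V} {f : A}

theorem span_algebraMap_away (f : A) :
    Ideal.span {algebraMap V (Localization.Away f) ϖ} =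
      (Ideal.span {algebraMap V A ϖ}).map (algebraMap A (Localization.Away f)) := by
  rw [Ideal.map_span, Set.image_singleton, ← IsScalarTower.algebraMap_apply]

theorem isPrime_span_away [hp : (Ideal.span {algebraMap V A ϖ}).IsPrime]
    (hf : f ∉ Ideal.span {algebraMap V A ϖ}) :
    (Ideal.span {algebraMap V (Localization.Away f) ϖ}).IsPrime := by
  rw [span_algebraMap_away]
  refine IsLocalization.isPrime_of_isPrime_disjoint (Submonoid.powers f) _ _ hp ?_
  exact (Ideal.disjoint_powers_iff_notMem f hp.isRadical).2 hf

/-- Inverting an element outside a prime ideal loses nothing modulo that prime; thus restriction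
keeps leading coefficients nonzero. -/
theorem mem_span_of_algebraMap_mem_away [hp : (Ideal.span {algebraMap V A ϖ}).IsPrime]
    (hf : f ∉ Ideal.span {algebraMap V A ϖ}) {a : A}
    (ha : algebraMap A (Localization.Away f) a ∈
      Ideal.span {algebraMap V (Localization.Away f) ϖ}) : a ∈ Ideal.span {algebraMap V A ϖ} := by
  rw [span_algebraMap_away] at ha
  have := IsLocalization.under_map_of_isPrime_disjoint (Submonoid.powers f)
    (Localization.Away f) hp ((Ideal.disjoint_powers_iff_notMem f hp.isRadical).2 hf)
  rw [← this]
  exact ha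

theorem smul_eq_zero_away (hA : ∀ a : A, ϖ • a = 0 → a = 0) (b : Localization.Away f)
    (hb : ϖ • b = 0) : b = 0 := by
  obtain ⟨a, s, rfl⟩ := IsLocalization.exists_mk'_eq (Submonoid.powers f) b
  rw [Algebra.smul_def, IsScalarTower.algebraMap_apply V A, IsLocalization.mul_mk'_eq_mk'_of_mul,
    IsLocalization.mk'_eq_zero_iff] at hb
  obtain ⟨r, hr⟩ := hb
  rw [IsLocalization.mk'_eq_zero_iff]
  exact ⟨r, hA _ (by rw [← mul_smul_comm, Algebra.smul_def, hr])⟩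

end Away

/-! ### The invariants in terms of degree and leading coefficient -/

section Invariants

open IsLocalRing PowerSeries

variable {V : Type*} [CommRing V] [IsDomain V] [IsDiscreteValuationRing V]
  {K : Type*} [NormedField K] [IsUltrametricDist K] [CompleteSpace K] [Algebra V K]
  {ϖ : V} {A : Type*} [CommRing A] [Algebra V A] [IsAdicComplete (Ideal.span {algebraMap V A ϖ}) A]
  {t : A} {D : Derivation V A A} {k : ℕ}

theorem coeffQ_tmul {V : Type*} [CommRing V] {K : Type*} [NormedField K] [Algebra V K] {ϖ : V}
    {A : Type*} [CommRing A] [Algebra V A] [IsAdicComplete (Ideal.span {algebraMap V A ϖ}) A]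
    {D : Derivation V A A} {k : ℕ} (c : K) (H : Dhat ϖ k D) (n : ℕ) :
    coeffQ (c ⊗ₜ[V] H : DhatQ K ϖ k D) n = c ⊗ₜ coeffHat (ϖ ^ k • D) ϖ n H :=
  LinearMap.baseChange_tmul _ _ _

theorem spNorm_tmul_lt (hV : (NormedField.valuation (K := K)).Integers V)
    (hϖ : Irreducible ϖ) {c : K} (hc : c ≠ 0) {a : A}
    (ha : a ∈ Ideal.span {algebraMap V A ϖ}) : spNorm K (c ⊗ₜ[V] a : K ⊗[V] A) < ‖c‖ := by
  obtain ⟨b, rfl⟩ := Ideal.mem_span_singleton'.1 ha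
  rw [mul_comm, ← Algebra.smul_def, ← TensorProduct.smul_tmul, Algebra.smul_def]
  refine (spNorm_tmul_le hV hϖ _ _).trans_lt ?_
  rw [norm_mul]
  exact mul_lt_of_lt_one_left (norm_pos_iff.2 hc) (norm_algebraMap_uniformizer_lt_one hV hϖ)

theorem spNorm_zero (hV : (NormedField.valuation (K := K)).Integers V) (hϖ : Irreducible ϖ) :
    spNorm K (0 : K ⊗[V] A) = 0 := by
  refine le_antisymm ?_ (Real.iSup_nonneg fun z =>
    let _ : Field (K ⊗[V] A ⧸ z.asIdeal) := Ideal.Quotient.field z.asIdeal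
    spectralNorm_nonneg _)
  have := spNorm_tmul_le hV hϖ (0 : K) (0 : A)
  rwa [TensorProduct.zero_tmul, norm_zero] at this

variable [PerfectField (ResidueField V)]

theorem spNorm_tmul_of_notMem (hV : (NormedField.valuation (K := K)).Integers V)
    (hϖ : Irreducible ϖ) (ht : IsEtaleCoordinate ϖ t)
    (hp : (Ideal.span {algebraMap V A ϖ}).IsPrime) (c : K) {a : A}
    (ha : a ∉ Ideal.span {algebraMap V A ϖ}) : spNorm K (c ⊗ₜ[V] a : K ⊗[V] A) = ‖c‖ := by
  have := isAdicComplete_of_integers hV hϖ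
  obtain ⟨G, hG, hn, φ, hφ⟩ := exists_integral_point hϖ ht hp ha
  have hfree : Module.Free V (AdjoinRoot G) := .of_basis (AdjoinRoot.powerBasis' hG).basis
  have hfin : Module.Finite V (AdjoinRoot G) := .of_basis (AdjoinRoot.powerBasis' hG).basis
  have : Nontrivial (K ⊗[V] AdjoinRoot G) := by
    have : FaithfulSMul V K := (faithfulSMul_iff_algebraMap_injective V K).2 hV.hom_inj
    infer_instance
  exact spNorm_tmul_eq hV hϖ φ c a hφ

theorem opNorm_tmul (hV : (NormedField.valuation (K := K)).Integers V)
    (hϖ : Irreducible ϖ) (ht : IsEtaleCoordinate ϖ t)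
    (hp : (Ideal.span {algebraMap V A ϖ}).IsPrime) (c : K) {H : Dhat ϖ k D} {n : ℕ} {a : A}
    (hH : HasLeadingCoeff H n a) : opNorm (c ⊗ₜ[V] H : DhatQ K ϖ k D) = ‖c‖ := by
  have hb : ∀ l, spNorm K (coeffQ (c ⊗ₜ[V] H : DhatQ K ϖ k D) l) ≤ ‖c‖ := fun l => by
    rw [coeffQ_tmul]; exact spNorm_tmul_le hV hϖ _ _
  refine le_antisymm (ciSup_le hb) ?_
  rw [← spNorm_tmul_of_notMem hV hϖ ht hp c hH.coeffHat_notMem, ← coeffQ_tmul]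
  exact le_ciSup (f := fun l => spNorm K (coeffQ (c ⊗ₜ[V] H : DhatQ K ϖ k D) l))
    ⟨_, by rintro _ ⟨l, rfl⟩; exact hb l⟩ n

/-- Coefficients above degree `n` are divisible by `ϖ`, hence of norm strictly below `‖c‖`, and the
`n`-th attains it. -/
theorem Nbar_tmul (hV : (NormedField.valuation (K := K)).Integers V)
    (hϖ : Irreducible ϖ) (ht : IsEtaleCoordinate ϖ t)
    (hp : (Ideal.span {algebraMap V A ϖ}).IsPrime) {c : K} (hc : c ≠ 0) {H : Dhat ϖ k D} {n : ℕ}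
    {a : A} (hH : HasLeadingCoeff H n a) : Nbar (c ⊗ₜ[V] H : DhatQ K ϖ k D) = n := by
  rw [Nbar, opNorm_tmul hV hϖ ht hp c hH]
  refine le_antisymm (iSup₂_le fun l hl => ?_) (le_iSup₂_of_le n ?_ le_rfl)
  · rw [Nat.cast_le]
    by_contra! h
    refine (spNorm_tmul_lt hV hϖ hc (hH.coeffHat_mem h)).ne ?_
    rw [← coeffQ_tmul]
    exact hl
  · change spNorm K (coeffQ _ _) = _
    rw [coeffQ_tmul]
    exact spNorm_tmul_of_notMem hV hϖ ht hp c hH.coeffHat_notMem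

variable {V' : Type*} [CommRing V'] [IsDomain V'] [IsDiscreteValuationRing V'] [Algebra V V']
  [Module.Finite V V'] [FaithfulSMul V V'] {c' : V'} {ρ : A →ₐ[V] ResidueField V'}
  {K' : Type*} [Field K'] [Algebra V' K'] [Algebra K K'] [Algebra V K'] [IsScalarTower V K K']
  [IsScalarTower V V' K']

/-- The exact coefficient and `a` agree modulo `ϖ`, so they have the same reduced expansion. -/
theorem opIndex_tmul [IsFractionRing V' K'] (hV : (NormedField.valuation (K := K)).Integers V)
    (hϖ : Irreducible ϖ) (ht : IsEtaleCoordinate ϖ t)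
    (hp : (Ideal.span {algebraMap V A ϖ}).IsPrime) (hρ : Function.Surjective ρ)
    {s : A →ₐ[V] V'⟦X⟧} (hs : IsTubeExpansion ρ t c' s)
    (hs' : tubeExpansion ρ t c' = s.toLinearMap) {c : K} (hc : c ≠ 0) {H : Dhat ϖ k D} {n : ℕ}
    {a : A} (hH : HasLeadingCoeff H n a) :
    opIndex ρ t c' K' (c ⊗ₜ[V] H : DhatQ K ϖ k D) = (reducedExpansion s a).order := by
  have h1 : reducedExpansion s (coeffHat (ϖ ^ k • D) ϖ n H) = reducedExpansion s a := by
    rw [← sub_eq_zero, ← map_sub]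
    exact reducedExpansion_eq_zero hϖ s hH.coeffHat_sub_mem
  rw [opIndex, Nbar_tmul hV hϖ ht hp hc hH, ENat.toNat_natCast, coeffQ_tmul, ← h1]
  refine functionIndex_tmul hV hϖ hs' hc ?_
  rw [h1]
  exact reducedExpansion_ne_zero hϖ ht hp hρ hs hH.1

end Invariants

/-! ### Inverses and the zero operator -/

section Inverse

variable {V : Type*} [CommRing V] [IsDomain V] [IsDiscreteValuationRing V]
  {K : Type*} [NormedField K] [IsUltrametricDist K] [Algebra V K] {ϖ : V}
  {D : Type*} [Ring D] [Algebra V D]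

theorem nontrivial_tensorProduct_completion (hV : (NormedField.valuation (K := K)).Integers V)
    (hϖ : Irreducible ϖ) (hD : ∀ P : D, ϖ • P = 0 → P = 0)
    (h1 : (1 : Completion ϖ D).1 1 ≠ 0) : Nontrivial (K ⊗[V] Completion ϖ D) := by
  have := hV.isFractionRing
  refine ⟨1, 0, fun h => h1 ?_⟩
  have h0 : (1 : Completion ϖ D) = 0 :=
    one_tmul_injective (K := K) hϖ
      (fun m : Completion ϖ D => Completion.eq_zero_of_smul_eq_zero hD)
      (h.trans (TensorProduct.tmul_zero _ _).symm)
  rw [h0]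
  rfl

/-- Write `Q = d ⊗ Y` in normal form. By `hmul`, `X * Y` is nonzero modulo `ϖ`, so `(c * d) ⊗ (X *
Y) = 1` forces `c * d` to be a unit of `V`, which is absorbed into `Y`. -/
theorem exists_eq_inv_tmul_of_mul_eq_one (hV : (NormedField.valuation (K := K)).Integers V)
    (hϖ : Irreducible ϖ) (hD : ∀ P : D, ϖ • P = 0 → P = 0)
    (h1 : (1 : Completion ϖ D).1 1 ≠ 0)
    (hmul : ∀ X Y : Completion ϖ D, X.1 1 ≠ 0 → Y.1 1 ≠ 0 → (X * Y).1 1 ≠ 0) {c : K} (hc : c ≠ 0)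
    {X : Completion ϖ D} (hX : X.1 1 ≠ 0) {Q : K ⊗[V] Completion ϖ D} (hQ : c ⊗ₜ X * Q = 1) :
    ∃ Y, X * Y = 1 ∧ Q = c⁻¹ ⊗ₜ Y := by
  have := hV.isFractionRing
  have := nontrivial_tensorProduct_completion hV hϖ hD h1
  obtain ⟨d, hd, Y, hY, rfl⟩ := exists_eq_tmul_of_ne_zero hϖ hD (H := Q)
    (by rintro rfl; rw [mul_zero] at hQ; exact zero_ne_one hQ)
  rw [Algebra.TensorProduct.tmul_mul_tmul] at hQ
  obtain ⟨v, hv, hv1⟩ := exists_unit_of_tmul_eq_one_tmul hV hϖ hD (hmul X Y hX hY) h1 hQ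
  refine ⟨(v : V) • Y, by rw [mul_smul_comm, hv1], ?_⟩
  rw [← TensorProduct.smul_tmul, Algebra.smul_def, ← hv, mul_comm c d, mul_inv_cancel_right₀ hc]

end Inverse

section Zero

open IsLocalRing

variable {V : Type*} [CommRing V] [IsDomain V] [IsDiscreteValuationRing V]
  {K : Type*} [NormedField K] [IsUltrametricDist K] [CompleteSpace K] [Algebra V K]
  {ϖ : V} {A : Type*} [CommRing A] [Algebra V A] [IsAdicComplete (Ideal.span {algebraMap V A ϖ}) A]
  {D : Derivation V A A} {k : ℕ}

theorem coeffQ_zero {V : Type*} [CommRing V] {K : Type*} [NormedField K] [Algebra V K] {ϖ : V}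
    {A : Type*} [CommRing A] [Algebra V A] [IsAdicComplete (Ideal.span {algebraMap V A ϖ}) A]
    {D : Derivation V A A} {k : ℕ} (n : ℕ) : coeffQ (0 : DhatQ K ϖ k D) n = 0 :=
  map_zero _

theorem opNorm_zero (hV : (NormedField.valuation (K := K)).Integers V) (hϖ : Irreducible ϖ) :
    opNorm (0 : DhatQ K ϖ k D) = 0 := by
  simp only [opNorm, coeffQ_zero, spNorm_zero hV hϖ, ciSup_const]

theorem Nbar_zero (hV : (NormedField.valuation (K := K)).Integers V) (hϖ : Irreducible ϖ) :
    Nbar (0 : DhatQ K ϖ k D) = ⊤ := by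
  simp only [Nbar, opNorm_zero hV hϖ, coeffQ_zero, spNorm_zero hV hϖ, Set.ofPred_true,
    Set.mem_univ, iSup_pos]
  exact ENat.iSup_natCast_eq_top.2 fun ⟨n, hn⟩ => absurd (hn ⟨n + 1, rfl⟩) (by simp)

theorem opIndex_zero {V : Type*} [CommRing V] {K : Type*} [NormedField K] [Algebra V K] {ϖ : V}
    {A : Type*} [CommRing A] [Algebra V A] [IsAdicComplete (Ideal.span {algebraMap V A ϖ}) A]
    {D : Derivation V A A} {k : ℕ} {V' : Type*} [CommRing V'] [IsLocalRing V'] [Algebra V V']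
    {t : A} {c' : V'} {ρ : A →ₐ[V] ResidueField V'} {K' : Type*} [Field K'] [Algebra V' K']
    [Algebra K K'] [Algebra V K'] [IsScalarTower V K K'] [IsScalarTower V V' K'] :
    opIndex ρ t c' K' (0 : DhatQ K ϖ k D) = ⊤ := by
  rw [opIndex, coeffQ_zero, functionIndex_zero]

end Zero

end ArithDiff

end

/-! ### Assembly of the theorem -/

set_option maxHeartbeats 400000 in
theorem mainTheorem12
    -- a complete discrete valuation ring `V` of mixed characteristic `(0, p)` with perfect residue
    -- field, its fraction field `K` with its absolute value, a uniformizer `ϖ`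
    (p : ℕ) [Fact p.Prime]
    {V : Type*} [CommRing V] [IsDomain V] [IsDiscreteValuationRing V]
    [CharP (IsLocalRing.ResidueField V) p] [PerfectField (IsLocalRing.ResidueField V)]
    {K : Type*} [NormedField K] [IsUltrametricDist K] [CompleteSpace K] [CharZero K] [Algebra V K]
    (hV : (NormedField.valuation (K := K)).Integers V)
    (ϖ : V) (hϖ : Irreducible ϖ)
    -- a connected affine smooth formal curve `U = Spf A` with an étale coordinate `t` and the
    -- derivation `D = ∂` dual to `dt`
    {A : Type*} [CommRing A] [Algebra V A] [IsAdicComplete (Ideal.span {algebraMap V A ϖ}) A]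
    [ConnectedSpace (PrimeSpectrum (A ⧸ Ideal.span {algebraMap V A ϖ}))]
    (t : A) (ht : ArithDiff.IsEtaleCoordinate ϖ t)
    (D : Derivation V A A) (hD : D t = 1)
    -- a closed point `x`
    (x : Ideal A) (hx : x.IsMaximal)
    -- a finite extension `K'` of `K` with ring of integers `V'`, whose residue field is identified
    -- with that of `x`, and a lift `c` of `t(x)`
    {V' : Type*} [CommRing V'] [IsDomain V'] [IsDiscreteValuationRing V'] [Algebra V V']
    [Module.Finite V V']
    {K' : Type*} [Field K'] [Algebra V' K'] [IsFractionRing V' K'] [Algebra K K'] [Algebra V K']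
    [IsScalarTower V K K'] [IsScalarTower V V' K']
    (ρ : A →ₐ[V] IsLocalRing.ResidueField V') (hρ : Function.Surjective ρ)
    (hρx : RingHom.ker ρ = x)
    (c : V') (hc : IsLocalRing.residue V' c = ρ t)
    -- the congruence level and an operator
    (k : ℕ) (H : ArithDiff.DhatQ K ϖ k D) :
    (ArithDiff.IsInvertibleNear x H ↔
      ArithDiff.Nbar H = 0 ∧ ArithDiff.opIndex ρ t c K' H = 0) ∧
    (ArithDiff.opNorm H = 1 → ∀ f : A, f ∉ x →
      ∀ Q : ArithDiff.DhatQ K ϖ k (ArithDiff.localizedDerivation D f),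
        ArithDiff.restrict K ϖ k D f H * Q = 1 → Q * ArithDiff.restrict K ϖ k D f H = 1 →
          ∃ Q₀ : ArithDiff.Dhat ϖ k (ArithDiff.localizedDerivation D f), Q = 1 ⊗ₜ[V] Q₀) ∧
    (∀ Q : ArithDiff.DhatQ K ϖ k D,
      ArithDiff.opNorm (H * Q) = ArithDiff.opNorm H * ArithDiff.opNorm Q ∧
      ArithDiff.Nbar (H * Q) = ArithDiff.Nbar H + ArithDiff.Nbar Q ∧
      ArithDiff.opIndex ρ t c K' (H * Q) =
        ArithDiff.opIndex ρ t c K' H + ArithDiff.opIndex ρ t c K' Q) := by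
  open ArithDiff in
  have : IsFractionRing V K := hV.isFractionRing
  have : IsAdicComplete (Ideal.span {ϖ}) V := isAdicComplete_of_integers hV hϖ
  have : FaithfulSMul V V' := (faithfulSMul_iff_algebraMap_injective V V').2 fun a b hab => by
    refine hV.hom_inj ((algebraMap K K').injective ?_)
    rw [← IsScalarTower.algebraMap_apply V K K', ← IsScalarTower.algebraMap_apply V K K',
      IsScalarTower.algebraMap_apply V V' K', hab, ← IsScalarTower.algebraMap_apply V V' K']
  have hp : (Ideal.span {algebraMap V A ϖ}).IsPrime := isPrime_span_uniformizer hϖ ht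
  have hA := eq_zero_of_uniformizer_smul_eq_zero hϖ ht
  obtain ⟨s, hs, hs'⟩ := tubeExpansion_eq (exists_isTubeExpansion hϖ ht hc)
  have hxϖ : Ideal.span {algebraMap V A ϖ} ≤ x := by
    rw [Ideal.span_singleton_le_iff_mem, ← hρx, RingHom.mem_ker]
    exact (ρ.commutes ϖ).trans (algebraMap_residueField_uniformizer hϖ)
  -- The constant term of the reduced expansion is the value of `a` at `x`.
  have hord : ∀ a, (reducedExpansion s a).order = 0 ↔ a ∉ x := fun a => by
    rw [← not_iff_not, not_not, ← Ne, PowerSeries.order_ne_zero_iff_constCoeff_eq_zero,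
      constantCoeff_reducedExpansion hs, ← hρx, RingHom.mem_ker]
  have hform : ∀ H : DhatQ K ϖ k D, H ≠ 0 → ∃ d : K, d ≠ 0 ∧ ∃ (H₀ : Dhat ϖ k D) (n : ℕ) (a : A),
      HasLeadingCoeff H₀ n a ∧ H = d ⊗ₜ H₀ := fun H hH => by
    obtain ⟨d, hd, H₀, h0, rfl⟩ := exists_eq_tmul_of_ne_zero hϖ
      (DiffOp.smul_eq_zero_of_regular hA) hH
    obtain ⟨n, a, h⟩ := HasLeadingCoeff.exists_of_val_one_ne_zero h0
    exact ⟨d, hd, H₀, n, a, h, rfl⟩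
  have hloc : ∀ f, f ∉ x → (Ideal.span {algebraMap V (Localization.Away f) ϖ}).IsPrime ∧
      (∀ P : DiffOp (ϖ ^ k • localizedDerivation D f), ϖ • P = 0 → P = 0) ∧
      ∀ {H₀ : Dhat ϖ k D} {n : ℕ} {a : A}, HasLeadingCoeff H₀ n a →
        HasLeadingCoeff (restrictHat ϖ k D f H₀) n (algebraMap A (Localization.Away f) a) :=
    fun f hf =>
      have hf' : f ∉ Ideal.span {algebraMap V A ϖ} := fun h => hf (hxϖ h)
      ⟨isPrime_span_away hf', DiffOp.smul_eq_zero_of_regular (smul_eq_zero_away hA),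
        fun hH => hH.map _ _ fun h => hH.1 (mem_span_of_algebraMap_mem_away hf' h)⟩
  have hinv : ∀ f, f ∉ x → ∀ {d : K}, d ≠ 0 → ∀ {H₀ : Dhat ϖ k D} {n : ℕ} {a : A},
      HasLeadingCoeff H₀ n a → ∀ Q : DhatQ K ϖ k (localizedDerivation D f),
      restrict K ϖ k D f (d ⊗ₜ H₀) * Q = 1 →
        ∃ Y, restrictHat ϖ k D f H₀ * Y = 1 ∧ Q = d⁻¹ ⊗ₜ Y := by
    intro f hf d hd H₀ n a hH Q hQ
    obtain ⟨_, hDf, hres⟩ := hloc f hf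
    refine exists_eq_inv_tmul_of_mul_eq_one hV hϖ hDf HasLeadingCoeff.one.val_one_ne_zero ?_ hd
      (hres hH).val_one_ne_zero hQ
    intro X Y hX hY
    obtain ⟨_, _, hX⟩ := HasLeadingCoeff.exists_of_val_one_ne_zero hX
    obtain ⟨_, _, hY⟩ := HasLeadingCoeff.exists_of_val_one_ne_zero hY
    exact (hX.mul hY).val_one_ne_zero
  refine ⟨⟨?_, ?_⟩, ?_, ?_⟩
  · rintro ⟨f, hf, hu⟩
    obtain ⟨_, hDf, hres⟩ := hloc f hf
    have := nontrivial_tensorProduct_completion hV hϖ hDf HasLeadingCoeff.one.val_one_ne_zero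
    obtain ⟨d, hd, H₀, n, a, hH, rfl⟩ := hform H (by
      rintro rfl
      rw [map_zero] at hu
      exact not_isUnit_zero hu)
    obtain ⟨Q, hQ⟩ := hu.exists_right_inv
    obtain ⟨Y, hY, -⟩ := hinv f hf hd hH Q hQ
    have h1 : Y.1 1 ≠ 0 := fun h => by
      refine HasLeadingCoeff.one.val_one_ne_zero (R := Localization.Away f)
        (δ := ϖ ^ k • localizedDerivation D f) (ϖ := ϖ) ?_
      rw [← hY]
      change (restrictHat ϖ k D f H₀).1 1 * Y.1 1 = 0
      rw [h, mul_zero]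
    obtain ⟨m, b, hYb⟩ := HasLeadingCoeff.exists_of_val_one_ne_zero h1
    have h2 := (hres hH).mul hYb
    rw [hY] at h2
    -- The identity has degree 0 and leading coefficient 1, so `H₀ * Y = 1` gives `n + m = 0` and `a
    -- * b ≡ 1` modulo `ϖ` on `D(f)`.
    obtain ⟨hnm, hab⟩ := HasLeadingCoeff.one.unique h2
    rw [Nbar_tmul hV hϖ ht hp hd hH, opIndex_tmul hV hϖ ht hp hρ hs hs' hd hH, hord]
    refine ⟨by rw [Nat.cast_eq_zero]; omega, fun hax => ?_⟩
    have hxp := hx.isPrime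
    -- If `a ∈ x`, this congruence puts 1 in the ideal generated by `x` in `A_f`, which is proper
    -- because `f ∉ x`.
    refine (IsLocalization.isPrime_of_isPrime_disjoint (Submonoid.powers f)
      (Localization.Away f) x hxp ((Ideal.disjoint_powers_iff_notMem f hxp.isRadical).2 hf)).ne_top
      ((Ideal.eq_top_iff_one _).2 ?_)
    rw [span_algebraMap_away] at hab
    have h3 := add_mem (Ideal.map_mono hxϖ hab)
      (Ideal.mul_mem_right b _ (Ideal.mem_map_of_mem (algebraMap A (Localization.Away f)) hax))
    rwa [sub_add_cancel] at h3
  · rintro ⟨hN, hI⟩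
    obtain ⟨d, hd, H₀, n, a, hH, rfl⟩ := hform H (by
      rintro rfl
      rw [Nbar_zero hV hϖ] at hN
      exact absurd hN (by simp))
    rw [Nbar_tmul hV hϖ ht hp hd hH, Nat.cast_eq_zero] at hN
    rw [opIndex_tmul hV hϖ ht hp hρ hs hs' hd hH, hord] at hI
    subst hN
    -- The leading coefficient itself defines the neighbourhood: on `D(a)` it is a unit.
    refine ⟨a, hI, ?_⟩
    have h1 : IsUnit (restrictHat ϖ k D a H₀) := ((hloc a hI).2.2 hH).isUnit
      (IsLocalization.Away.algebraMap_isUnit a)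
    have h2 : restrict K ϖ k D a (d ⊗ₜ H₀) =
        (d ⊗ₜ 1 : DhatQ K ϖ k (localizedDerivation D a)) * 1 ⊗ₜ restrictHat ϖ k D a H₀ := by
      rw [Algebra.TensorProduct.tmul_mul_tmul, mul_one, one_mul]
      rfl
    rw [h2]
    exact ((isUnit_iff_ne_zero.2 hd).map Algebra.TensorProduct.includeLeftRingHom).mul
      (h1.map Algebra.TensorProduct.includeRight)
  · intro hN f hf Q hQ _
    obtain ⟨d, hd, H₀, n, a, hH, rfl⟩ := hform H (by
      rintro rfl
      rw [opNorm_zero hV hϖ] at hN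
      exact zero_ne_one hN)
    obtain ⟨Y, -, rfl⟩ := hinv f hf hd hH Q hQ
    rw [opNorm_tmul hV hϖ ht hp d hH] at hN
    -- Norm 1 means `|d| = 1`, so `d⁻¹` lies in `V` and can be moved into the integral factor.
    obtain ⟨v, hv⟩ := exists_algebraMap_eq_of_norm_le_one hV (r := d⁻¹)
      (by rw [norm_inv, hN, inv_one])
    exact ⟨v • Y, hv ▸ algebraMap_tmul v Y⟩
  · intro Q
    rcases eq_or_ne H 0 with rfl | hH0
    · rw [zero_mul, opNorm_zero hV hϖ, Nbar_zero hV hϖ, opIndex_zero]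
      simp
    rcases eq_or_ne Q 0 with rfl | hQ0
    · rw [mul_zero, opNorm_zero hV hϖ, Nbar_zero hV hϖ, opIndex_zero]
      simp
    obtain ⟨d, hd, H₀, n, a, hH, rfl⟩ := hform H hH0
    obtain ⟨e, he, Q₀, m, b, hQ, rfl⟩ := hform Q hQ0
    have hHQ := hH.mul hQ
    rw [Algebra.TensorProduct.tmul_mul_tmul, opNorm_tmul hV hϖ ht hp _ hHQ,
      opNorm_tmul hV hϖ ht hp _ hH, opNorm_tmul hV hϖ ht hp _ hQ,
      Nbar_tmul hV hϖ ht hp (mul_ne_zero hd he) hHQ, Nbar_tmul hV hϖ ht hp hd hH,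
      Nbar_tmul hV hϖ ht hp he hQ, opIndex_tmul hV hϖ ht hp hρ hs hs' (mul_ne_zero hd he) hHQ,
      opIndex_tmul hV hϖ ht hp hρ hs hs' hd hH, opIndex_tmul hV hϖ ht hp hρ hs hs' he hQ,
      norm_mul, map_mul, PowerSeries.order_mul, Nat.cast_add]
    exact ⟨rfl, rfl, rfl⟩
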